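/- Let $F$ be a finite extension of $\mathbb{Q}_p$ with ring of integers $\mathcal{O}$, uniformizer $\pi$ and residue field of cardinality $q$, and let $K\supseteq F$ be an algebraically closed field, complete for a real-valued valuation $v$ extending that of $F$, normalized by $v(\pi)=1$. Let $H$ be a one-dimensional formal $\mathcal{O}$-module over $\mathcal{O}_K$ of finite $\mathcal{O}$-height $n$ (so the reduction of $[\pi](T)$ modulo $\mathfrak{m}_K$ has order exactly $q^n$). A coordinate identifies $\widehat H(\mathcal{O}_K)$ with $\{x\in\mathcal{O}_K : v(x)>0\}$ and gives $v:\widehat H(\mathcal{O}_K)\to\,]0,+\infty]$. Let $$V=V_p(H)=\{(x_i)_{i\in\mathbb{Z}} : x_i\in\widehat H(\mathcal{O}_K),\ \pi x_{i+1}=x_i,\ x_i=0 \text{ for } i\ll 0\},\qquad T_p(H)=\{x\in V : x_0=0\},$$ and put $v(x)=v(x_0)$ and $\mathrm{Fil}_\lambda V=\{x\in V : v(x)\ge\lambda\}$ for $x\in V$, $\lambda\in\,]0,+\infty]$. The building $\mathcal{I}(V)$ of $\mathrm{PGL}(V)$ is the simplicial complex whose vertices are the homothety classes $[\Lambda]$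 of $\mathcal{O}$-lattices $\Lambda$ in $V$ and whose simplices are the sets $\{[\Lambda_1],\dots,[\Lambda_d]\}$ with $\pi\Lambda_1\subsetneq\Lambda_d\subsetneq\dots\subsetneq\Lambda_1$. The apartment of a basis $(e_1,\dots,e_n)$ of $V$ has vertices $[\langle\pi^{a_1}e_1,\dots,\pi^{a_n}e_n\rangle]$, $a\in\mathbb{Z}^n$; the vertices of a quartier (sector) in it with vertex $[\langle\pi^{b_1}e_1,\dots,\pi^{b_n}e_n\rangle]$ are the $[\langle\pi^{b_1+a_1}e_1,\dots,\pi^{b_n+a_n}e_n\rangle]$ with $a_{\sigma(1)}\ge\dots\ge a_{\sigma(n)}$, for a fixed permutation $\sigma$. Let $\mathcal{N}$ be the Newton polygon of $[\pi](T)=\sum_m a_mT^m$, i.e. the lower convex hull of the points $(m,v(a_m))$. For $1\le i\le n$ let $\lambda_i^{(0)}=+\infty$, let $\lambda_i^{(1)}$ be the slope, with positive sign, of $\mathcal{N}$ between the abscissae $q^{i-1}$ and $q^i$, and for $k\ge1$ let $\lambda_i^{(k+1)}$ be the largest slope, with the same sign convention (the one between the abscissae $0$ and $1$), of the convex hull of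 $\mathcal{N}$ and the point $(0,\lambda_i^{(k)})$. An $\mathcal{O}$-basis $(e_1,\dots,e_n)$ of $T_p(H)$ is called adapted if $v(\pi^{-k}e_i)=\lambda_i^{(k)}$ for all $i$ and all $k\ge1$. Then: 1. Every $\mathrm{Fil}_\lambda V$, $\lambda\in\,]0,+\infty]$, is an $\mathcal{O}$-lattice in $V$, $\mathrm{Fil}_\infty V=T_p(H)$, and the set $\{[\mathrm{Fil}_\lambda V] : \lambda\in\,]0,+\infty]\}$ of vertices of $\mathcal{I}(V)$ is finite. 2. This set is contained in an apartment of $\mathcal{I}(V)$, and more precisely in a quartier with vertex $[T_p(H)]$ in an apartment. 3. This set is connected: the subgraph that it induces in the $1$-skeleton of $\mathcal{I}(V)$ is connected. 4. Adapted bases of $T_p(H)$ exist, and every adapted basis $(e_1,\dots,e_n)$ splits all the $\mathrm{Fil}_\mu V$ simultaneously: for every $\mu\in\,]0,+\infty]$, with $k(i,\mu)=\sup\{k\ge0 : \lambda_i^{(k)}\ge\mu\}$, one has $k(1,\mu)\ge\dots\ge k(n,\mu)$ and $$\mathrm{Fil}_\mu V=\bigoplus_{i=1}^n\mathcal{O}\,\pi^{-k(i,\mu)}e_i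 .$$ -/

import Mathlib

open Filter Topology
open scoped Pointwise

namespace Ramification

noncomputable section

/-- The valuation ring `{‖x‖ ≤ 1}` of an ultrametric normed field. -/
abbrev IntRing (L : Type*) [NormedField L] [IsUltrametricDist L] : ValuationSubring L :=
  (NormedField.valuation (K := L)).valuationSubring

section IntRing
variable {L : Type*} [NormedField L] [IsUltrametricDist L]

lemma mem_intRing {x : L} : x ∈ IntRing L ↔ ‖x‖ ≤ 1 := by
  rw [Valuation.mem_valuationSubring_iff, NormedField.valuation_apply]
  exact Iff.rfl

lemma norm_le_one (x : IntRing L) : ‖(x : L)‖ ≤ 1 := mem_intRing.1 x.2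

instance : IsTopologicalRing (IntRing L) :=
  inferInstanceAs (IsTopologicalRing (IntRing L).toSubring)

instance : IsUniformAddGroup (IntRing L) :=
  inferInstanceAs (IsUniformAddGroup (IntRing L).toSubring.toAddSubgroup)

instance [CompleteSpace L] : CompleteSpace (IntRing L) := by
  have h : IsClosed ((IntRing L : Set L)) := by
    have : (IntRing L : Set L) = Metric.closedBall 0 1 := by
      ext x; simpa using mem_intRing (x := x)
    rw [this]; exact Metric.isClosed_closedBall
  exact h.completeSpace_coe

/-- The ideal `{‖x‖ ≤ r}` of the valuation ring. -/
def ballIdeal (L : Type*) [NormedField L] [IsUltrametricDist L] (r : ℝ) (hr : 0 ≤ r) :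
    Ideal (IntRing L) where
  carrier := {x | ‖(x : L)‖ ≤ r}
  add_mem' {x y} hx hy := (IsUltrametricDist.norm_add_le_max _ _).trans (max_le hx hy)
  zero_mem' := by simpa using hr
  smul_mem' c x hx := by
    have := mul_le_mul (norm_le_one c) hx (norm_nonneg _) zero_le_one
    simpa using this

instance : IsLinearTopology (IntRing L) (IntRing L) := by
  refine IsLinearTopology.mk_of_hasBasis (IntRing L) (ι := ℝ) (p := fun r => 0 < r)
    (s := fun r => ballIdeal L (max r 0) (le_max_right _ _)) ?_
  have h := (Metric.nhds_basis_closedBall (x := (0 : IntRing L)))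
  refine h.congr (fun _ => Iff.rfl) ?_
  intro r hr
  ext x
  simp [ballIdeal, max_eq_left hr.le]


lemma hasEval_of_norm_lt {σ : Type*} [Finite σ] {a : σ → IntRing L}
    (ha : ∀ s, ‖(a s : L)‖ < 1) : MvPowerSeries.HasEval a where
  hpow s := by
    have h : Tendsto (fun n => (a s : L) ^ n) atTop (𝓝 0) :=
      tendsto_pow_atTop_nhds_zero_of_norm_lt_one (ha s)
    rw [IsTopologicallyNilpotent, tendsto_subtype_rng]
    simpa using h
  tendsto_zero := by simp [Filter.cofinite_eq_bot]

lemma hasSum_eval₂_bot {σ R T : Type*} [CommRing R] [CommRing T] [UniformSpace T] [T2Space T]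
    [CompleteSpace T] [IsUniformAddGroup T] [IsTopologicalRing T] [IsLinearTopology T T]
    [Algebra R T] {b : σ → T} (hb : MvPowerSeries.HasEval b) (f : MvPowerSeries σ R) :
    letI : UniformSpace R := ⊥
    HasSum (fun d : σ →₀ ℕ => algebraMap R T (MvPowerSeries.coeff d f) *
      d.prod fun s e => b s ^ e) (MvPowerSeries.eval₂ (algebraMap R T) b f) := by
  let : UniformSpace R := ⊥
  have : DiscreteUniformity R := ⟨rfl⟩
  exact MvPowerSeries.hasSum_eval₂ continuous_of_discreteTopology hb f

lemma tsum_subst {σ τ R T : Type*} [CommRing R] [CommRing T] [UniformSpace T] [T2Space T]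
    [CompleteSpace T] [IsUniformAddGroup T] [IsTopologicalRing T] [IsLinearTopology T T]
    [Algebra R T] {a : σ → MvPowerSeries τ R} (ha : MvPowerSeries.HasSubst a) {b : τ → T}
    (hb : MvPowerSeries.HasEval b)
    (hab : MvPowerSeries.HasEval fun s => ∑' d : τ →₀ ℕ,
      algebraMap R T (MvPowerSeries.coeff d (a s)) * d.prod fun s e => b s ^ e)
    (f : MvPowerSeries σ R) :
    ∑' d : τ →₀ ℕ, algebraMap R T (MvPowerSeries.coeff d (MvPowerSeries.subst a f)) *
        (d.prod fun s e => b s ^ e) =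
      ∑' d : σ →₀ ℕ, algebraMap R T (MvPowerSeries.coeff d f) * d.prod fun s e =>
        (∑' d : τ →₀ ℕ, algebraMap R T (MvPowerSeries.coeff d (a s)) *
          d.prod fun s e => b s ^ e) ^ e := by
  let : UniformSpace R := ⊥
  have : DiscreteUniformity R := ⟨rfl⟩
  rw [(hasSum_eval₂_bot hab f).tsum_eq, (hasSum_eval₂_bot hb _).tsum_eq,
    MvPowerSeries.eval₂_subst ha hb]
  congr 1
  funext s
  rw [(hasSum_eval₂_bot hb _).tsum_eq]

/-- The value at `a` of a power series over the valuation ring, as the sum of its monomials;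
it converges when the family `a` is finite and all `‖a s‖ < 1`. -/
def evalAt {σ : Type*} (f : MvPowerSeries σ (IntRing L)) (a : σ → IntRing L) : IntRing L :=
  ∑' d : σ →₀ ℕ, MvPowerSeries.coeff d f * d.prod fun s e => a s ^ e

section evalAt
variable {σ τ : Type*}

lemma evalAt_zero (a : σ → IntRing L) : evalAt (0 : MvPowerSeries σ (IntRing L)) a = 0 := by
  simp [evalAt]

lemma norm_evalAt_le {f : MvPowerSeries σ (IntRing L)}
    (hf : MvPowerSeries.constantCoeff f = 0) {a : σ → IntRing L} {r : ℝ} (hr : 0 ≤ r)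
    (ha : ∀ s, ‖(a s : L)‖ ≤ r) : ‖(evalAt f a : L)‖ ≤ r := by
  have hc : IsClosed {x : IntRing L | ‖(x : L)‖ ≤ r} :=
    isClosed_le (continuous_norm.comp continuous_subtype_val) continuous_const
  refine tsum_mem (s := ballIdeal L r hr) hc fun d => ?_
  by_cases hd : d = 0
  · subst hd
    simp [hf]
  · apply Ideal.mul_mem_left
    obtain ⟨s, hs⟩ : d.support.Nonempty := by simpa [Finset.nonempty_iff_ne_empty] using hd
    exact Ideal.prod_mem _ hs (Ideal.pow_mem_of_mem _ (ha s) _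
      (Nat.pos_of_ne_zero (by simpa using hs)))

variable [CompleteSpace L]

lemma evalAt_subst [Finite σ] [Finite τ] {a : σ → MvPowerSeries τ (IntRing L)}
    (ha : MvPowerSeries.HasSubst a) {b : τ → IntRing L} (hb : ∀ s, ‖(b s : L)‖ < 1)
    (hab : ∀ s, ‖(evalAt (a s) b : L)‖ < 1) (f : MvPowerSeries σ (IntRing L)) :
    evalAt (MvPowerSeries.subst a f) b = evalAt f (fun s => evalAt (a s) b) :=
  tsum_subst ha (hasEval_of_norm_lt hb) (hasEval_of_norm_lt hab) f

lemma evalAt_X [Finite σ] {a : σ → IntRing L} (ha : ∀ s, ‖(a s : L)‖ < 1) (s : σ) :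
    evalAt (MvPowerSeries.X s) a = a s := by
  have h := MvPowerSeries.hasSum_eval₂ (φ := RingHom.id (IntRing L)) continuous_id
    (hasEval_of_norm_lt ha) (MvPowerSeries.X s)
  rw [MvPowerSeries.eval₂_X] at h
  exact h.tsum_eq

end evalAt

end IntRing

section Formal
variable (F K : Type*) [NormedField F] [IsUltrametricDist F] [NormedField K] [IsUltrametricDist K]
  [NormedAlgebra F K]

/-- The inclusion of valuation rings induced by an isometric extension `K / F`. -/
def intRingMap : IntRing F →+* IntRing K where
  toFun a := ⟨algebraMap F K a, mem_intRing.2 (by rw [norm_algebraMap']; exact norm_le_one a)⟩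
  map_one' := Subtype.ext (map_one _)
  map_mul' _ _ := Subtype.ext (map_mul _ _ _)
  map_zero' := Subtype.ext (map_zero _)
  map_add' _ _ := Subtype.ext (map_add _ _ _)

/-- A one-dimensional formal `𝒪_F`-module over `𝒪_K` (with a chosen coordinate): a commutative
formal group law with a ring homomorphism `a ↦ [a]` from `𝒪_F` to its endomorphisms such that
`[a](T) = a T + ⋯`. -/
structure FormalModule where
  law : FormalGroup (IntRing K)
  comm : law.IsComm
  act : IntRing F → PowerSeries (IntRing K)
  act_constantCoeff : ∀ a, PowerSeries.constantCoeff (act a) = 0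
  act_coeff_one : ∀ a, PowerSeries.coeff 1 (act a) = intRingMap F K a
  act_hom : ∀ a, PowerSeries.subst law.toPowerSeries (act a) =
    MvPowerSeries.subst ![PowerSeries.subst (MvPowerSeries.X 0 : MvPowerSeries (Fin 2) (IntRing K))
        (act a),
      PowerSeries.subst (MvPowerSeries.X 1 : MvPowerSeries (Fin 2) (IntRing K)) (act a)]
      law.toPowerSeries
  act_zero : act 0 = 0
  act_one : act 1 = PowerSeries.X
  act_add : ∀ a b, act (a + b) = MvPowerSeries.subst ![act a, act b] law.toPowerSeries
  act_mul : ∀ a b, act (a * b) = PowerSeries.subst (act b) (act a)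

variable {F K}

/-- The points `Ĥ(𝒪_K)`: the elements of `𝒪_K` of absolute value `< 1`. -/
@[ext]
structure FormalModule.Points (H : FormalModule F K) where
  val : IntRing K
  norm_lt : ‖(val : K)‖ < 1

namespace FormalModule.Points
variable {H : FormalModule F K}

lemma norm_pair_lt {x y : IntRing K} (hx : ‖(x : K)‖ < 1) (hy : ‖(y : K)‖ < 1) (s : Fin 2) :
    ‖((![x, y] s : IntRing K) : K)‖ < 1 := by
  fin_cases s <;> assumption

lemma norm_evalAt_lt {σ : Type*} [Finite σ] [Nonempty σ] {f : MvPowerSeries σ (IntRing K)}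
    (hf : MvPowerSeries.constantCoeff f = 0) {a : σ → IntRing K} (ha : ∀ s, ‖(a s : K)‖ < 1) :
    ‖(evalAt f a : K)‖ < 1 := by
  obtain ⟨s₀, h₀⟩ := Finite.exists_max fun s => ‖(a s : K)‖
  exact (norm_evalAt_le hf (norm_nonneg (a s₀ : K)) h₀).trans_lt (ha s₀)

instance : Zero H.Points := ⟨⟨0, by simp⟩⟩

/-- `x + y` is `F(x, y)`. -/
instance : Add H.Points :=
  ⟨fun x y => ⟨evalAt H.law.toPowerSeries ![x.val, y.val],
    norm_evalAt_lt H.law.zero_constantCoeff (norm_pair_lt x.norm_lt y.norm_lt)⟩⟩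

/-- `a • x` is `[a](x)`. -/
instance : SMul (IntRing F) H.Points :=
  ⟨fun a x => ⟨evalAt (H.act a) fun _ : Unit => x.val,
    norm_evalAt_lt (H.act_constantCoeff a) fun _ => x.norm_lt⟩⟩

instance : Neg H.Points := ⟨fun x => (-1 : IntRing F) • x⟩

lemma val_zero : (0 : H.Points).val = 0 := rfl

lemma val_add (x y : H.Points) :
    (x + y).val = evalAt H.law.toPowerSeries ![x.val, y.val] := rfl

lemma val_smul (a : IntRing F) (x : H.Points) :
    (a • x).val = evalAt (H.act a) fun _ : Unit => x.val := rfl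

lemma neg_def (x : H.Points) : -x = (-1 : IntRing F) • x := rfl

lemma constantCoeff_subst_pair {τ : Type*} {f g : MvPowerSeries τ (IntRing K)}
    (hf : MvPowerSeries.constantCoeff f = 0) (hg : MvPowerSeries.constantCoeff g = 0)
    {P : MvPowerSeries (Fin 2) (IntRing K)} (hP : MvPowerSeries.constantCoeff P = 0) :
    MvPowerSeries.constantCoeff (MvPowerSeries.subst ![f, g] P) = 0 := by
  have h : ∀ s, MvPowerSeries.constantCoeff (![f, g] s) = 0 := fun s => by
    fin_cases s <;> assumption
  exact MvPowerSeries.constantCoeff_subst_eq_zero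
    (MvPowerSeries.hasSubst_of_constantCoeff_zero h) h hP

lemma constantCoeff_subst_single {τ : Type*} {f : MvPowerSeries τ (IntRing K)}
    (hf : MvPowerSeries.constantCoeff f = 0)
    {P : PowerSeries (IntRing K)} (hP : PowerSeries.constantCoeff P = 0) :
    MvPowerSeries.constantCoeff (PowerSeries.subst f P) = 0 :=
  MvPowerSeries.constantCoeff_subst_eq_zero
    (MvPowerSeries.hasSubst_of_constantCoeff_zero fun _ => hf) (fun _ => hf) hP

variable [CompleteSpace K]

lemma evalAt_subst_pair {τ : Type*} [Finite τ] [Nonempty τ] {f g : MvPowerSeries τ (IntRing K)}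
    (hf : MvPowerSeries.constantCoeff f = 0) (hg : MvPowerSeries.constantCoeff g = 0)
    {b : τ → IntRing K} (hb : ∀ s, ‖(b s : K)‖ < 1) (P : MvPowerSeries (Fin 2) (IntRing K)) :
    evalAt (MvPowerSeries.subst ![f, g] P) b = evalAt P ![evalAt f b, evalAt g b] := by
  have h : (fun s => evalAt (![f, g] s) b) = ![evalAt f b, evalAt g b] := by
    funext s; fin_cases s <;> rfl
  rw [evalAt_subst _ hb, h]
  · intro s
    rw [congrFun h s]
    exact norm_pair_lt (norm_evalAt_lt hf hb) (norm_evalAt_lt hg hb) s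
  · refine MvPowerSeries.hasSubst_of_constantCoeff_zero fun s => ?_
    fin_cases s <;> assumption

lemma evalAt_subst_single {τ : Type*} [Finite τ] [Nonempty τ] {f : MvPowerSeries τ (IntRing K)}
    (hf : MvPowerSeries.constantCoeff f = 0)
    {b : τ → IntRing K} (hb : ∀ s, ‖(b s : K)‖ < 1) (P : PowerSeries (IntRing K)) :
    evalAt (PowerSeries.subst f P) b = evalAt P fun _ : Unit => evalAt f b :=
  evalAt_subst (MvPowerSeries.hasSubst_of_constantCoeff_zero fun _ => hf) hb
    (fun _ => norm_evalAt_lt hf hb) P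

instance : AddCommGroup H.Points where
  add_assoc x y z := by
    have hb : ∀ s, ‖((![x.val, y.val, z.val] s : IntRing K) : K)‖ < 1 := fun s => by
      fin_cases s
      exacts [x.norm_lt, y.norm_lt, z.norm_lt]
    have h := congrArg (fun f => evalAt f ![x.val, y.val, z.val]) H.law.assoc
    have hc := fun i : Fin 3 => MvPowerSeries.constantCoeff_X (R := IntRing K) i
    have h01 := constantCoeff_subst_pair (hc 0) (hc 1) H.law.zero_constantCoeff
    have h12 := constantCoeff_subst_pair (hc 1) (hc 2) H.law.zero_constantCoeff
    rw [evalAt_subst_pair h01 (hc 2) hb, evalAt_subst_pair (hc 0) h12 hb,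
      evalAt_subst_pair (hc 0) (hc 1) hb, evalAt_subst_pair (hc 1) (hc 2) hb,
      evalAt_X hb, evalAt_X hb, evalAt_X hb] at h
    exact Points.ext h
  zero_add x := by
    have hb : ∀ _ : Unit, ‖(x.val : K)‖ < 1 := fun _ => x.norm_lt
    have h := congrArg (fun f => evalAt f fun _ : Unit => x.val) H.law.zeroX_eq_X
    dsimp only [FormalGroup.zeroX] at h
    rw [evalAt_subst_pair (map_zero _) PowerSeries.constantCoeff_X hb, evalAt_zero,
      PowerSeries.X, evalAt_X hb] at h
    exact Points.ext h
  add_zero x := by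
    have hb : ∀ _ : Unit, ‖(x.val : K)‖ < 1 := fun _ => x.norm_lt
    have h := congrArg (fun f => evalAt f fun _ : Unit => x.val) H.law.Xzero_eq_X
    dsimp only [FormalGroup.Xzero] at h
    rw [evalAt_subst_pair PowerSeries.constantCoeff_X (map_zero _) hb, evalAt_zero,
      PowerSeries.X, evalAt_X hb] at h
    exact Points.ext h
  add_comm x y := by
    have hb := norm_pair_lt x.norm_lt y.norm_lt
    have hc := fun i : Fin 2 => MvPowerSeries.constantCoeff_X (R := IntRing K) i
    have h := congrArg (fun f => evalAt f ![x.val, y.val]) H.comm.comm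
    rw [evalAt_subst_pair (hc 1) (hc 0) hb, evalAt_X hb, evalAt_X hb] at h
    exact Points.ext h
  neg_add_cancel x := by
    have hb : ∀ _ : Unit, ‖(x.val : K)‖ < 1 := fun _ => x.norm_lt
    have h := congrArg (fun f => evalAt f fun _ : Unit => x.val) (H.act_add (-1) 1)
    rw [evalAt_subst_pair (H.act_constantCoeff _) (H.act_constantCoeff _) hb, neg_add_cancel,
      H.act_zero, evalAt_zero, H.act_one, PowerSeries.X, evalAt_X hb] at h
    exact Points.ext h.symm
  nsmul := nsmulRec
  zsmul := zsmulRec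

instance : Module (IntRing F) H.Points where
  one_smul x := by
    have hb : ∀ _ : Unit, ‖(x.val : K)‖ < 1 := fun _ => x.norm_lt
    refine Points.ext ?_
    rw [val_smul, H.act_one, PowerSeries.X, evalAt_X hb]
  mul_smul a b x := by
    have hb : ∀ _ : Unit, ‖(x.val : K)‖ < 1 := fun _ => x.norm_lt
    refine Points.ext ?_
    rw [val_smul, H.act_mul, evalAt_subst_single (H.act_constantCoeff b) hb]
    rfl
  smul_zero a := by
    refine Points.ext (Subtype.ext (norm_le_zero_iff.1 ?_))
    exact norm_evalAt_le (H.act_constantCoeff a) le_rfl fun _ => by simp [val_zero]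
  smul_add a x y := by
    have hb := norm_pair_lt x.norm_lt y.norm_lt
    have hc := fun i : Fin 2 => MvPowerSeries.constantCoeff_X (R := IntRing K) i
    have h := congrArg (fun f => evalAt f ![x.val, y.val]) (H.act_hom a)
    rw [evalAt_subst_single H.law.zero_constantCoeff hb,
      evalAt_subst_pair (constantCoeff_subst_single (hc 0) (H.act_constantCoeff a))
        (constantCoeff_subst_single (hc 1) (H.act_constantCoeff a)) hb,
      evalAt_subst_single (hc 0) hb, evalAt_subst_single (hc 1) hb,
      evalAt_X hb, evalAt_X hb] at h
    exact Points.ext h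
  add_smul a b x := by
    have hb : ∀ _ : Unit, ‖(x.val : K)‖ < 1 := fun _ => x.norm_lt
    refine Points.ext ?_
    rw [val_smul, H.act_add, evalAt_subst_pair (H.act_constantCoeff a) (H.act_constantCoeff b) hb]
    rfl
  zero_smul x := by
    refine Points.ext ?_
    rw [val_smul, H.act_zero, evalAt_zero]
    rfl

end FormalModule.Points
end Formal

/-- A uniformizer of `𝒪_F`. -/
structure Uniformizer (F : Type*) [NormedField F] [IsUltrametricDist F] where
  val : IntRing F
  irreducible : Irreducible val

namespace Uniformizer
variable {F : Type*} [NormedField F] [IsUltrametricDist F] (ϖ : Uniformizer F)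

lemma ne_zero : (ϖ.val : F) ≠ 0 := by
  simpa using ϖ.irreducible.ne_zero

lemma norm_lt_one : ‖(ϖ.val : F)‖ < 1 := by
  refine lt_of_le_of_ne (norm_le_one _) fun h => ϖ.irreducible.not_isUnit ?_
  refine IsUnit.of_mul_eq_one ⟨(ϖ.val : F)⁻¹, mem_intRing.2 (by rw [norm_inv, h, inv_one])⟩ ?_
  exact Subtype.ext (mul_inv_cancel₀ ϖ.ne_zero)

lemma log_neg : Real.log ‖(ϖ.val : F)‖ < 0 :=
  Real.log_neg (norm_pos_iff.2 ϖ.ne_zero) ϖ.norm_lt_one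

/-- The additive valuation of an ultrametric field containing `F`, normalized by `v(ϖ) = 1`. -/
def addVal {K : Type*} [NormedField K] (x : K) : EReal :=
  open Classical in
  if x = 0 then ⊤ else ((Real.log ‖x‖ / Real.log ‖(ϖ.val : F)‖ : ℝ) : EReal)

lemma addVal_anti {K : Type*} [NormedField K] {x y : K} (h : ‖x‖ ≤ ‖y‖) :
    ϖ.addVal y ≤ ϖ.addVal x := by
  unfold addVal
  by_cases hx : x = 0
  · simp [hx]
  · have hy : y ≠ 0 := fun hy => hx (by simpa [hy] using h)
    rw [if_neg hx, if_neg hy, EReal.coe_le_coe_iff]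
    exact div_le_div_of_nonpos_of_le ϖ.log_neg.le (Real.log_le_log (norm_pos_iff.2 hx) h)

lemma exists_pow_mul (c : F) : ∃ k : ℕ, (ϖ.val : F) ^ k * c ∈ IntRing F := by
  have h := (tendsto_pow_atTop_nhds_zero_of_norm_lt_one ϖ.norm_lt_one).mul_const c
  rw [zero_mul] at h
  obtain ⟨k, hk⟩ := (h.norm.eventually_lt_const (u := 1) (by simp)).exists
  exact ⟨k, mem_intRing.2 hk.le⟩

end Uniformizer

/-- The lower boundary of the convex hull of the points `(m, pts m)` (those with `pts m = ∞` do not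
count): the supremum of the affine functions that lie below all of them. -/
def newtonPolygon (pts : ℕ → EReal) (x : ℝ) : ℝ :=
  sSup {y | ∃ s u : ℝ, (∀ m : ℕ, ((s * m + u : ℝ) : EReal) ≤ pts m) ∧ y = s * x + u}

section Building
variable (F V : Type*) [NormedField F] [IsUltrametricDist F] [AddCommGroup V] [Module F V]
  [Module (IntRing F) V] [IsScalarTower (IntRing F) F V]

/-- The `𝒪_F`-lattices in the `F`-vector space `V`. -/
abbrev Lattice : Type _ := {Λ : Submodule (IntRing F) V // Submodule.IsLattice F Λ}

/-- Homothety of lattices: `Λ' = c Λ` for some `c ∈ F^×`. -/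
def homothety : Setoid (Lattice F V) where
  r Λ Λ' := ∃ c : Fˣ, Λ'.1 = c • Λ.1
  iseqv :=
    { refl := fun Λ => ⟨1, (one_smul _ _).symm⟩
      symm := by
        rintro Λ Λ' ⟨c, h⟩
        exact ⟨c⁻¹, by rw [h, inv_smul_smul]⟩
      trans := by
        rintro Λ Λ' Λ'' ⟨c, h⟩ ⟨d, h'⟩
        exact ⟨d * c, by rw [h', h, mul_smul]⟩ }

/-- The vertices of the building of `PGL(V)`: the homothety classes of lattices in `V`. -/
def Vertex : Type _ := Quotient (homothety F V)

variable {F V}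

/-- The homothety class `[Λ]` of a lattice. -/
def Vertex.mk (Λ : Lattice F V) : Vertex F V := Quotient.mk (homothety F V) Λ

/-- The simplices of the building: the sets of classes `{[Λ_0], …, [Λ_d]}` with
`ϖ Λ_0 ⊊ Λ_d ⊊ ⋯ ⊊ Λ_1 ⊊ Λ_0`. -/
def IsSimplex (ϖ : Uniformizer F) (S : Set (Vertex F V)) : Prop :=
  ∃ (d : ℕ) (Λ : Fin (d + 1) → Lattice F V), StrictAnti (fun i => (Λ i).1) ∧
    ϖ.val • (Λ 0).1 < (Λ (Fin.last d)).1 ∧ S = Set.range fun i => Vertex.mk (Λ i)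

/-- The graph of vertices and edges (1-skeleton) of the building. -/
def skeleton (V : Type*) [AddCommGroup V] [Module F V] [Module (IntRing F) V]
    [IsScalarTower (IntRing F) F V] (ϖ : Uniformizer F) : SimpleGraph (Vertex F V) where
  Adj x y := x ≠ y ∧ IsSimplex ϖ {x, y}
  symm := ⟨fun x y h => ⟨h.1.symm, by rw [Set.pair_comm]; exact h.2⟩⟩
  loopless := ⟨fun _ h => h.1 rfl⟩

/-- The lattice `⟨ϖ^{a_1} e_1, …, ϖ^{a_n} e_n⟩`. -/
def diagLattice (ϖ : Uniformizer F) {n : ℕ} (e : Module.Basis (Fin n) F V) (a : Fin n → ℤ) :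
    Lattice F V :=
  ⟨Submodule.span (IntRing F) (Set.range fun i => (ϖ.val : F) ^ a i • e i),
    { fg := Submodule.fg_span (Set.finite_range _)
      span_eq_top := by
        rw [Submodule.span_span_of_tower, eq_top_iff, ← e.span_eq, Submodule.span_le]
        rintro _ ⟨i, rfl⟩
        have h : (ϖ.val : F) ^ a i ≠ 0 := zpow_ne_zero _ ϖ.ne_zero
        rw [← inv_smul_smul₀ h (e i)]
        exact Submodule.smul_mem _ _ (Submodule.subset_span ⟨i, rfl⟩) }⟩

/-- The vertices of the apartment of the basis `e`. -/
def apartment (ϖ : Uniformizer F) {n : ℕ} (e : Module.Basis (Fin n) F V) : Set (Vertex F V) :=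
  Set.range fun a : Fin n → ℤ => Vertex.mk (diagLattice ϖ e a)

/-- `Q` is the set of vertices of a sector ("quartier") with vertex `x` in the apartment of `e`,
that is, of `x + C` where `C = {a | a_{σ 1} ≥ ⋯ ≥ a_{σ n}}` is a Weyl chamber; the point `a` of
the apartment corresponds to `[⟨ϖ^{a_1} e_1, …, ϖ^{a_n} e_n⟩]`. -/
def IsSector (ϖ : Uniformizer F) {n : ℕ} (e : Module.Basis (Fin n) F V) (x : Vertex F V)
    (Q : Set (Vertex F V)) : Prop :=
  ∃ (b : Fin n → ℤ) (σ : Equiv.Perm (Fin n)), x = Vertex.mk (diagLattice ϖ e b) ∧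
    Q = {y | ∃ a : Fin n → ℤ, Antitone (fun i => a (σ i)) ∧
      y = Vertex.mk (diagLattice ϖ e (b + a))}

end Building

section Tate
variable {F K : Type*} [NormedField F] [IsUltrametricDist F] [NormedField K] [IsUltrametricDist K]
  [NormedAlgebra F K] [CompleteSpace K]

/-- The rational Tate module `V_p(H)`: the sequences `(x_i)_{i ∈ ℤ}` of points with
`ϖ x_{i+1} = x_i` and `x_i = 0` for `i ≪ 0`. -/
def FormalModule.ratTate (H : FormalModule F K) (ϖ : Uniformizer F) :
    Submodule (IntRing F) (ℤ → H.Points) where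
  carrier := {x | (∀ i, ϖ.val • x (i + 1) = x i) ∧ ∃ N, ∀ i ≤ N, x i = 0}
  add_mem' := by
    rintro x y ⟨hx, M, hM⟩ ⟨hy, N, hN⟩
    refine ⟨fun i => by simp [smul_add, hx, hy], min M N, fun i hi => ?_⟩
    simp [hM i (hi.trans (min_le_left _ _)), hN i (hi.trans (min_le_right _ _))]
  zero_mem' := ⟨fun i => by simp, 0, fun i _ => rfl⟩
  smul_mem' := by
    rintro a x ⟨hx, M, hM⟩
    refine ⟨fun i => ?_, M, fun i hi => by simp [hM i hi]⟩
    rw [Pi.smul_apply, smul_comm, hx, Pi.smul_apply]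

namespace FormalModule.ratTate
variable {H : FormalModule F K} {ϖ : Uniformizer F}

lemma pow_smul (x : H.ratTate ϖ) (k : ℕ) (i : ℤ) : ϖ.val ^ k • x.1 (i + k) = x.1 i := by
  induction k with
  | zero => simp
  | succ k ih =>
    rw [pow_succ, mul_smul, Nat.cast_succ, ← add_assoc, x.2.1, ih]

lemma smul_eq_smul (x : H.ratTate ϖ) {a b : IntRing F} {k l : ℕ} {c : F}
    (ha : (a : F) = (ϖ.val : F) ^ k * c) (hb : (b : F) = (ϖ.val : F) ^ l * c) (i : ℤ) :
    a • x.1 (i + k) = b • x.1 (i + l) := by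
  rw [← pow_smul x l (i + k), ← pow_smul x k (i + l), ← mul_smul, ← mul_smul,
    show i + (l : ℤ) + k = i + k + l by ring]
  congr 1
  apply Subtype.ext
  push_cast
  rw [ha, hb]
  ring

/-- `F` acts on `V_p(H)`: if `ϖ ^ k c ∈ 𝒪_F` then `(c • x)_i = (ϖ ^ k c) • x_{i+k}`. -/
instance : SMul F (H.ratTate ϖ) where
  smul c x := ⟨fun i => (⟨_, (ϖ.exists_pow_mul c).choose_spec⟩ : IntRing F) •
      x.1 (i + (ϖ.exists_pow_mul c).choose), by
    obtain ⟨N, hN⟩ := x.2.2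
    refine ⟨fun i => ?_, N - (ϖ.exists_pow_mul c).choose, fun i hi => ?_⟩
    · rw [smul_comm, add_right_comm, x.2.1]
    · change _ • x.1 _ = 0
      rw [hN _ (le_sub_iff_add_le.1 hi), smul_zero]⟩

lemma smul_apply (x : H.ratTate ϖ) {a : IntRing F} {k : ℕ} {c : F}
    (ha : (a : F) = (ϖ.val : F) ^ k * c) (i : ℤ) : (c • x).1 i = a • x.1 (i + k) :=
  smul_eq_smul x rfl ha i

instance : Module F (H.ratTate ϖ) where
  one_smul x := by
    refine Subtype.ext (funext fun i => ?_)
    rw [smul_apply x (a := 1) (k := 0) (by simp)]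
    simp
  mul_smul c d x := by
    obtain ⟨k, hk⟩ := ϖ.exists_pow_mul c
    obtain ⟨l, hl⟩ := ϖ.exists_pow_mul d
    refine Subtype.ext (funext fun i => ?_)
    rw [smul_apply x (a := ⟨_, hk⟩ * ⟨_, hl⟩) (k := k + l) (by push_cast; ring),
      smul_apply (d • x) (a := ⟨_, hk⟩) (k := k) rfl, smul_apply x (a := ⟨_, hl⟩) (k := l) rfl,
      mul_smul, Nat.cast_add, add_assoc]
  smul_zero c := by
    refine Subtype.ext (funext fun i => ?_)
    obtain ⟨k, hk⟩ := ϖ.exists_pow_mul c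
    rw [smul_apply _ (a := ⟨_, hk⟩) (k := k) rfl]
    exact smul_zero _
  smul_add c x y := by
    refine Subtype.ext (funext fun i => ?_)
    obtain ⟨k, hk⟩ := ϖ.exists_pow_mul c
    rw [smul_apply _ (a := ⟨_, hk⟩) (k := k) rfl]
    change _ • (x.1 _ + y.1 _) = (c • x).1 i + (c • y).1 i
    rw [smul_apply x (a := ⟨_, hk⟩) (k := k) rfl, smul_apply y (a := ⟨_, hk⟩) (k := k) rfl,
      smul_add]
  add_smul c d x := by
    refine Subtype.ext (funext fun i => ?_)
    obtain ⟨k, hk⟩ := ϖ.exists_pow_mul c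
    obtain ⟨l, hl⟩ := ϖ.exists_pow_mul d
    change _ = (c • x).1 i + (d • x).1 i
    rw [smul_apply x (a := ϖ.val ^ l * ⟨_, hk⟩) (k := k + l) (c := c) (by push_cast; ring),
      smul_apply x (a := ϖ.val ^ k * ⟨_, hl⟩) (k := k + l) (c := d) (by push_cast; ring),
      smul_apply x (a := ϖ.val ^ l * ⟨_, hk⟩ + ϖ.val ^ k * ⟨_, hl⟩) (k := k + l) (c := c + d)
        (by push_cast; ring), add_smul]
  zero_smul x := by
    refine Subtype.ext (funext fun i => ?_)
    rw [smul_apply x (a := 0) (k := 0) (by simp), zero_smul]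
    rfl

instance : IsScalarTower (IntRing F) F (H.ratTate ϖ) where
  smul_assoc a c x := by
    refine Subtype.ext (funext fun i => ?_)
    obtain ⟨k, hk⟩ := ϖ.exists_pow_mul c
    change _ = a • (c • x).1 i
    rw [smul_apply x (a := ⟨_, hk⟩) (k := k) rfl, smul_apply x (a := a * ⟨_, hk⟩) (k := k)
      (by rw [Algebra.smul_def]; push_cast; exact mul_left_comm _ _ _), mul_smul]

end FormalModule.ratTate

namespace FormalModule
variable (H : FormalModule F K) (ϖ : Uniformizer F)

/-- The integral Tate module `T_p(H) ⊆ V_p(H)`. -/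
def tate : Submodule (IntRing F) (H.ratTate ϖ) where
  carrier := {x | x.1 0 = 0}
  add_mem' {x y} hx hy := by
    change x.1 0 + y.1 0 = 0
    rw [show x.1 0 = 0 from hx, show y.1 0 = 0 from hy, add_zero]
  zero_mem' := rfl
  smul_mem' a x hx := by
    change a • x.1 0 = 0
    rw [show x.1 0 = 0 from hx, smul_zero]

/-- `v(x) = v(x_0) ∈ ]0, ∞]` for `x = (x_i)_i ∈ V_p(H)`. -/
def tateVal (x : H.ratTate ϖ) : EReal := ϖ.addVal ((x.1 0).val : K)

/-- The ramification filtration `Fil_μ V = {x | v(x) ≥ μ}`. -/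
def fil (μ : EReal) : Submodule (IntRing F) (H.ratTate ϖ) where
  carrier := {x | μ ≤ H.tateVal ϖ x}
  add_mem' {x y} hx hy := by
    have h : ‖((x.1 0 + y.1 0).val : K)‖ ≤ max ‖((x.1 0).val : K)‖ ‖((y.1 0).val : K)‖ := by
      refine norm_evalAt_le H.law.zero_constantCoeff (le_max_of_le_left (norm_nonneg _)) fun s => ?_
      fin_cases s
      exacts [le_max_left _ _, le_max_right _ _]
    rcases le_max_iff.1 h with h | h
    exacts [le_trans hx (ϖ.addVal_anti h), le_trans hy (ϖ.addVal_anti h)]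
  zero_mem' := by
    change μ ≤ ϖ.addVal (0 : K)
    simp [Uniformizer.addVal]
  smul_mem' a x hx :=
    le_trans hx (ϖ.addVal_anti
      (norm_evalAt_le (H.act_constantCoeff a) (norm_nonneg _) fun _ => le_rfl))

/-- The vertices `[Fil_μ V]`, `0 < μ ≤ ∞`, of the building of `PGL(V_p(H))`. -/
def filVertices : Set (Vertex F (H.ratTate ϖ)) :=
  {x | ∃ μ : EReal, 0 < μ ∧ ∃ h : Submodule.IsLattice F (H.fil ϖ μ), x = Vertex.mk ⟨H.fil ϖ μ, h⟩}

/-- The height is `n`: the reduction of `[ϖ]` modulo the maximal ideal of `𝒪_K` has order `q ^ n`,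
where `q` is the cardinality of the residue field of `F`. -/
def HasHeight (n : ℕ) : Prop :=
  (PowerSeries.map (IsLocalRing.residue (IntRing K)) (H.act ϖ.val)).order =
    ((Nat.card (IsLocalRing.ResidueField (IntRing F)) ^ n : ℕ) : ℕ∞)

/-- The points `(m, v(a_m))`, where `[ϖ](T) = ∑ a_m T ^ m`. -/
def newtonPoints (m : ℕ) : EReal := ϖ.addVal ((PowerSeries.coeff m (H.act ϖ.val) : IntRing K) : K)

/-- The slopes (with positive sign) of the Newton polygon of `[ϖ]`: here `i : ℕ` counts from `0`,
and the value is the slope between the abscissae `q ^ i` and `q ^ (i + 1)`. -/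
def firstSlope (i : ℕ) : ℝ :=
  let q : ℝ := Nat.card (IsLocalRing.ResidueField (IntRing F))
  (newtonPolygon (H.newtonPoints ϖ) (q ^ i) - newtonPolygon (H.newtonPoints ϖ) (q ^ (i + 1))) /
    (q ^ (i + 1) - q ^ i)

/-- The largest slope of the convex hull of the Newton polygon of `[ϖ]` and of the point `(0, t)`,
that is, its slope between the abscissae `0` and `1`. -/
def nextSlope (t : ℝ) : ℝ :=
  newtonPolygon (Function.update (H.newtonPoints ϖ) 0 t) 0 -
    newtonPolygon (Function.update (H.newtonPoints ϖ) 0 t) 1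

/-- The numbers `λ_i^{(k)}`, with `λ_i^{(0)} = ∞`, `λ_i^{(1)}` a slope of the Newton polygon of
`[ϖ]`, and `λ_i^{(k+1)}` obtained from `λ_i^{(k)}` by `nextSlope`. -/
def slope (i : ℕ) : ℕ → EReal
  | 0 => ⊤
  | k + 1 => (((H.nextSlope ϖ)^[k] (H.firstSlope ϖ i) : ℝ) : EReal)

/-- `k(i, μ) = sup {k ≥ 0 | λ_i^{(k)} ≥ μ}`. -/
def slopeIndex (i : ℕ) (μ : EReal) : ℕ := sSup {k : ℕ | μ ≤ H.slope ϖ i k}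

/-- A basis `e` of `T_p(H)` is adapted if `v(ϖ^{-k} e_i) = λ_i^{(k)}` for all `i` and `k ≥ 1`. -/
def IsAdapted {n : ℕ} (e : Module.Basis (Fin n) (IntRing F) (H.tate ϖ)) : Prop :=
  ∀ (i : Fin n) (k : ℕ), 1 ≤ k →
    H.tateVal ϖ (((ϖ.val : F) ^ k)⁻¹ • (e i : H.ratTate ϖ)) = H.slope ϖ i k

end FormalModule
end Tate
end

end Ramification

/-!
Absolute values are used in place of valuations: a point of the formal module has the norm
`nrm x = ‖x‖ < 1` of its coordinate, and `Fil_μ` is the set of the `x` in `V_p(H)` with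
`nrm x_0 ≤ r`, where `r` has the valuation `μ` (`mem_fil_radVal`); it is denoted by `Fil_r` below.

*Torsion.* Weierstrass preparation and the algebraic closedness of `K` write `[ϖ](T) - y` as a unit
times `∏ (T - x_j)`, with `q ^ n` factors (`exists_prod_factorization`). The zeros of `[ϖ]` are
simple and translations are isometries, so that the `ϖ`-torsion `W` has `q ^ n` elements and
`‖ϖ w‖ = ∏_{z ∈ W} ‖w - z‖`. Let `φ(r) = ∏_{z ∈ W} max(‖z‖, r)` (`gaussProd`). Then
`‖ϖ w‖ ≤ φ(‖w‖)`, and every point `y` has a division point `x` with `φ(‖x‖) = ‖y‖`, namely the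
nearest one to `0` (`exists_smul_eq_gaussProd_eq`).

*Newton polygon.* `W` is a vector space over the residue field, with an ultrametric norm that is
invariant under nonzero scalars, and has an orthogonal basis (`exists_isOrthogonal`). Counting the
vectors of each norm expresses `φ` by the norms of this basis (`gaussProd_eq_prod`). On the other
hand `φ` is the Gauss norm of `[ϖ]`, that is, the Legendre transform of the Newton polygon in
multiplicative form. Hence the slopes of the polygon are the valuations of the orthogonal basis
(`firstSlope_eq`), and the passage from `λ_i^{(k)}` to `λ_i^{(k+1)}` inverts `φ` (`nextSlope_eq`).

*Bases.* Lifting an orthogonal basis of `W` to `T_p(H)` by successive division points of minimal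
norm yields a basis, by Nakayama's lemma (`exists_isMinimalBasis`). Such minimal bases are adapted.
Conversely adapted bases are minimal (`IsAdapted.isMinimalBasis`): the only point to check is that
their reductions in `W` are orthogonal, and this holds for every basis of `W` with the same norms
as an orthogonal one, because the sum of the norms of all elements of `W` is then the largest
possible. A minimal basis is orthogonal in `V_p(H)`, by induction on the denominators of the
coordinates (`IsMinimalBasis.tateNrm_smul_le`), and therefore splits all the `Fil_μ`
(`IsMinimalBasis.fil_eq_span`). That `k(i, μ)` decreases with `i` places the vertices in a sector.

*Building.* One has `ϖ Fil_r ⊆ Fil_{φ(r)} ⊆ Fil_r`, so that the vertices of the radii `r` and `φ(r)`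
are equal or neighbours. The iterates of `φ` tend to `0` on `[0, 1[`, and `Fil_r = T_p(H)` for
small `r`; this gives the connectedness. If the disc of radius `r` contains `W`, then
`Fil_{φ(r)} = ϖ Fil_r`, so that up to homothety only finitely many exponents
`(k(1, μ), …, k(n, μ))` occur.
-/

namespace Ramification

noncomputable section

/-! ### Power series over the ring of integers of an ultrametric field -/

section IntRing
variable {L : Type*} [NormedField L] [IsUltrametricDist L]

lemma dvd_iff_norm_le {a b : IntRing L} : a ∣ b ↔ ‖(b : L)‖ ≤ ‖(a : L)‖ := by
  constructor
  · rintro ⟨c, rfl⟩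
    push_cast
    rw [norm_mul]
    exact mul_le_of_le_one_right (norm_nonneg _) (norm_le_one c)
  · intro h
    by_cases ha : (a : L) = 0
    · have hb : (b : L) = 0 := by simpa [ha] using h
      rw [show b = 0 from Subtype.ext hb]
      exact dvd_zero a
    · refine ⟨⟨(b : L) / a, mem_intRing.2 ?_⟩, Subtype.ext ?_⟩
      · rw [norm_div]
        exact div_le_one_of_le₀ h (norm_nonneg _)
      · push_cast
        field_simp

lemma isUnit_iff_norm_eq_one {a : IntRing L} : IsUnit a ↔ ‖(a : L)‖ = 1 := by
  rw [isUnit_iff_dvd_one, dvd_iff_norm_le]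
  simpa using ⟨fun h => le_antisymm (norm_le_one a) h, fun h => h.ge⟩

lemma mem_maximalIdeal_iff_norm_lt {a : IntRing L} :
    a ∈ IsLocalRing.maximalIdeal (IntRing L) ↔ ‖(a : L)‖ < 1 := by
  rw [IsLocalRing.mem_maximalIdeal, mem_nonunits_iff, isUnit_iff_norm_eq_one,
    (norm_le_one a).lt_iff_ne]

lemma mem_span_pow_iff {a b : IntRing L} {k : ℕ} :
    b ∈ Ideal.span {a} ^ k ↔ ‖(b : L)‖ ≤ ‖(a : L)‖ ^ k := by
  rw [Ideal.span_singleton_pow, Ideal.mem_span_singleton, dvd_iff_norm_le]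
  simp

lemma isAdic_span_singleton {a : IntRing L} (h0 : a ≠ 0) (h1 : ‖(a : L)‖ < 1) :
    IsAdic (Ideal.span {a}) := by
  have hpos : 0 < ‖(a : L)‖ := norm_pos_iff.2 fun h => h0 (Subtype.ext h)
  rw [isAdic_iff]
  constructor
  · intro k
    rw [show ((Ideal.span {a} ^ k : Ideal (IntRing L)) : Set (IntRing L)) =
      Subtype.val ⁻¹' Metric.closedBall (0 : L) (‖(a : L)‖ ^ k) by
        ext b; simpa using mem_span_pow_iff]
    exact (IsUltrametricDist.isOpen_closedBall _ (pow_pos hpos k).ne').preimage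
      continuous_subtype_val
  · intro s hs
    obtain ⟨r, hr, hrs⟩ := Metric.nhds_basis_closedBall.mem_iff.1 hs
    obtain ⟨k, hk⟩ := exists_pow_lt_of_lt_one hr h1
    refine ⟨k, fun b hb => hrs ?_⟩
    have := (mem_span_pow_iff.1 hb).trans hk.le
    simpa [Subtype.dist_eq] using this

lemma isAdicComplete_span_singleton [CompleteSpace L] {a : IntRing L} (h0 : a ≠ 0)
    (h1 : ‖(a : L)‖ < 1) : IsAdicComplete (Ideal.span {a}) (IntRing L) where
  toIsHausdorff := (isAdic_span_singleton h0 h1).isHausdorff_iff.2 inferInstance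
  toIsPrecomplete := (isAdic_span_singleton h0 h1).isPrecomplete_iff.2 inferInstance

open Polynomial in
/-- A form of the Weierstrass preparation theorem that does not need the maximal ideal to be
finitely generated: only the ideal generated by one element `a` of norm `< 1` that divides the
coefficients of low degree is used. -/
lemma exists_isDistinguishedAt_mul_unit [CompleteSpace L] {a : IntRing L} (h0 : a ≠ 0)
    (h1 : ‖(a : L)‖ < 1) {h : PowerSeries (IntRing L)} {N : ℕ}
    (hlt : ∀ m < N, a ∣ PowerSeries.coeff m h) (hN : IsUnit (PowerSeries.coeff N h)) :
    ∃ (P : (IntRing L)[X]) (U : (PowerSeries (IntRing L))ˣ), P.Monic ∧ P.natDegree = N ∧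
      (∀ m < N, a ∣ P.coeff m) ∧ h = (P : PowerSeries (IntRing L)) * U := by
  have := isAdicComplete_span_singleton h0 h1
  set I : Ideal (IntRing L) := Ideal.span {a} with hI
  have hItop : I ≠ ⊤ := by
    rw [hI, Ne, Ideal.span_singleton_eq_top, isUnit_iff_norm_eq_one]
    exact h1.ne
  have : Nontrivial (IntRing L ⧸ I) := Ideal.Quotient.nontrivial_iff.2 hItop
  have hord : (h.map (Ideal.Quotient.mk I)).order = N := by
    rw [PowerSeries.order_eq_nat]
    constructor
    · rw [PowerSeries.coeff_map]
      exact (hN.map _).ne_zero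
    · intro i hi
      rw [PowerSeries.coeff_map, Ideal.Quotient.eq_zero_iff_mem]
      exact Ideal.mem_span_singleton.2 (hlt i hi)
  have hW : h.IsWeierstrassDivisorAt I := by
    rw [PowerSeries.IsWeierstrassDivisorAt, hord]
    exact hN
  have hdiv := hW.isWeierstrassDivisionAt_div_mod (X ^ N : (IntRing L)[X])
  set Q := hW.div ((X ^ N : (IntRing L)[X]) : PowerSeries (IntRing L))
  set R := hW.mod ((X ^ N : (IntRing L)[X]) : PowerSeries (IntRing L))
  have hdeg : R.degree < N := by simpa [hord] using hdiv.degree_lt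
  have hR : ∀ m < N, a ∣ R.coeff m := fun m hm => by
    have := hdiv.coeff_f_sub_r_mem (i := m) (by simpa [hord] using hm)
    rw [map_sub, Polynomial.coeff_coe, Polynomial.coeff_coe, Polynomial.coeff_X_pow,
      if_neg hm.ne, zero_sub, neg_mem_iff] at this
    exact Ideal.mem_span_singleton.1 this
  have heq : ((X ^ N - R : (IntRing L)[X]) : PowerSeries (IntRing L)) = h * Q := by
    rw [Polynomial.coe_sub, sub_eq_iff_eq_add]
    exact hdiv.eq_mul_add
  have hQ : IsUnit Q := by
    rw [PowerSeries.isUnit_iff_constantCoeff]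
    have hc := congrArg (PowerSeries.coeff N) heq
    rw [Polynomial.coeff_coe, Polynomial.coeff_sub, Polynomial.coeff_X_pow_self,
      Polynomial.coeff_eq_zero_of_degree_lt hdeg, sub_zero, PowerSeries.coeff_mul,
      Finset.Nat.sum_antidiagonal_eq_sum_range_succ_mk, Finset.sum_range_succ, Nat.sub_self,
      PowerSeries.coeff_zero_eq_constantCoeff] at hc
    have hs : a ∣ ∑ k ∈ Finset.range N, PowerSeries.coeff k h * PowerSeries.coeff (N - k) Q :=
      Finset.dvd_sum fun k hk => (hlt k (Finset.mem_range.1 hk)).mul_right _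
    by_contra hu
    have hmem : (1 : IntRing L) ∈ IsLocalRing.maximalIdeal (IntRing L) := by
      rw [hc]
      refine add_mem (Ideal.mem_of_dvd _ hs (mem_maximalIdeal_iff_norm_lt.2 h1)) ?_
      exact Ideal.mul_mem_left _ _ ((IsLocalRing.mem_maximalIdeal _).2 hu)
    exact (Ideal.ne_top_iff_one _).1 (IsLocalRing.maximalIdeal.isMaximal _).ne_top hmem
  refine ⟨X ^ N - R, hQ.unit⁻¹, monic_X_pow_sub hdeg, ?_, ?_, ?_⟩
  · rw [sub_eq_add_neg, natDegree_add_eq_left_of_degree_lt, natDegree_X_pow]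
    rwa [degree_neg, degree_X_pow]
  · intro m hm
    rw [coeff_sub, coeff_X_pow, if_neg hm.ne, zero_sub, dvd_neg]
    exact hR m hm
  · rw [heq, mul_assoc]
    simp

open Polynomial in
/-- The roots of a monic polynomial over the ring of integers are integral, and they have norm `< 1`
if the lower coefficients do. -/
lemma exists_fin_roots [IsAlgClosed L] {P : (IntRing L)[X]} (hP : P.Monic)
    (hlt : ∀ m < P.natDegree, ‖(P.coeff m : L)‖ < 1) :
    ∃ x : Fin P.natDegree → IntRing L, (∀ j, ‖(x j : L)‖ < 1) ∧ P = ∏ j, (X - C (x j)) := by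
  set φ := algebraMap (IntRing L) L with hφ
  have hinj : Function.Injective φ := IsFractionRing.injective _ _
  have hsplit := IsAlgClosed.splits (P.map φ)
  have hmonic := hP.map φ
  have hcard : (P.map φ).roots.toList.length = P.natDegree := by
    rw [Multiset.length_toList, ← hsplit.natDegree_eq_card_roots, hP.natDegree_map]
  have hroot : ∀ y ∈ (P.map φ).roots, ∃ x : IntRing L, φ x = y := fun y hy => by
    have : IsIntegral (IntRing L) y := by
      refine ⟨P, hP, ?_⟩
      have := (mem_roots'.1 hy).2
      rwa [IsRoot, eval_map] at this
    exact IsIntegrallyClosed.isIntegral_iff.1 this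
  choose! g hg using hroot
  have hmem : ∀ j : Fin P.natDegree, (P.map φ).roots.toList.get (j.cast hcard.symm) ∈
      (P.map φ).roots := fun j => Multiset.mem_toList.1 (List.get_mem _ _)
  refine ⟨fun j => g ((P.map φ).roots.toList.get (j.cast hcard.symm)), fun j => ?_, ?_⟩
  · have hr := hg _ (hmem j)
    set x := g ((P.map φ).roots.toList.get (j.cast hcard.symm))
    have he : P.eval x = 0 := by
      have := (mem_roots'.1 (hmem j)).2
      rw [IsRoot, ← hr, eval_map, eval₂_at_apply] at this
      exact hinj (by rw [this, map_zero])
    rw [← mem_maximalIdeal_iff_norm_lt]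
    rw [eval_eq_sum_range, Finset.sum_range_succ, hP.coeff_natDegree, one_mul] at he
    refine (IsLocalRing.maximalIdeal.isMaximal (IntRing L)).isPrime.mem_of_pow_mem P.natDegree ?_
    rw [← neg_eq_iff_add_eq_zero] at he
    rw [← he, neg_mem_iff]
    refine sum_mem fun m hm => Ideal.mul_mem_right _ _ (mem_maximalIdeal_iff_norm_lt.2 ?_)
    exact hlt m (Finset.mem_range.1 hm)
  · apply Polynomial.map_injective φ hinj
    have hlist : (P.map φ).roots = (P.map φ).roots.toList := (Multiset.coe_toList _).symm
    have hprod : ((P.map φ).roots.map fun y => X - C y).prod =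
        ∏ j : Fin (P.map φ).roots.toList.length, (X - C ((P.map φ).roots.toList.get j)) := by
      conv_lhs => rw [hlist, Multiset.map_coe, Multiset.prod_coe,
        ← List.ofFn_get (P.map φ).roots.toList, List.map_ofFn, List.prod_ofFn]
      simp
    refine (hsplit.eq_prod_roots_of_monic hmonic).trans ?_
    rw [hprod, Polynomial.map_prod]
    simp only [Polynomial.map_sub, map_X, map_C, hg _ (hmem _)]
    exact (Fintype.prod_equiv (finCongr hcard.symm) _ _ fun j => rfl).symm

section Eval
variable [CompleteSpace L]

/-- Evaluation of power series in one variable at an element of norm `< 1`, as a ring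
homomorphism. -/
def evalHom (x : IntRing L) (hx : ‖(x : L)‖ < 1) : PowerSeries (IntRing L) →+* IntRing L :=
  MvPowerSeries.eval₂Hom (φ := RingHom.id (IntRing L)) continuous_id
    (hasEval_of_norm_lt (σ := Unit) fun _ => hx)

lemma evalHom_apply {x : IntRing L} (hx : ‖(x : L)‖ < 1) (f : PowerSeries (IntRing L)) :
    evalHom x hx f = evalAt f fun _ : Unit => x := by
  rw [evalHom, MvPowerSeries.coe_eval₂Hom]
  exact (MvPowerSeries.hasSum_eval₂ (φ := RingHom.id (IntRing L)) continuous_id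
    (hasEval_of_norm_lt (σ := Unit) fun _ => hx) f).tsum_eq.symm

lemma evalHom_X {x : IntRing L} (hx : ‖(x : L)‖ < 1) : evalHom x hx PowerSeries.X = x := by
  rw [evalHom_apply, PowerSeries.X, evalAt_X fun _ => hx]

lemma evalHom_C {x : IntRing L} (hx : ‖(x : L)‖ < 1) (c : IntRing L) :
    evalHom x hx (PowerSeries.C c) = c := by
  rw [evalHom, MvPowerSeries.coe_eval₂Hom]
  exact MvPowerSeries.eval₂_C _ _ _

lemma norm_evalHom_unit {x : IntRing L} (hx : ‖(x : L)‖ < 1) (U : (PowerSeries (IntRing L))ˣ) :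
    ‖(evalHom x hx (U : PowerSeries (IntRing L)) : L)‖ = 1 :=
  isUnit_iff_norm_eq_one.1 (U.isUnit.map _)

/-- Over an algebraically closed field, a power series whose reduction has order `N` is the product
of a unit and of `N` linear factors with zeros in the open unit disc. The element `a` only serves to
exclude the trivial absolute value. -/
lemma exists_prod_factorization [IsAlgClosed L] {a : IntRing L} (h0 : a ≠ 0)
    (h1 : ‖(a : L)‖ < 1) {h : PowerSeries (IntRing L)} {N : ℕ}
    (hlt : ∀ m < N, ‖((PowerSeries.coeff m h : IntRing L) : L)‖ < 1)
    (hN : ‖((PowerSeries.coeff N h : IntRing L) : L)‖ = 1) :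
    ∃ (x : Fin N → IntRing L) (U : (PowerSeries (IntRing L))ˣ), (∀ j, ‖(x j : L)‖ < 1) ∧
      h = ((∏ j, (Polynomial.X - Polynomial.C (x j)) : Polynomial (IntRing L)) :
        PowerSeries (IntRing L)) * U := by
  -- the coefficients of degree `< N` have a common divisor of norm `< 1`
  obtain ⟨b, hb0, hb1, hb⟩ : ∃ b : IntRing L, b ≠ 0 ∧ ‖(b : L)‖ < 1 ∧
      ∀ m < N, b ∣ PowerSeries.coeff m h := by
    clear hN
    induction N with
    | zero => exact ⟨a, h0, h1, fun m hm => absurd hm (Nat.not_lt_zero m)⟩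
    | succ N ih =>
      obtain ⟨b, hb0, hb1, hb⟩ := ih fun m hm => hlt m (hm.trans N.lt_succ_self)
      rcases le_total ‖((PowerSeries.coeff N h : IntRing L) : L)‖ ‖(b : L)‖ with hle | hle
      · refine ⟨b, hb0, hb1, fun m hm => ?_⟩
        rcases Nat.lt_succ_iff_lt_or_eq.1 hm with hm | rfl
        exacts [hb m hm, dvd_iff_norm_le.2 hle]
      · refine ⟨PowerSeries.coeff N h, ?_, hlt N N.lt_succ_self, fun m hm => ?_⟩
        · rintro h
          rw [h] at hle
          exact hb0 (Subtype.ext (norm_le_zero_iff.1 (by simpa using hle)))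
        · rcases Nat.lt_succ_iff_lt_or_eq.1 hm with hm | rfl
          exacts [(dvd_iff_norm_le.2 hle).trans (hb m hm), dvd_rfl]
  obtain ⟨P, U, hP, rfl, hPa, rfl⟩ := exists_isDistinguishedAt_mul_unit hb0 hb1 hb
    (isUnit_iff_norm_eq_one.2 hN)
  obtain ⟨x, hx, hPx⟩ := exists_fin_roots hP
    fun m hm => (dvd_iff_norm_le.1 (hPa m hm)).trans_lt hb1
  exact ⟨x, U, hx, by rw [← hPx]⟩

lemma norm_evalHom_prod {N : ℕ} {x : Fin N → IntRing L} {U : (PowerSeries (IntRing L))ˣ}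
    {w : IntRing L} (hw : ‖(w : L)‖ < 1) :
    ‖(evalHom w hw (((∏ j, (Polynomial.X - Polynomial.C (x j)) : Polynomial (IntRing L)) :
        PowerSeries (IntRing L)) * U) : L)‖ = ∏ j, ‖(w : L) - x j‖ := by
  rw [map_mul, ← Polynomial.coeToPowerSeries.ringHom_apply, map_prod, map_prod]
  push_cast
  rw [norm_mul, norm_evalHom_unit, mul_one, norm_prod]
  refine Finset.prod_congr rfl fun j _ => ?_
  rw [map_sub, Polynomial.coeToPowerSeries.ringHom_apply, Polynomial.coeToPowerSeries.ringHom_apply,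
    Polynomial.coe_X, Polynomial.coe_C, map_sub, evalHom_X, evalHom_C]
  rfl

end Eval

section Gauss

/-- Multiplication by an integral power series does not increase the Gauss norm for a radius
`r ≤ 1`. -/
lemma norm_coeff_mul_pow_le {A B : PowerSeries (IntRing L)} {r C : ℝ} (hr : 0 ≤ r) (hr1 : r ≤ 1)
    (hA : ∀ m, ‖((PowerSeries.coeff m A : IntRing L) : L)‖ * r ^ m ≤ C) (m : ℕ) :
    ‖((PowerSeries.coeff m (A * B) : IntRing L) : L)‖ * r ^ m ≤ C := by
  have hC : 0 ≤ C := le_trans (by positivity) (hA 0)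
  rw [PowerSeries.coeff_mul]
  push_cast
  obtain ⟨i, hi, hle⟩ := IsUltrametricDist.exists_norm_finsetSum_le_of_nonempty
    (t := Finset.HasAntidiagonal.antidiagonal m) ⟨(0, m), by simp⟩
    (fun p : ℕ × ℕ => ((PowerSeries.coeff p.1 A : IntRing L) : L) *
      ((PowerSeries.coeff p.2 B : IntRing L) : L))
  refine (mul_le_mul_of_nonneg_right hle (by positivity)).trans ?_
  rw [norm_mul]
  have him : i.1 ≤ m := (Nat.le_add_right _ _).trans (Finset.HasAntidiagonal.mem_antidiagonal.1 hi).le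
  calc _ ≤ ‖((PowerSeries.coeff i.1 A : IntRing L) : L)‖ * 1 * r ^ i.1 := by
        gcongr ‖_‖ * ?_ * ?_
        · exact norm_le_one _
        · exact pow_le_pow_of_le_one hr hr1 him
    _ ≤ C := by simpa using hA i.1

open Polynomial in
/-- The Gauss norm of `∏ (X - x_j)` for the radius `r` is `∏ max(‖x_j‖, r)`, and a unit of the
ring of power series has Gauss norm `1`. -/
lemma forall_norm_coeff_mul_pow_le_iff {N : ℕ} {x : Fin N → IntRing L}
    {U : (PowerSeries (IntRing L))ˣ} {r C : ℝ} (hr : 0 < r) (hr1 : r ≤ 1) :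
    (∀ m, ‖((PowerSeries.coeff m (((∏ j, (X - Polynomial.C (x j)) : (IntRing L)[X]) :
        PowerSeries (IntRing L)) * (U : PowerSeries (IntRing L))) : IntRing L) : L)‖ * r ^ m ≤ C) ↔
      ∏ j, max ‖(x j : L)‖ r ≤ C := by
  set P : (IntRing L)[X] := ∏ j, (X - Polynomial.C (x j)) with hP
  have h1 : (∀ m, ‖((PowerSeries.coeff m ((P : PowerSeries (IntRing L)) *
      (U : PowerSeries (IntRing L))) : IntRing L) : L)‖ * r ^ m ≤ C) ↔
      ∀ m, ‖(P.coeff m : L)‖ * r ^ m ≤ C := by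
    constructor
    · intro h m
      have := norm_coeff_mul_pow_le (B := (↑U⁻¹ : PowerSeries (IntRing L))) hr.le hr1 h m
      rwa [mul_assoc, Units.mul_inv, mul_one, Polynomial.coeff_coe] at this
    · intro h m
      refine norm_coeff_mul_pow_le hr.le hr1 (fun m => ?_) m
      rw [Polynomial.coeff_coe]
      exact h m
  rw [h1]
  let v : AbsoluteValue L ℝ := NormedField.toAbsoluteValue L
  have hna : IsNonarchimedean v := fun a b => IsUltrametricDist.norm_add_le_max a b
  set φ := algebraMap (IntRing L) L
  have hg : (P.map φ).gaussNorm v r = ∏ j, max ‖(x j : L)‖ r := by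
    have hmul : ∀ s : Finset (Fin N), ((∏ j ∈ s, (X - Polynomial.C (x j : L))).gaussNorm v r) =
        ∏ j ∈ s, max ‖(x j : L)‖ r := by
      classical
      intro s
      induction s using Finset.induction_on with
      | empty =>
        rw [Finset.prod_empty, Finset.prod_empty, ← Polynomial.C_1, gaussNorm_C, map_one]
      | insert j s hj ih =>
        rw [Finset.prod_insert hj, Finset.prod_insert hj, gaussNorm_mul hna hr, ih]
        congr 1
        apply le_antisymm
        · obtain ⟨i, hi⟩ := (X - Polynomial.C (x j : L)).exists_eq_gaussNorm v r
          rw [hi]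
          rcases i with _ | _ | i
          · refine le_max_of_le_left (le_of_eq ?_)
            change ‖_‖ * _ = _
            simp
          · refine le_max_of_le_right (le_of_eq ?_)
            change ‖_‖ * _ = _
            simp
          · refine le_max_of_le_left ?_
            simp [Polynomial.coeff_X]
        · refine max_le ?_ ?_
          · refine le_trans (le_of_eq ?_) (le_gaussNorm v _ hr.le 0)
            change _ = ‖_‖ * _
            simp
          · refine le_trans (le_of_eq ?_) (le_gaussNorm v _ hr.le 1)
            change _ = ‖_‖ * _
            simp
    rw [← hmul, hP, Polynomial.map_prod]
    simp only [Polynomial.map_sub, map_X, map_C]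
    rfl
  rw [← hg]
  constructor
  · intro h
    obtain ⟨i, hi⟩ := (P.map φ).exists_eq_gaussNorm v r
    rw [hi, coeff_map]
    exact h i
  · intro h m
    refine le_trans ?_ h
    have := le_gaussNorm v (P.map φ) hr.le m
    rw [coeff_map] at this
    exact this

end Gauss

end IntRing

/-! ### The points of the formal module -/

namespace FormalModule.Points
variable {F K : Type*} [NormedField F] [IsUltrametricDist F] [NormedField K] [IsUltrametricDist K]
  [NormedAlgebra F K] {H : FormalModule F K}

/-- The absolute value of the coordinate of a point. -/
def nrm (x : H.Points) : ℝ := ‖(x.val : K)‖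

lemma nrm_nonneg (x : H.Points) : 0 ≤ nrm x := norm_nonneg _

lemma nrm_lt_one (x : H.Points) : nrm x < 1 := x.norm_lt

lemma nrm_eq_zero {x : H.Points} : nrm x = 0 ↔ x = 0 := by
  rw [nrm, norm_eq_zero, Points.ext_iff, val_zero]
  simp

lemma nrm_zero : nrm (0 : H.Points) = 0 := nrm_eq_zero.2 rfl

lemma nrm_pos {x : H.Points} (hx : x ≠ 0) : 0 < nrm x :=
  (nrm_nonneg x).lt_of_ne fun h => hx (nrm_eq_zero.1 h.symm)

lemma nrm_smul_le (a : IntRing F) (x : H.Points) : nrm (a • x) ≤ nrm x :=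
  norm_evalAt_le (H.act_constantCoeff a) (norm_nonneg _) fun _ => le_rfl

lemma nrm_add_le (x y : H.Points) : nrm (x + y) ≤ max (nrm x) (nrm y) := by
  refine norm_evalAt_le H.law.zero_constantCoeff (le_max_of_le_left (norm_nonneg _)) fun s => ?_
  fin_cases s
  exacts [le_max_left _ _, le_max_right _ _]

variable [CompleteSpace K]

lemma nrm_neg (x : H.Points) : nrm (-x) = nrm x := by
  refine le_antisymm (nrm_smul_le _ _) ?_
  conv_lhs => rw [← neg_neg x]
  exact nrm_smul_le _ _

lemma nrm_sub_le (x y : H.Points) : nrm (x - y) ≤ max (nrm x) (nrm y) := by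
  rw [sub_eq_add_neg, ← nrm_neg y]
  exact nrm_add_le x (-y)

lemma nrm_add_eq_of_lt {x y : H.Points} (h : nrm x < nrm y) : nrm (x + y) = nrm y := by
  refine le_antisymm ((nrm_add_le x y).trans (max_le h.le le_rfl)) ?_
  by_contra! hlt
  have := nrm_sub_le (x + y) x
  rw [add_sub_cancel_left] at this
  exact absurd this (not_le.2 (max_lt hlt h))

lemma nrm_unit_smul {a : IntRing F} (ha : IsUnit a) (x : H.Points) : nrm (a • x) = nrm x := by
  obtain ⟨u, rfl⟩ := ha
  refine le_antisymm (nrm_smul_le _ _) ?_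
  calc nrm x = nrm ((↑u⁻¹ : IntRing F) • (u : IntRing F) • x) := by
        rw [smul_smul, Units.inv_mul, one_smul]
    _ ≤ _ := nrm_smul_le _ _

/-- Subtracting `X + Z` and the terms without `Z` from the formal group law leaves monomials of
degree at least `2` that involve `Z`; these are smaller than `Z`. -/
lemma norm_val_add_sub_val (x z : H.Points) : ‖((x + z).val : K) - x.val‖ = nrm z := by
  by_cases hz : z = 0
  · subst hz
    rw [add_zero, sub_self, norm_zero, nrm_zero]
  have hzpos := nrm_pos hz
  set M := nrm z * max (nrm x) (nrm z) with hM
  have hMlt : M < nrm z := mul_lt_of_lt_one_right hzpos (max_lt (nrm_lt_one x) (nrm_lt_one z))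
  have hsum : ∀ y : H.Points, HasSum (fun d : Fin 2 →₀ ℕ =>
      MvPowerSeries.coeff d H.law.toPowerSeries * d.prod fun s e => ![x.val, y.val] s ^ e)
      (x + y).val := fun y => by
    have := MvPowerSeries.hasSum_eval₂ (φ := RingHom.id (IntRing K)) continuous_id
      (hasEval_of_norm_lt (norm_pair_lt x.norm_lt y.norm_lt)) H.law.toPowerSeries
    rw [val_add, evalAt]
    exact this.summable.hasSum
  have h1 := ((hsum z).sub (hsum 0)).sub (hasSum_ite_eq (Finsupp.single (1 : Fin 2) 1) z.val)
  rw [add_zero] at h1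
  -- the terms of `F(x, z) - F(x, 0) - z` are at most `M`
  have hle : ‖(((x + z).val - x.val - z.val : IntRing K) : K)‖ ≤ M := by
    have hM0 : 0 ≤ M := mul_nonneg (nrm_nonneg _) (le_max_of_le_left (nrm_nonneg _))
    rw [← h1.tsum_eq]
    refine tsum_mem (s := ballIdeal K M hM0)
      (isClosed_le (continuous_norm.comp continuous_subtype_val) continuous_const) fun d => ?_
    change ‖((_ : IntRing K) : K)‖ ≤ M
    have hprod : ∀ y : H.Points, (d.prod fun s e => ![x.val, y.val] s ^ e) =
        x.val ^ d 0 * y.val ^ d 1 := fun y => by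
      rw [Finsupp.prod_fintype _ _ fun _ => pow_zero _, Fin.prod_univ_two]
      rfl
    rw [hprod, hprod, val_zero]
    by_cases hd : d = Finsupp.single 1 1
    · subst hd
      simp [H.law.lin_coeff_Y, hM0]
    · rw [if_neg hd]
      rcases Nat.eq_zero_or_pos (d 1) with h | h
      · simp [h, hM0]
      · have h2 : ‖(x.val : K)‖ ^ d 0 * ‖(z.val : K)‖ ^ d 1 ≤ M := by
          change nrm x ^ d 0 * nrm z ^ d 1 ≤ M
          obtain ⟨k, hk⟩ := Nat.exists_eq_add_of_lt h
          rw [zero_add] at hk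
          have hx1 := (nrm_lt_one x).le
          have hz1 := (nrm_lt_one z).le
          have hx0 := nrm_nonneg x
          rw [hk, pow_succ, ← mul_assoc, mul_comm, hM]
          refine mul_le_mul_of_nonneg_left ?_ hzpos.le
          rcases Nat.eq_zero_or_pos (d 0) with h0 | h0
          · have hk0 : k ≠ 0 := by
              rintro rfl
              apply hd
              ext i
              fin_cases i
              · simpa using h0
              · simpa using hk
            rw [h0, pow_zero, one_mul]
            exact (pow_le_of_le_one hzpos.le hz1 hk0).trans (le_max_right _ _)
          · refine le_trans (mul_le_of_le_one_right (by positivity) (pow_le_one₀ hzpos.le hz1)) ?_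
            exact (pow_le_of_le_one hx0 hx1 h0.ne').trans (le_max_left _ _)
        rw [zero_pow h.ne', mul_zero, mul_zero, sub_zero, sub_zero]
        push_cast
        rw [norm_mul, norm_mul, norm_pow, norm_pow]
        exact (mul_le_of_le_one_left (by positivity) (norm_le_one _)).trans h2
  have heq : ((x + z).val : K) - x.val =
      (((x + z).val - x.val - z.val : IntRing K) : K) + z.val := by
    push_cast
    ring
  rw [heq, IsUltrametricDist.norm_add_eq_max_of_norm_ne_norm (hle.trans_lt hMlt).ne]
  exact max_eq_right (hle.trans hMlt.le)

/-- The translations of the formal group are isometries. -/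
lemma norm_val_sub_val (x y : H.Points) : ‖(x.val : K) - y.val‖ = nrm (x - y) := by
  have := norm_val_add_sub_val y (x - y)
  rwa [add_sub_cancel] at this

lemma val_smul_eq_evalHom (a : IntRing F) (x : H.Points) :
    (a • x).val = evalHom x.val x.norm_lt (H.act a) := by
  rw [evalHom_apply, val_smul]

/-- Near `0`, the endomorphism `[a]` multiplies the absolute value by that of `a`. -/
lemma nrm_smul_of_nrm_lt {a : IntRing F} {w : H.Points} (hw : nrm w < ‖(a : F)‖) :
    nrm (a • w) = ‖(a : F)‖ * nrm w := by
  obtain ⟨g, hg⟩ : ∃ g : PowerSeries (IntRing K),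
      H.act a = (g * PowerSeries.X + PowerSeries.C (intRingMap F K a)) * PowerSeries.X := by
    refine ⟨PowerSeries.mk fun m => PowerSeries.coeff (m + 2) (H.act a), ?_⟩
    ext m
    rcases m with _ | _ | m
    · simpa using H.act_constantCoeff a
    · rw [H.act_coeff_one, PowerSeries.coeff_succ_mul_X]
      simp
    · rw [PowerSeries.coeff_succ_mul_X, map_add, PowerSeries.coeff_succ_mul_X,
        PowerSeries.coeff_mk, PowerSeries.coeff_C]
      simp
  rw [nrm, val_smul_eq_evalHom, hg, map_mul, map_add, map_mul, evalHom_X, evalHom_C]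
  push_cast
  have ha : ‖((intRingMap F K a : IntRing K) : K)‖ = ‖(a : F)‖ := norm_algebraMap' K (a : F)
  rw [norm_mul, IsUltrametricDist.norm_add_eq_max_of_norm_ne_norm, max_eq_right, ha, nrm]
  all_goals
    rw [ha, norm_mul]
    first
      | refine (lt_of_le_of_lt ?_ hw).ne
      | refine (lt_of_le_of_lt ?_ hw).le
    exact mul_le_of_le_one_left (norm_nonneg _) (norm_le_one _)

end FormalModule.Points

/-! ### The zeros of `[ϖ]` and the torsion -/

namespace FormalModule
variable {F K : Type*} [NormedField F] [IsUltrametricDist F] [NormedField K] [IsUltrametricDist K]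
  [NormedAlgebra F K] [CompleteSpace K] {H : FormalModule F K} {ϖ : Uniformizer F}

open Points

variable (H ϖ) in
/-- The `ϖ`-torsion points of the formal module. -/
abbrev torsion : Submodule (IntRing F) H.Points := Submodule.torsionBy (IntRing F) H.Points ϖ.val

variable (H ϖ) in
/-- The function `r ↦ ∏ max(‖z‖, r)`, with `z` running through the `ϖ`-torsion. It is the Gauss
norm of `[ϖ]` for the radius `r`, that is, the Legendre transform of its Newton polygon, written
multiplicatively. -/
def gaussProd (r : ℝ) : ℝ := ∏ᶠ z : H.torsion ϖ, max (nrm (z : H.Points)) r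

/-- The zeros of `[ϖ](T) - y`, as a family with multiplicities, determine the absolute values and
the Gauss norms of this power series. -/
lemma exists_roots [IsAlgClosed K] {n : ℕ} (hn : H.HasHeight ϖ n) (y : H.Points) :
    ∃ (x : Fin (Nat.card (IsLocalRing.ResidueField (IntRing F)) ^ n) → H.Points),
      (∀ w : H.Points, nrm (ϖ.val • w - y) = ∏ j, nrm (w - x j)) ∧
      ∀ r C : ℝ, 0 < r → r ≤ 1 →
        ((∀ m, ‖((PowerSeries.coeff m (H.act ϖ.val - PowerSeries.C y.val) : IntRing K) : K)‖ *
          r ^ m ≤ C) ↔ ∏ j, max (nrm (x j)) r ≤ C) := by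
  set N := Nat.card (IsLocalRing.ResidueField (IntRing F)) ^ n with hN
  obtain ⟨h1, h2⟩ := PowerSeries.order_eq_nat.1 hn
  rw [← hN, PowerSeries.coeff_map, Ne, IsLocalRing.residue_eq_zero_iff,
    mem_maximalIdeal_iff_norm_lt] at h1
  have hN0 : N ≠ 0 := by
    rintro h
    rw [h, PowerSeries.coeff_zero_eq_constantCoeff, H.act_constantCoeff] at h1
    simp at h1
  obtain ⟨x, U, hx, hxU⟩ := exists_prod_factorization (L := K) (a := intRingMap F K ϖ.val)
    (h := H.act ϖ.val - PowerSeries.C y.val) (N := N)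
    (fun h => ϖ.ne_zero (by
      have h' : algebraMap F K ϖ.val = 0 := congrArg Subtype.val h
      simpa using h'))
    ((norm_algebraMap' K (ϖ.val : F)).trans_lt ϖ.norm_lt_one)
    (fun m hm => by
      have h3 := h2 m hm
      rw [PowerSeries.coeff_map, IsLocalRing.residue_eq_zero_iff,
        mem_maximalIdeal_iff_norm_lt] at h3
      rw [map_sub, PowerSeries.coeff_C]
      split_ifs with hm0
      · subst hm0
        rw [PowerSeries.coeff_zero_eq_constantCoeff, H.act_constantCoeff, zero_sub]
        simpa using y.norm_lt
      · simpa using h3)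
    (by
      rw [map_sub, PowerSeries.coeff_C, if_neg hN0, sub_zero]
      exact le_antisymm (norm_le_one _) (not_lt.1 h1))
  refine ⟨fun j => ⟨x j, hx j⟩, fun w => ?_, fun r C hr hr1 => ?_⟩
  · rw [← norm_val_sub_val]
    have := norm_evalHom_prod (x := x) (U := U) w.norm_lt
    rw [← hxU, map_sub, evalHom_C, ← val_smul_eq_evalHom] at this
    refine this.trans (Finset.prod_congr rfl fun j _ => ?_)
    exact norm_val_sub_val w ⟨x j, hx j⟩
  · rw [hxU]
    exact forall_norm_coeff_mul_pow_le_iff hr hr1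

omit [CompleteSpace K] in
lemma residueCard_pow_ne_zero {n : ℕ} (hn : H.HasHeight ϖ n) :
    Nat.card (IsLocalRing.ResidueField (IntRing F)) ^ n ≠ 0 := by
  intro h
  obtain ⟨h1, -⟩ := PowerSeries.order_eq_nat.1 hn
  rw [h, PowerSeries.coeff_map, PowerSeries.coeff_zero_eq_constantCoeff, H.act_constantCoeff,
    map_zero] at h1
  exact h1 rfl

lemma exists_smul_eq [IsAlgClosed K] {n : ℕ} (hn : H.HasHeight ϖ n) (y : H.Points) :
    ∃ x : H.Points, ϖ.val • x = y := by
  obtain ⟨x, hx, -⟩ := exists_roots hn y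
  have : NeZero (Nat.card (IsLocalRing.ResidueField (IntRing F)) ^ n) :=
    ⟨residueCard_pow_ne_zero hn⟩
  refine ⟨x 0, sub_eq_zero.1 (nrm_eq_zero.1 ?_)⟩
  rw [hx]
  exact Finset.prod_eq_zero (Finset.mem_univ 0) (by rw [sub_self, nrm_zero])

/-- The zeros of `[ϖ]` in the open unit disc are simple, since `‖[ϖ](w)‖ = ‖ϖ‖ ‖w‖` for small `w`,
so that they are parametrized by the factors of its Weierstrass polynomial. -/
lemma exists_equiv_torsion [IsAlgClosed K] {n : ℕ} (hn : H.HasHeight ϖ n) :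
    ∃ x : Fin (Nat.card (IsLocalRing.ResidueField (IntRing F)) ^ n) ≃ H.torsion ϖ,
      (∀ w : H.Points, nrm (ϖ.val • w) = ∏ j, nrm (w - (x j : H.Points))) ∧
      ∀ r C : ℝ, 0 < r → r ≤ 1 →
        ((∀ m, ‖((PowerSeries.coeff m (H.act ϖ.val) : IntRing K) : K)‖ * r ^ m ≤ C) ↔
          ∏ j, max (nrm (x j : H.Points)) r ≤ C) := by
  obtain ⟨x, hx, hg⟩ := exists_roots hn 0
  simp only [sub_zero, val_zero, map_zero] at hx hg
  have hmem : ∀ j, x j ∈ H.torsion ϖ := fun j => by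
    rw [Submodule.mem_torsionBy_iff, ← nrm_eq_zero, hx]
    exact Finset.prod_eq_zero (Finset.mem_univ j) (by rw [sub_self, nrm_zero])
  have hinj : Function.Injective x := fun i j hij => by
    by_contra hne
    have hϖ0 : 0 < ‖(ϖ.val : F)‖ := norm_pos_iff.2 ϖ.ne_zero
    have hϖ1 := ϖ.norm_lt_one
    have ha : ‖((intRingMap F K ϖ.val : IntRing K) : K)‖ = ‖(ϖ.val : F)‖ :=
      norm_algebraMap' K (ϖ.val : F)
    -- a double zero contradicts the behaviour of `[ϖ]` at the point `w = ϖ ^ 2`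
    set w : H.Points := ⟨intRingMap F K ϖ.val ^ 2, by
      push_cast
      rw [norm_pow, ha]
      exact pow_lt_one₀ hϖ0.le hϖ1 two_ne_zero⟩ with hw
    have hwn : nrm w = ‖(ϖ.val : F)‖ ^ 2 := by
      rw [nrm, hw]
      push_cast
      rw [norm_pow, ha]
    have h1 : nrm (ϖ.val • (x i + w)) = ‖(ϖ.val : F)‖ * nrm w := by
      rw [smul_add, (Submodule.mem_torsionBy_iff _ _).1 (hmem i), zero_add]
      refine nrm_smul_of_nrm_lt ?_
      rw [hwn]
      exact pow_lt_self_of_lt_one₀ hϖ0 hϖ1 one_lt_two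
    rw [hx, ← Finset.mul_prod_erase _ _ (Finset.mem_univ i),
      ← Finset.mul_prod_erase _ _ (Finset.mem_erase.2 ⟨Ne.symm hne, Finset.mem_univ j⟩), ← hij,
      add_sub_cancel_left, hwn] at h1
    have h2 : ∏ k ∈ (Finset.univ.erase i).erase j, nrm (x i + w - x k) ≤ 1 :=
      Finset.prod_le_one (fun _ _ => nrm_nonneg _) fun _ _ => (nrm_lt_one _).le
    nlinarith [mul_le_mul_of_nonneg_left h2 (by positivity :
      0 ≤ ‖(ϖ.val : F)‖ ^ 2 * ‖(ϖ.val : F)‖ ^ 2), pow_pos hϖ0 3]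
  have hbij : Function.Bijective fun j => (⟨x j, hmem j⟩ : H.torsion ϖ) := by
    refine ⟨fun i j hij => hinj (congrArg Subtype.val hij), fun z => ?_⟩
    have hz := hx z
    rw [(Submodule.mem_torsionBy_iff _ _).1 z.2, nrm_zero, eq_comm, Finset.prod_eq_zero_iff] at hz
    obtain ⟨j, -, hj⟩ := hz
    exact ⟨j, Subtype.ext (sub_eq_zero.1 (nrm_eq_zero.1 hj)).symm⟩
  exact ⟨Equiv.ofBijective _ hbij, hx, hg⟩

lemma gaussProd_eq_mul [Fintype (H.torsion ϖ)] [DecidableEq (H.torsion ϖ)] {r : ℝ} (hr : 0 ≤ r) :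
    H.gaussProd ϖ r = r * ∏ z ∈ Finset.univ.erase (0 : H.torsion ϖ),
      max (nrm (z : H.Points)) r := by
  rw [gaussProd, finprod_eq_prod_of_fintype, ← Finset.mul_prod_erase _ _ (Finset.mem_univ 0)]
  congr 1
  rw [Submodule.coe_zero, nrm_zero, max_eq_right hr]

lemma gaussProd_nonneg {r : ℝ} (hr : 0 ≤ r) : 0 ≤ H.gaussProd ϖ r :=
  finprod_nonneg fun _ => le_max_of_le_right hr

section Torsion
variable [IsAlgClosed K] {n : ℕ} (hn : H.HasHeight ϖ n)
include hn

lemma finite_torsion : Finite (H.torsion ϖ) := by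
  obtain ⟨x, -⟩ := exists_equiv_torsion hn
  exact Finite.of_equiv _ x

lemma card_torsion :
    Nat.card (H.torsion ϖ) = Nat.card (IsLocalRing.ResidueField (IntRing F)) ^ n := by
  obtain ⟨x, -⟩ := exists_equiv_torsion hn
  rw [← Nat.card_congr x, Nat.card_eq_fintype_card, Fintype.card_fin]

lemma nrm_uniformizer_smul (w : H.Points) :
    nrm (ϖ.val • w) = ∏ᶠ z : H.torsion ϖ, nrm (w - (z : H.Points)) := by
  obtain ⟨x, hx, -⟩ := exists_equiv_torsion hn
  rw [hx, ← finprod_eq_prod_of_fintype]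
  exact finprod_eq_of_bijective x x.bijective fun _ => rfl

lemma forall_norm_coeff_le_iff_gaussProd_le {r C : ℝ} (hr : 0 < r) (hr1 : r ≤ 1) :
    (∀ m, ‖((PowerSeries.coeff m (H.act ϖ.val) : IntRing K) : K)‖ * r ^ m ≤ C) ↔
      H.gaussProd ϖ r ≤ C := by
  obtain ⟨x, -, hg⟩ := exists_equiv_torsion hn
  rw [hg r C hr hr1, ← finprod_eq_prod_of_fintype, gaussProd]
  rw [finprod_eq_of_bijective (g := fun z : H.torsion ϖ => max (nrm (z : H.Points)) r) x
    x.bijective fun _ => rfl]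

lemma nrm_uniformizer_smul_le (w : H.Points) : nrm (ϖ.val • w) ≤ H.gaussProd ϖ (nrm w) := by
  have := finite_torsion hn
  have := Fintype.ofFinite (H.torsion ϖ)
  rw [nrm_uniformizer_smul hn, gaussProd, finprod_eq_prod_of_fintype, finprod_eq_prod_of_fintype]
  exact Finset.prod_le_prod (fun _ _ => nrm_nonneg _) fun z _ =>
    (nrm_sub_le _ _).trans (max_comm _ _).le

/-- A solution `x` of `ϖ x = y` of minimal absolute value: then no torsion point `z` is nearer to `x`
than `0`, so that `‖x - z‖ = max(‖z‖, ‖x‖)`. -/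
lemma exists_smul_eq_gaussProd_eq (y : H.Points) :
    ∃ x : H.Points, ϖ.val • x = y ∧ H.gaussProd ϖ (nrm x) = nrm y := by
  have := finite_torsion hn
  have := Fintype.ofFinite (H.torsion ϖ)
  obtain ⟨x₁, h₁⟩ := exists_smul_eq hn y
  obtain ⟨z₁, hz₁⟩ := Finite.exists_min fun z : H.torsion ϖ => nrm (x₁ - (z : H.Points))
  have hmem : ∀ z : H.torsion ϖ, ϖ.val • (z : H.Points) = 0 := fun z =>
    (Submodule.mem_torsionBy_iff _ _).1 z.2
  refine ⟨x₁ - (z₁ : H.Points), by rw [smul_sub, h₁, hmem, sub_zero], ?_⟩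
  rw [show nrm y = nrm (ϖ.val • (x₁ - (z₁ : H.Points))) by rw [smul_sub, h₁, hmem, sub_zero],
    nrm_uniformizer_smul hn, gaussProd,
    finprod_eq_prod_of_fintype, finprod_eq_prod_of_fintype]
  refine Finset.prod_congr rfl fun z _ => ?_
  refine le_antisymm (max_le ?_ ?_) ((nrm_sub_le _ _).trans (max_comm _ _).le)
  · by_contra! hlt
    have h2 : nrm (x₁ - (z₁ : H.Points)) < nrm (-(z : H.Points)) := by
      rw [nrm_neg]
      refine lt_of_le_of_lt ?_ hlt
      rw [sub_sub]
      exact hz₁ (z₁ + z)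
    have h3 := nrm_add_eq_of_lt h2
    rw [← sub_eq_add_neg, nrm_neg] at h3
    exact hlt.ne h3
  · rw [sub_sub]
    exact hz₁ (z₁ + z)

lemma gaussProd_lt {r s : ℝ} (hr : 0 ≤ r) (hrs : r < s) :
    H.gaussProd ϖ r < H.gaussProd ϖ s := by
  classical
  have := finite_torsion hn
  have := Fintype.ofFinite (H.torsion ϖ)
  rw [gaussProd_eq_mul hr, gaussProd_eq_mul (hr.trans hrs.le)]
  refine mul_lt_mul hrs ?_ ?_ (hr.trans hrs.le)
  · exact Finset.prod_le_prod (fun z _ => le_max_of_le_right hr) fun z _ =>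
      max_le_max le_rfl hrs.le
  · refine Finset.prod_pos fun z hz => lt_max_of_lt_left (nrm_pos fun h => ?_)
    exact Finset.ne_of_mem_erase hz (Subtype.ext h)

lemma le_of_gaussProd_le {r s : ℝ} (hs : 0 ≤ s) (h : H.gaussProd ϖ r ≤ H.gaussProd ϖ s) :
    r ≤ s :=
  not_lt.1 fun hlt => absurd (gaussProd_lt hn hs hlt) (not_lt.2 h)

lemma gaussProd_mono {r s : ℝ} (hr : 0 ≤ r) (hrs : r ≤ s) :
    H.gaussProd ϖ r ≤ H.gaussProd ϖ s := by
  rcases hrs.eq_or_lt with rfl | h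
  exacts [le_rfl, (gaussProd_lt hn hr h).le]

/-- All factors of `gaussProd` are at most `1`, and the one of `0` is `r`. -/
lemma gaussProd_le_mul {r : ℝ} (hr : 0 ≤ r) (hr1 : r ≤ 1) {z : H.torsion ϖ} (hz : z ≠ 0) :
    H.gaussProd ϖ r ≤ r * max (nrm (z : H.Points)) r := by
  classical
  have := finite_torsion hn
  have := Fintype.ofFinite (H.torsion ϖ)
  rw [gaussProd_eq_mul hr,
    ← Finset.mul_prod_erase _ _ (Finset.mem_erase.2 ⟨hz, Finset.mem_univ z⟩)]
  refine mul_le_mul_of_nonneg_left (mul_le_of_le_one_right (le_max_of_le_right hr) ?_) hr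
  exact Finset.prod_le_one (fun _ _ => le_max_of_le_right hr) fun _ _ =>
    max_le (nrm_lt_one _).le hr1

lemma gaussProd_zero : H.gaussProd ϖ 0 = 0 := by
  classical
  have := finite_torsion hn
  have := Fintype.ofFinite (H.torsion ϖ)
  rw [gaussProd_eq_mul le_rfl, zero_mul]

lemma gaussProd_pos {r : ℝ} (hr : 0 < r) : 0 < H.gaussProd ϖ r := by
  rw [← gaussProd_zero hn]
  exact gaussProd_lt hn le_rfl hr

end Torsion

end FormalModule

/-! ### Orthogonal bases over a trivially valued field -/

section Orthogonal
variable {k W : Type*} [Field k] [AddCommGroup W] [Module k W]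

/-- An ultrametric seminorm on a vector space over a field with the trivial absolute value. -/
structure TrivialSeminorm (k W : Type*) [Field k] [AddCommGroup W] [Module k W] where
  toFun : W → ℝ
  nonneg' : ∀ x, 0 ≤ toFun x
  zero' : toFun 0 = 0
  add_le' : ∀ x y, toFun (x + y) ≤ max (toFun x) (toFun y)
  smul_le' : ∀ (a : k) x, toFun (a • x) ≤ toFun x

/-- The largest `ρ i` for which `c i ≠ 0`: this is the norm of the vector with coordinates `c` in
an orthogonal basis whose vectors have the norms `ρ i`. -/
def supportNorm {n : ℕ} (ρ : Fin n → ℝ) (c : Fin n → k) : ℝ :=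
  open Classical in ‖fun i => if c i ≠ 0 then ρ i else 0‖

lemma le_supportNorm {n : ℕ} {ρ : Fin n → ℝ} {c : Fin n → k} {i : Fin n} (hi : c i ≠ 0) :
    ρ i ≤ supportNorm ρ c := by
  classical
  refine le_trans ?_ (norm_le_pi_norm (fun i => if c i ≠ 0 then ρ i else 0) i)
  rw [if_pos hi]
  exact le_abs_self _

lemma supportNorm_le_iff {n : ℕ} {ρ : Fin n → ℝ} (hρ : ∀ i, 0 ≤ ρ i) {c : Fin n → k} {C : ℝ}
    (hC : 0 ≤ C) : supportNorm ρ c ≤ C ↔ ∀ i, c i ≠ 0 → ρ i ≤ C := by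
  refine ⟨fun h i hi => (le_supportNorm hi).trans h, fun h => ?_⟩
  refine (pi_norm_le_iff_of_nonneg hC).2 fun i => ?_
  split_ifs with hi
  · rw [Real.norm_of_nonneg (hρ i)]
    exact h i hi
  · simpa using hC

lemma supportNorm_nonneg {n : ℕ} {ρ : Fin n → ℝ} {c : Fin n → k} : 0 ≤ supportNorm ρ c :=
  norm_nonneg _

namespace TrivialSeminorm
variable (N : TrivialSeminorm k W)

lemma sum_le {ι : Type*} (s : Finset ι) (f : ι → W) {C : ℝ} (hC : 0 ≤ C)
    (h : ∀ i ∈ s, N.toFun (f i) ≤ C) : N.toFun (∑ i ∈ s, f i) ≤ C :=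
  Finset.sum_induction f (fun x => N.toFun x ≤ C)
    (fun x y hx hy => (N.add_le' x y).trans (max_le hx hy)) (by rwa [N.zero']) h

lemma sum_smul_le {n : ℕ} (b : Fin n → W) (c : Fin n → k) :
    N.toFun (∑ i, c i • b i) ≤ supportNorm (fun i => N.toFun (b i)) c := by
  refine N.sum_le _ _ supportNorm_nonneg fun i _ => ?_
  by_cases hi : c i = 0
  · rw [hi, zero_smul, N.zero']
    exact supportNorm_nonneg
  · exact (N.smul_le' _ _).trans (le_supportNorm (ρ := fun i => N.toFun (b i)) hi)

/-- A basis `b` is orthogonal if the norm of `∑ c i • b i` is the largest norm of a `b i` with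
`c i ≠ 0`; one inequality is automatic. -/
def IsOrthogonal {n : ℕ} (b : Module.Basis (Fin n) k W) : Prop :=
  ∀ (c : Fin n → k) (i : Fin n), c i ≠ 0 → N.toFun (b i) ≤ N.toFun (∑ i, c i • b i)

variable {N}

lemma IsOrthogonal.eq_supportNorm {n : ℕ} {b : Module.Basis (Fin n) k W} (hb : N.IsOrthogonal b)
    (c : Fin n → k) : N.toFun (∑ i, c i • b i) = supportNorm (fun i => N.toFun (b i)) c :=
  le_antisymm (N.sum_smul_le _ _)
    ((supportNorm_le_iff (fun _ => N.nonneg' _) (N.nonneg' _)).2 (hb c))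

/-- A basis for which the sum of the norms is minimal is orthogonal, by the exchange lemma. -/
lemma exists_isOrthogonal [Finite W] {n : ℕ} (hn : Module.finrank k W = n) :
    ∃ b : Module.Basis (Fin n) k W, Monotone (fun i => N.toFun (b i)) ∧ N.IsOrthogonal b := by
  classical
  have : Module.Finite k W := Module.Finite.of_finite
  have : Finite (Module.Basis (Fin n) k W) :=
    Finite.of_injective (fun b => (b : Fin n → W)) DFunLike.coe_injective
  have : Nonempty (Module.Basis (Fin n) k W) := ⟨Module.finBasisOfFinrankEq k W hn⟩
  obtain ⟨b, hb⟩ := Finite.exists_min fun b : Module.Basis (Fin n) k W => ∑ i, N.toFun (b i)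
  have hbo : N.IsOrthogonal b := by
    intro c i hi
    by_contra! hlt
    set w := ∑ i, c i • b i with hw
    have hli : LinearIndependent k (Function.update b i w) := by
      refine b.linearIndependent.update i w ⟨1, one_mem _, b.repr w, ?_, ?_⟩
      · rw [hw, b.repr_sum_self]
        exact mem_nonZeroDivisors_of_ne_zero hi
      · rw [one_smul, b.linearCombination_repr]
    have hcard : Fintype.card (Fin n) = Module.finrank k W := by rw [hn, Fintype.card_fin]
    rcases Nat.eq_zero_or_pos n with rfl | hpos
    · exact i.elim0
    have : Nonempty (Fin n) := ⟨⟨0, hpos⟩⟩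
    have hmin := hb (basisOfLinearIndependentOfCardEqFinrank hli hcard)
    rw [coe_basisOfLinearIndependentOfCardEqFinrank] at hmin
    refine absurd hmin (not_le.2 (Finset.sum_lt_sum (fun j _ => ?_) ⟨i, Finset.mem_univ i, ?_⟩))
    · by_cases hji : j = i
      · subst hji
        rw [Function.update_self]
        exact hlt.le
      · rw [Function.update_of_ne hji]
    · rw [Function.update_self]
      exact hlt
  refine ⟨b.reindex (Tuple.sort fun i => N.toFun (b i)).symm, ?_, ?_⟩
  · have := Tuple.monotone_sort fun i => N.toFun (b i)
    simpa [Function.comp_def] using this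
  · intro c i hi
    set σ := Tuple.sort fun i => N.toFun (b i)
    have := hbo (fun j => c (σ.symm j)) (σ i) (by simpa using hi)
    simp only [Module.Basis.reindex_apply, Equiv.symm_symm]
    refine this.trans (le_of_eq ?_)
    congr 1
    exact (Equiv.sum_comp σ (fun j => c (σ.symm j) • b j)).symm.trans (by simp)

/-- A basis whose vectors have the same norms as those of an orthogonal basis is orthogonal: the
sum of the norms of all vectors of `W` is the largest possible one. -/
lemma IsOrthogonal.of_norm_eq [Finite k] {n : ℕ} {b b' : Module.Basis (Fin n) k W}
    (hb : N.IsOrthogonal b) (h : ∀ i, N.toFun (b' i) = N.toFun (b i)) : N.IsOrthogonal b' := by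
  have := Fintype.ofFinite k
  have := Module.Finite.of_basis b
  have : Finite W := Module.finite_of_finite k
  have := Fintype.ofFinite W
  classical
  set ρ : Fin n → ℝ := fun i => N.toFun (b i) with hρ
  have hle : ∀ c : Fin n → k, N.toFun (∑ i, c i • b' i) ≤ supportNorm ρ c := fun c => by
    have := N.sum_smul_le b' c
    simpa only [h] using this
  have hsum : ∀ e : Module.Basis (Fin n) k W,
      ∑ c : Fin n → k, N.toFun (∑ i, c i • e i) = ∑ w, N.toFun w := fun e =>
    Fintype.sum_equiv e.equivFun.symm.toEquiv _ _ fun c => by simp [Module.Basis.equivFun_symm_apply]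
  have heq : ∑ c : Fin n → k, N.toFun (∑ i, c i • b' i) = ∑ c : Fin n → k, supportNorm ρ c := by
    rw [hsum b', ← hsum b]
    exact Finset.sum_congr rfl fun c _ => hb.eq_supportNorm c
  have hall := (Finset.sum_eq_sum_iff_of_le fun c _ => hle c).1 heq
  intro c i hi
  rw [hall c (Finset.mem_univ c), h]
  exact le_supportNorm (ρ := ρ) hi

end TrivialSeminorm

/-- There are `q ^ (i + 1) - q ^ i` vectors whose last nonzero coordinate is the one of index `i`, and
they have the norm `ρ i`. -/
lemma prod_max_supportNorm [Fintype k] {n : ℕ} {ρ : Fin n → ℝ} (hρ : ∀ i, 0 ≤ ρ i)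
    (hmono : Monotone ρ) {r : ℝ} (hr : 0 ≤ r) :
    ∏ c : Fin n → k, max (supportNorm ρ c) r =
      r * ∏ i : Fin n, max (ρ i) r ^ (Fintype.card k ^ (i + 1 : ℕ) - Fintype.card k ^ (i : ℕ)) := by
  classical
  induction n with
  | zero =>
    simp only [Finset.univ_eq_empty, Finset.prod_empty, mul_one, Finset.univ_unique,
      Finset.prod_singleton]
    exact max_eq_right ((supportNorm_le_iff hρ hr).2 fun i => i.elim0)
  | succ n ih =>
    have h0 : ∀ c : Fin n → k, supportNorm ρ (Fin.snoc c 0 : Fin (n + 1) → k) =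
        supportNorm (fun i => ρ i.castSucc) c := fun c => by
      refine le_antisymm ?_ ?_
      · refine (supportNorm_le_iff hρ supportNorm_nonneg).2 fun i => ?_
        refine Fin.lastCases ?_ (fun i hi => ?_) i
        · simp
        · rw [Fin.snoc_castSucc] at hi
          exact le_supportNorm (ρ := fun i => ρ i.castSucc) hi
      · refine (supportNorm_le_iff (fun _ => hρ _) supportNorm_nonneg).2 fun i hi => ?_
        exact le_supportNorm (i := i.castSucc) (by rwa [Fin.snoc_castSucc])
    have h1 : ∀ (c : Fin n → k) (a : k), a ≠ 0 →
        supportNorm ρ (Fin.snoc c a : Fin (n + 1) → k) = ρ (Fin.last n) := fun c a ha => by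
      refine le_antisymm ((supportNorm_le_iff hρ (hρ _)).2 fun i _ => hmono (Fin.le_last i)) ?_
      exact le_supportNorm (by rwa [Fin.snoc_last])
    rw [← Fintype.prod_equiv (Fin.snocEquiv fun _ : Fin (n + 1) => k)
      (fun p => max (supportNorm ρ (Fin.snoc p.2 p.1 : Fin (n + 1) → k)) r) _ fun p => rfl,
      Fintype.prod_prod_type, ← Finset.mul_prod_erase _ _ (Finset.mem_univ (0 : k))]
    simp only [h0]
    rw [ih (fun _ => hρ _) fun i j hij => hmono (Fin.castSucc_le_castSucc_iff.2 hij),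
      Fin.prod_univ_castSucc, ← mul_assoc]
    congr 1
    rw [Finset.prod_congr rfl fun a ha => Finset.prod_congr rfl fun c _ => by
      rw [h1 c a (Finset.ne_of_mem_erase ha)]]
    simp only [Finset.prod_const, Finset.card_univ, Fintype.card_fun, Fintype.card_fin,
      Finset.card_erase_of_mem (Finset.mem_univ _), ← pow_mul, Fin.val_last]
    congr 1
    rw [pow_succ, Nat.mul_sub, mul_one]

end Orthogonal

/-! ### The residue field and an orthogonal basis of the torsion -/

section ResidueField
variable {F : Type*} [NormedField F] [IsUltrametricDist F]

namespace Uniformizer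
variable (ϖ : Uniformizer F)

lemma dvd_iff_norm_lt_one {a : IntRing F} : ϖ.val ∣ a ↔ ‖(a : F)‖ < 1 := by
  refine ⟨fun h => (dvd_iff_norm_le.1 h).trans_lt ϖ.norm_lt_one, fun ha => ?_⟩
  by_contra hdvd
  rw [dvd_iff_norm_le, not_le] at hdvd
  obtain ⟨c, hc⟩ := dvd_iff_norm_le.2 hdvd.le
  rcases ϖ.irreducible.isUnit_or_isUnit hc with h | h
  · exact ha.ne (isUnit_iff_norm_eq_one.1 h)
  · refine hdvd.ne ?_
    rw [hc]
    push_cast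
    rw [norm_mul, isUnit_iff_norm_eq_one.1 h, mul_one]

lemma isUnit_iff_not_dvd {a : IntRing F} : IsUnit a ↔ ¬ ϖ.val ∣ a := by
  rw [ϖ.dvd_iff_norm_lt_one, isUnit_iff_norm_eq_one, (norm_le_one a).lt_iff_ne, not_not]

lemma maximalIdeal_eq : IsLocalRing.maximalIdeal (IntRing F) = Ideal.span {ϖ.val} := by
  ext a
  rw [mem_maximalIdeal_iff_norm_lt, Ideal.mem_span_singleton, ϖ.dvd_iff_norm_lt_one]

/-- An element of `F` that is not integral is `ϖ ^ (-k)` times a unit, with `k ≥ 1`. -/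
lemma exists_eq_inv_pow_mul {c : F} (hc : c ∉ IntRing F) :
    ∃ (k : ℕ) (u : IntRing F), IsUnit u ∧ c = ((ϖ.val : F) ^ (k + 1))⁻¹ * u := by
  classical
  have hex := ϖ.exists_pow_mul c
  obtain ⟨k, hk⟩ : ∃ k, Nat.find hex = k + 1 := Nat.exists_eq_succ_of_ne_zero fun h0 => hc (by
    have := Nat.find_spec hex
    rwa [h0, pow_zero, one_mul] at this)
  have hspec := Nat.find_spec hex
  rw [hk] at hspec
  refine ⟨k, ⟨_, hspec⟩, ?_, ?_⟩
  · rw [ϖ.isUnit_iff_not_dvd]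
    rintro ⟨d, hd⟩
    refine Nat.find_min hex (m := k) (by omega) ?_
    have h1 : (ϖ.val : F) ^ (k + 1) * c = ϖ.val * d := congrArg Subtype.val hd
    rw [pow_succ', mul_assoc] at h1
    rw [mul_left_cancel₀ ϖ.ne_zero h1]
    exact d.2
  · exact (inv_mul_cancel_left₀ (pow_ne_zero _ ϖ.ne_zero) c).symm

/-- The residue field of `F`, as the quotient by the ideal of the uniformizer. -/
abbrev ResField : Type _ := IntRing F ⧸ Ideal.span {ϖ.val}

instance : (Ideal.span {ϖ.val}).IsMaximal := by
  rw [← ϖ.maximalIdeal_eq]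
  infer_instance

instance : Field ϖ.ResField := Ideal.Quotient.field _

lemma card_resField : Nat.card ϖ.ResField = Nat.card (IsLocalRing.ResidueField (IntRing F)) := by
  rw [ResField, ← ϖ.maximalIdeal_eq]
  rfl

lemma finite_resField [ProperSpace F] : Finite ϖ.ResField := by
  have hc : CompactSpace (IntRing F) := by
    have : (IntRing F : Set F) = Metric.closedBall 0 1 := by
      ext x; simpa using mem_intRing (x := x)
    exact isCompact_iff_compactSpace.1 (this ▸ isCompact_closedBall (0 : F) 1)
  have hopen : IsOpen ((Ideal.span {ϖ.val} : Ideal (IntRing F)) : Set (IntRing F)) := by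
    have := (isAdic_iff.1 (isAdic_span_singleton ϖ.irreducible.ne_zero ϖ.norm_lt_one)).1 1
    rwa [pow_one] at this
  exact AddSubgroup.quotient_finite_of_isOpen (Ideal.span {ϖ.val} : Ideal (IntRing F)).toAddSubgroup
    hopen

lemma one_lt_residueCard [ProperSpace F] (ϖ : Uniformizer F) :
    1 < (Nat.card (IsLocalRing.ResidueField (IntRing F)) : ℝ) := by
  have := ϖ.finite_resField
  rw [← ϖ.card_resField]
  exact_mod_cast Finite.one_lt_card

end Uniformizer
end ResidueField

namespace FormalModule
variable {F K : Type*} [NormedField F] [IsUltrametricDist F] [NormedField K] [IsUltrametricDist K]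
  [NormedAlgebra F K] [CompleteSpace K] {H : FormalModule F K} {ϖ : Uniformizer F}

open Points

variable (H ϖ) in
/-- The absolute value of the coordinate, on the vector space of the `ϖ`-torsion points. -/
def torsionSeminorm : TrivialSeminorm ϖ.ResField (H.torsion ϖ) where
  toFun z := nrm (z : H.Points)
  nonneg' _ := nrm_nonneg _
  zero' := nrm_zero
  add_le' _ _ := nrm_add_le _ _
  smul_le' a z := by
    obtain ⟨a, rfl⟩ := Ideal.Quotient.mk_surjective a
    exact nrm_smul_le a (z : H.Points)

omit [CompleteSpace K] in
/-- The coefficient `ϖ` of `T` in `[ϖ](T)` is not a unit, so that the height is positive. -/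
lemma ne_zero_of_hasHeight {n : ℕ} (hn : H.HasHeight ϖ n) : n ≠ 0 := by
  rintro rfl
  obtain ⟨h1, -⟩ := PowerSeries.order_eq_nat.1 hn
  rw [pow_zero, PowerSeries.coeff_map, H.act_coeff_one, Ne, IsLocalRing.residue_eq_zero_iff,
    mem_maximalIdeal_iff_norm_lt] at h1
  exact h1 ((norm_algebraMap' K (ϖ.val : F)).trans_lt ϖ.norm_lt_one)

section Torsion
variable [IsAlgClosed K] [ProperSpace F] {n : ℕ} (hn : H.HasHeight ϖ n)
include hn

lemma finrank_torsion : Module.finrank ϖ.ResField (H.torsion ϖ) = n := by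
  have := ϖ.finite_resField
  have := finite_torsion hn
  have h1 := Module.natCard_eq_pow_finrank (K := ϖ.ResField) (V := H.torsion ϖ)
  rw [card_torsion hn, ← ϖ.card_resField] at h1
  exact (Nat.pow_right_injective Finite.one_lt_card h1).symm

lemma exists_torsion_basis : ∃ b : Module.Basis (Fin n) ϖ.ResField (H.torsion ϖ),
    Monotone (fun i => nrm (b i : H.Points)) ∧ (H.torsionSeminorm ϖ).IsOrthogonal b := by
  have := finite_torsion hn
  exact TrivialSeminorm.exists_isOrthogonal (N := H.torsionSeminorm ϖ) (finrank_torsion hn)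

/-- The Gauss norm of `[ϖ]` in terms of the norms of an orthogonal basis of the torsion. -/
lemma gaussProd_eq_prod {b : Module.Basis (Fin n) ϖ.ResField (H.torsion ϖ)}
    (hmono : Monotone (fun i => nrm (b i : H.Points)))
    (hb : (H.torsionSeminorm ϖ).IsOrthogonal b) {r : ℝ} (hr : 0 ≤ r) :
    H.gaussProd ϖ r = r * ∏ i : Fin n, max (nrm (b i : H.Points)) r ^
      (Nat.card (IsLocalRing.ResidueField (IntRing F)) ^ (i + 1 : ℕ) -
        Nat.card (IsLocalRing.ResidueField (IntRing F)) ^ (i : ℕ)) := by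
  have := ϖ.finite_resField
  have := Fintype.ofFinite ϖ.ResField
  have := finite_torsion hn
  have := Fintype.ofFinite (H.torsion ϖ)
  rw [← ϖ.card_resField, Nat.card_eq_fintype_card,
    ← prod_max_supportNorm (k := ϖ.ResField) (fun i => nrm_nonneg _) hmono hr, gaussProd,
    finprod_eq_prod_of_fintype]
  refine (Fintype.prod_equiv b.equivFun.symm.toEquiv _ _ fun c => ?_).symm
  have := hb.eq_supportNorm c
  change _ = max ((H.torsionSeminorm ϖ).toFun (b.equivFun.symm c)) r
  rw [Module.Basis.equivFun_symm_apply, this]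
  rfl

end Torsion
end FormalModule

/-! ### The Newton polygon -/

section LegendreSum

/-- The function `σ ↦ σ + ∑ (q ^ (j + 1) - q ^ j) min(v j, σ)`, whose Legendre dual is the Newton
polygon with slope `v j` between the abscissae `q ^ j` and `q ^ (j + 1)`. -/
def legendreSum (q : ℝ) (n : ℕ) (v : ℕ → ℝ) (σ : ℝ) : ℝ :=
  σ + ∑ j ∈ Finset.range n, (q ^ (j + 1) - q ^ j) * min (v j) σ

variable {q : ℝ} {n : ℕ} {v : ℕ → ℝ}

lemma pow_succ_sub_pow_nonneg (hq : 1 ≤ q) (j : ℕ) : 0 ≤ q ^ (j + 1) - q ^ j :=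
  sub_nonneg.2 (pow_le_pow_right₀ hq j.le_succ)

lemma legendreSum_sub_mul {i : ℕ} (hi : i ≤ n) (σ : ℝ) : legendreSum q n v σ - σ * q ^ i =
    ∑ j ∈ Finset.range i, (q ^ (j + 1) - q ^ j) * (min (v j) σ - σ) +
      ∑ j ∈ Finset.Ico i n, (q ^ (j + 1) - q ^ j) * min (v j) σ := by
  have h1 : q ^ i = 1 + ∑ j ∈ Finset.range i, (q ^ (j + 1) - q ^ j) := by
    rw [Finset.sum_range_sub, pow_zero]
    ring
  rw [legendreSum, ← Finset.sum_range_add_sum_Ico _ hi, h1]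
  simp only [mul_sub, Finset.sum_sub_distrib, ← Finset.sum_mul]
  ring

lemma legendreSum_sub_mul_le (hq : 1 ≤ q) {i : ℕ} (hi : i ≤ n) (σ : ℝ) :
    legendreSum q n v σ - σ * q ^ i ≤ ∑ j ∈ Finset.Ico i n, (q ^ (j + 1) - q ^ j) * v j := by
  rw [legendreSum_sub_mul hi]
  have h1 : ∑ j ∈ Finset.range i, (q ^ (j + 1) - q ^ j) * (min (v j) σ - σ) ≤ 0 :=
    Finset.sum_nonpos fun j _ => mul_nonpos_of_nonneg_of_nonpos (pow_succ_sub_pow_nonneg hq j)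
      (sub_nonpos.2 (min_le_right _ _))
  have h2 : ∑ j ∈ Finset.Ico i n, (q ^ (j + 1) - q ^ j) * min (v j) σ ≤
      ∑ j ∈ Finset.Ico i n, (q ^ (j + 1) - q ^ j) * v j :=
    Finset.sum_le_sum fun j _ => mul_le_mul_of_nonneg_left (min_le_left _ _)
      (pow_succ_sub_pow_nonneg hq j)
  linarith

lemma legendreSum_sub_mul_eq (hv : Antitone v) {i : ℕ} (hi : i ≤ n) :
    legendreSum q n v (v i) - v i * q ^ i =
      ∑ j ∈ Finset.Ico i n, (q ^ (j + 1) - q ^ j) * v j := by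
  rw [legendreSum_sub_mul hi, Finset.sum_eq_zero fun j hj => ?_, zero_add]
  · refine Finset.sum_congr rfl fun j hj => ?_
    rw [min_eq_left (hv (Finset.mem_Ico.1 hj).1)]
  · rw [min_eq_right (hv (Finset.mem_range.1 hj).le), sub_self, mul_zero]

lemma sub_le_legendreSum_sub (hq : 1 ≤ q) {σ τ : ℝ} (h : σ ≤ τ) :
    τ - σ ≤ legendreSum q n v τ - legendreSum q n v σ := by
  have : ∑ j ∈ Finset.range n, (q ^ (j + 1) - q ^ j) * min (v j) σ ≤
      ∑ j ∈ Finset.range n, (q ^ (j + 1) - q ^ j) * min (v j) τ :=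
    Finset.sum_le_sum fun j _ => mul_le_mul_of_nonneg_left (min_le_min le_rfl h)
      (pow_succ_sub_pow_nonneg hq j)
  rw [legendreSum, legendreSum]
  linarith

lemma le_legendreSum (hq : 1 ≤ q) (hv : ∀ j, 0 ≤ v j) {σ : ℝ} (hσ : 0 ≤ σ) :
    σ ≤ legendreSum q n v σ := by
  have : 0 ≤ ∑ j ∈ Finset.range n, (q ^ (j + 1) - q ^ j) * min (v j) σ :=
    Finset.sum_nonneg fun j _ => mul_nonneg (pow_succ_sub_pow_nonneg hq j) (le_min (hv j) hσ)
  rw [legendreSum]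
  linarith

/-- The Newton polygon of the points `pts`, if the affine functions of slope `-σ ≤ 0` below them
are given by `legendreSum`. The hypothesis `hpos` on positive slopes holds if the points contain
`(q ^ n, 0)`. -/
lemma newtonPolygon_pow {pts : ℕ → EReal} (hq : 1 ≤ q) (hv : Antitone v) (hv0 : ∀ j, 0 ≤ v j)
    (hpts : ∀ σ u : ℝ, 0 ≤ σ →
      ((∀ m : ℕ, ((-σ * m + u : ℝ) : EReal) ≤ pts m) ↔ u ≤ legendreSum q n v σ))
    (hpos : ∀ s u : ℝ, 0 ≤ s → (∀ m : ℕ, ((s * m + u : ℝ) : EReal) ≤ pts m) → s * q ^ n + u ≤ 0)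
    {i : ℕ} (hi : i ≤ n) :
    newtonPolygon pts (q ^ i) = ∑ j ∈ Finset.Ico i n, (q ^ (j + 1) - q ^ j) * v j := by
  refine IsGreatest.csSup_eq ⟨⟨-v i, legendreSum q n v (v i), ?_, ?_⟩, ?_⟩
  · exact (hpts _ _ (hv0 i)).2 le_rfl
  · rw [← legendreSum_sub_mul_eq hv hi]
    ring
  · rintro _ ⟨s, u, h, rfl⟩
    rcases le_total s 0 with hs | hs
    · have h1 := (hpts (-s) u (neg_nonneg.2 hs)).1 (by simpa using h)
      have h2 := legendreSum_sub_mul_le (v := v) hq hi (-s)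
      linarith
    · have h1 := hpos s u hs h
      have h2 : s * q ^ i ≤ s * q ^ n := mul_le_mul_of_nonneg_left (pow_le_pow_right₀ hq hi) hs
      have h3 : 0 ≤ ∑ j ∈ Finset.Ico i n, (q ^ (j + 1) - q ^ j) * v j :=
        Finset.sum_nonneg fun j _ => mul_nonneg (pow_succ_sub_pow_nonneg hq j) (hv0 j)
      linarith

/-- If a point of height `legendreSum q n v σ` is added at the abscissa `0`, then the first slope
of the polygon becomes `-σ`: thus `nextSlope` inverts `legendreSum`. -/
lemma newtonPolygon_update_sub {pts : ℕ → EReal} (hq : 1 ≤ q) (hv0 : ∀ j, 0 ≤ v j)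
    (htop : pts 0 = ⊤)
    (hpts : ∀ σ u : ℝ, 0 ≤ σ →
      ((∀ m : ℕ, ((-σ * m + u : ℝ) : EReal) ≤ pts m) ↔ u ≤ legendreSum q n v σ))
    (hpos : ∀ s u : ℝ, 0 ≤ s → (∀ m : ℕ, ((s * m + u : ℝ) : EReal) ≤ pts m) → s * q ^ n + u ≤ 0)
    {σ t : ℝ} (hσ : 0 ≤ σ) (ht : legendreSum q n v σ = t) :
    newtonPolygon (Function.update pts 0 (t : EReal)) 0 -
      newtonPolygon (Function.update pts 0 (t : EReal)) 1 = σ := by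
  have hiff : ∀ s u : ℝ, (∀ m : ℕ, ((s * m + u : ℝ) : EReal) ≤ Function.update pts 0 (t : EReal) m) ↔
      u ≤ t ∧ ∀ m : ℕ, ((s * m + u : ℝ) : EReal) ≤ pts m := by
    intro s u
    constructor
    · refine fun h => ⟨?_, fun m => ?_⟩
      · have := h 0
        rw [Function.update_self, EReal.coe_le_coe_iff] at this
        simpa using this
      · rcases Nat.eq_zero_or_pos m with rfl | hm
        · rw [htop]
          exact le_top
        · have := h m
          rwa [Function.update_of_ne hm.ne'] at this
    · rintro ⟨h1, h2⟩ m
      rcases Nat.eq_zero_or_pos m with rfl | hm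
      · rw [Function.update_self, EReal.coe_le_coe_iff]
        simpa using h1
      · rw [Function.update_of_ne hm.ne']
        exact h2 m
  have hmem := (hiff (-σ) t).2 ⟨le_rfl, (hpts σ t hσ).2 ht.ge⟩
  have h0 : newtonPolygon (Function.update pts 0 (t : EReal)) 0 = t := by
    refine IsGreatest.csSup_eq ⟨⟨-σ, t, hmem, by ring⟩, ?_⟩
    rintro _ ⟨s, u, h, rfl⟩
    rw [mul_zero, zero_add]
    exact ((hiff s u).1 h).1
  have h1 : newtonPolygon (Function.update pts 0 (t : EReal)) 1 = t - σ := by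
    refine IsGreatest.csSup_eq ⟨⟨-σ, t, hmem, by ring⟩, ?_⟩
    rintro _ ⟨s, u, h, rfl⟩
    obtain ⟨hu, h⟩ := (hiff s u).1 h
    rcases le_total s 0 with hs | hs
    · rcases le_total σ (-s) with hσs | hσs
      · linarith
      · have h2 := (hpts (-s) u (neg_nonneg.2 hs)).1 (by simpa using h)
        have h3 := sub_le_legendreSum_sub (n := n) (v := v) hq hσs
        linarith
    · have h2 := hpos s u hs h
      have h3 : s * 1 ≤ s * q ^ n := mul_le_mul_of_nonneg_left (one_le_pow₀ hq) hs
      have h4 := le_legendreSum (n := n) hq hv0 hσ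
      linarith
  rw [h0, h1]
  ring

end LegendreSum

namespace Uniformizer
variable {F : Type*} [NormedField F] [IsUltrametricDist F] (ϖ : Uniformizer F)

/-- The additive valuation of an element of absolute value `r`. -/
def logVal (r : ℝ) : ℝ := Real.log r / Real.log ‖(ϖ.val : F)‖

lemma norm_pos : 0 < ‖(ϖ.val : F)‖ := norm_pos_iff.2 ϖ.ne_zero

lemma rpow_logVal {r : ℝ} (hr : 0 < r) : ‖(ϖ.val : F)‖ ^ ϖ.logVal r = r := by
  rw [Real.rpow_def_of_pos ϖ.norm_pos, logVal, mul_div_cancel₀ _ ϖ.log_neg.ne, Real.exp_log hr]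

lemma logVal_rpow (t : ℝ) : ϖ.logVal (‖(ϖ.val : F)‖ ^ t) = t := by
  rw [logVal, Real.log_rpow ϖ.norm_pos, mul_div_cancel_right₀ _ ϖ.log_neg.ne]

lemma logVal_pos {r : ℝ} (hr : 0 < r) (hr1 : r < 1) : 0 < ϖ.logVal r :=
  div_pos_of_neg_of_neg (Real.log_neg hr hr1) ϖ.log_neg

lemma logVal_anti {r s : ℝ} (hr : 0 < r) (hrs : r ≤ s) : ϖ.logVal s ≤ ϖ.logVal r :=
  div_le_div_of_nonpos_of_le ϖ.log_neg.le (Real.log_le_log hr hrs)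

lemma le_logVal_iff {r t : ℝ} (hr : 0 < r) : t ≤ ϖ.logVal r ↔ r ≤ ‖(ϖ.val : F)‖ ^ t := by
  rw [logVal, le_div_iff_of_neg ϖ.log_neg, Real.le_rpow_iff_log_le hr ϖ.norm_pos]

lemma logVal_max {r s : ℝ} (hr : 0 < r) (hs : 0 < s) :
    ϖ.logVal (max r s) = min (ϖ.logVal r) (ϖ.logVal s) := by
  rcases le_total r s with h | h
  · rw [max_eq_right h, min_eq_right (ϖ.logVal_anti hr h)]
  · rw [max_eq_left h, min_eq_left (ϖ.logVal_anti hs h)]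

lemma addVal_of_ne_zero {K : Type*} [NormedField K] {x : K} (hx : x ≠ 0) :
    ϖ.addVal x = (ϖ.logVal ‖x‖ : ℝ) := if_neg hx

lemma coe_le_addVal_iff {K : Type*} [NormedField K] {x : K} {t : ℝ} :
    (t : EReal) ≤ ϖ.addVal x ↔ ‖x‖ ≤ ‖(ϖ.val : F)‖ ^ t := by
  by_cases hx : x = 0
  · rw [addVal, if_pos hx, hx, norm_zero]
    exact iff_of_true le_top (Real.rpow_nonneg (norm_nonneg _) _)
  · rw [ϖ.addVal_of_ne_zero hx, EReal.coe_le_coe_iff, ϖ.le_logVal_iff (norm_pos_iff.2 hx)]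

end Uniformizer

namespace FormalModule
variable {F K : Type*} [NormedField F] [IsUltrametricDist F] [NormedField K] [IsUltrametricDist K]
  [NormedAlgebra F K] [CompleteSpace K] {H : FormalModule F K} {ϖ : Uniformizer F}
  [IsAlgClosed K] [ProperSpace F] {n : ℕ} (hn : H.HasHeight ϖ n)
  {b : Module.Basis (Fin n) ϖ.ResField (H.torsion ϖ)}
  (hmono : Monotone (fun i => Points.nrm (b i : H.Points)))
  (hb : (H.torsionSeminorm ϖ).IsOrthogonal b)

open Points

/-- The valuations of the vectors of a basis of the torsion, continued by `0`. -/
def torsionVal (b : Module.Basis (Fin n) ϖ.ResField (H.torsion ϖ)) (j : ℕ) : ℝ :=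
  if h : j < n then ϖ.logVal (nrm (b ⟨j, h⟩ : H.Points)) else 0

omit [IsAlgClosed K] [ProperSpace F] in
lemma nrm_basis_pos (i : Fin n) : 0 < nrm (b i : H.Points) :=
  nrm_pos fun h => b.ne_zero i (Subtype.ext h)

omit [IsAlgClosed K] [ProperSpace F] in
lemma torsionVal_nonneg (j : ℕ) : 0 ≤ torsionVal b j := by
  unfold torsionVal
  split_ifs with h
  exacts [(ϖ.logVal_pos (nrm_basis_pos _) (nrm_lt_one _)).le, le_rfl]

omit [IsAlgClosed K] [ProperSpace F] in
include hmono in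
lemma torsionVal_antitone : Antitone (torsionVal b) := by
  intro i j hij
  by_cases hj : j < n
  · rw [torsionVal, dif_pos hj, torsionVal, dif_pos (hij.trans_lt hj)]
    exact ϖ.logVal_anti (nrm_basis_pos _) (hmono hij)
  · rw [torsionVal, dif_neg hj]
    exact torsionVal_nonneg i

include hn hmono hb

/-- In additive terms, `gaussProd` is the Legendre transform of a polygon whose slopes are the
valuations of an orthogonal basis of the torsion. -/
lemma logVal_gaussProd (σ : ℝ) : ϖ.logVal (H.gaussProd ϖ (‖(ϖ.val : F)‖ ^ σ)) =
    legendreSum (Nat.card (IsLocalRing.ResidueField (IntRing F))) n (torsionVal b) σ := by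
  have hr : 0 < ‖(ϖ.val : F)‖ ^ σ := Real.rpow_pos_of_pos ϖ.norm_pos σ
  have hmax : ∀ i, 0 < max (nrm (b i : H.Points)) (‖(ϖ.val : F)‖ ^ σ) := fun i =>
    lt_max_of_lt_right hr
  rw [gaussProd_eq_prod hn hmono hb hr.le, Uniformizer.logVal,
    Real.log_mul hr.ne' (Finset.prod_pos fun i _ => pow_pos (hmax i) _).ne', add_div,
    Real.log_prod fun i _ => (pow_pos (hmax i) _).ne', Finset.sum_div, legendreSum,
    Finset.sum_range]
  congr 1
  · exact ϖ.logVal_rpow σ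
  · refine Finset.sum_congr rfl fun i _ => ?_
    have h1 : 1 ≤ Nat.card (IsLocalRing.ResidueField (IntRing F)) := by
      exact_mod_cast ϖ.one_lt_residueCard.le
    rw [Real.log_pow, mul_div_assoc, Nat.cast_sub (Nat.pow_le_pow_right h1 (Nat.le_succ _))]
    push_cast
    congr 1
    rw [torsionVal, dif_pos i.2]
    have := ϖ.logVal_max (nrm_basis_pos (b := b) i) hr
    rwa [ϖ.logVal_rpow] at this

/-- The affine functions of slope `-σ ≤ 0` below the Newton points are bounded by the Gauss norm of
`[ϖ]` for the radius `‖ϖ‖ ^ σ ≤ 1`. -/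
lemma forall_le_newtonPoints_iff {σ u : ℝ} (hσ : 0 ≤ σ) :
    (∀ m : ℕ, ((-σ * m + u : ℝ) : EReal) ≤ H.newtonPoints ϖ m) ↔
      u ≤ legendreSum (Nat.card (IsLocalRing.ResidueField (IntRing F))) n (torsionVal b) σ := by
  have hr : 0 < ‖(ϖ.val : F)‖ ^ σ := Real.rpow_pos_of_pos ϖ.norm_pos σ
  have hr1 : ‖(ϖ.val : F)‖ ^ σ ≤ 1 := Real.rpow_le_one ϖ.norm_pos.le ϖ.norm_lt_one.le hσ
  rw [← logVal_gaussProd hn hmono hb, ϖ.le_logVal_iff (gaussProd_pos hn hr),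
    ← forall_norm_coeff_le_iff_gaussProd_le hn hr hr1]
  refine forall_congr' fun m => ?_
  rw [newtonPoints, ϖ.coe_le_addVal_iff, neg_mul, neg_add_eq_sub, Real.rpow_sub ϖ.norm_pos,
    Real.rpow_mul ϖ.norm_pos.le, Real.rpow_natCast, le_div_iff₀ (pow_pos hr m)]

omit hmono hb [IsAlgClosed K] [CompleteSpace K] [ProperSpace F] in
/-- The coefficient of `T ^ (q ^ n)` in `[ϖ](T)` is a unit, so that the Newton points contain
`(q ^ n, 0)`. -/
lemma mul_pow_add_nonpos {s u : ℝ}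
    (h : ∀ m : ℕ, ((s * m + u : ℝ) : EReal) ≤ H.newtonPoints ϖ m) :
    s * (Nat.card (IsLocalRing.ResidueField (IntRing F)) : ℝ) ^ n + u ≤ 0 := by
  have h1 := h (Nat.card (IsLocalRing.ResidueField (IntRing F)) ^ n)
  obtain ⟨h2, -⟩ := PowerSeries.order_eq_nat.1 hn
  rw [PowerSeries.coeff_map, Ne, IsLocalRing.residue_eq_zero_iff,
    mem_maximalIdeal_iff_norm_lt] at h2
  rw [newtonPoints, ϖ.coe_le_addVal_iff, le_antisymm (norm_le_one _) (not_lt.1 h2)] at h1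
  by_contra! hlt
  have := Real.rpow_lt_one ϖ.norm_pos.le ϖ.norm_lt_one hlt
  push_cast at h1
  exact absurd h1 (not_le.2 this)

omit hn hmono hb [IsAlgClosed K] [CompleteSpace K] [ProperSpace F] in
lemma newtonPoints_zero : H.newtonPoints ϖ 0 = ⊤ := by
  rw [newtonPoints, PowerSeries.coeff_zero_eq_constantCoeff, H.act_constantCoeff]
  exact if_pos rfl

/-- The slopes of the Newton polygon are the valuations of an orthogonal basis of the torsion. -/
lemma firstSlope_eq (i : Fin n) : H.firstSlope ϖ i = ϖ.logVal (nrm (b i : H.Points)) := by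
  set q : ℝ := (Nat.card (IsLocalRing.ResidueField (IntRing F)) : ℝ) with hq
  have hq1 : 1 < q := ϖ.one_lt_residueCard
  have hN : ∀ i ≤ n, newtonPolygon (H.newtonPoints ϖ) (q ^ i) =
      ∑ j ∈ Finset.Ico i n, (q ^ (j + 1) - q ^ j) * torsionVal b j := fun i hi =>
    newtonPolygon_pow hq1.le (torsionVal_antitone hmono) torsionVal_nonneg
      (fun σ u hσ => forall_le_newtonPoints_iff hn hmono hb hσ)
      (fun s u _ h => mul_pow_add_nonpos hn h) hi
  have hne : q ^ (i + 1 : ℕ) - q ^ (i : ℕ) ≠ 0 :=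
    (sub_pos.2 (pow_lt_pow_right₀ hq1 (Nat.lt_succ_self _))).ne'
  change (newtonPolygon (H.newtonPoints ϖ) (q ^ (i : ℕ)) -
    newtonPolygon (H.newtonPoints ϖ) (q ^ (i + 1 : ℕ))) / _ = _
  rw [hN _ i.2.le, hN _ i.2, Finset.sum_eq_sum_Ico_succ_bot i.2, add_sub_cancel_right]
  change _ / (q ^ (i + 1 : ℕ) - q ^ (i : ℕ)) = _
  rw [mul_div_cancel_left₀ _ hne, torsionVal, dif_pos i.2]

/-- The passage from `λ_i^{(k)}` to `λ_i^{(k+1)}` inverts `gaussProd`, up to the translation between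
absolute values and valuations. -/
lemma nextSlope_eq {r s : ℝ} (hs : 0 < s) (hs1 : s < 1) (h : H.gaussProd ϖ s = r) :
    H.nextSlope ϖ (ϖ.logVal r) = ϖ.logVal s := by
  refine newtonPolygon_update_sub (ϖ.one_lt_residueCard.le) (torsionVal_nonneg (b := b))
    newtonPoints_zero
    (fun σ u hσ => forall_le_newtonPoints_iff hn hmono hb hσ)
    (fun s u _ h => mul_pow_add_nonpos hn h) (ϖ.logVal_pos hs hs1).le ?_
  rw [← logVal_gaussProd hn hmono hb, ϖ.rpow_logVal hs, h]

/-- The numbers `λ_i^{(k)}` are the valuations of a sequence that starts with a vector of an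
orthogonal basis of the torsion and continues with division points of minimal norm. -/
lemma slope_eq {i : Fin n} {r : ℕ → ℝ} (h0 : r 0 = nrm (b i : H.Points)) (hpos : ∀ k, 0 < r k)
    (hlt : ∀ k, r k < 1) (h : ∀ k, H.gaussProd ϖ (r (k + 1)) = r k) (k : ℕ) :
    H.slope ϖ i (k + 1) = (ϖ.logVal (r k) : ℝ) := by
  rw [slope, EReal.coe_eq_coe_iff]
  induction k with
  | zero => rw [Function.iterate_zero, id, firstSlope_eq hn hmono hb, h0]
  | succ k ih =>
    rw [Function.iterate_succ_apply', ih]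
    exact nextSlope_eq hn hmono hb (hpos _) (hlt _) (h k)

end FormalModule

/-! ### The Tate module and minimal bases -/

namespace FormalModule
variable {F K : Type*} [NormedField F] [IsUltrametricDist F] [NormedField K] [IsUltrametricDist K]
  [NormedAlgebra F K] [CompleteSpace K] {H : FormalModule F K} {ϖ : Uniformizer F}

open Points

section RatTate

lemma ratTate_smul_apply (a : IntRing F) (x : H.ratTate ϖ) (i : ℤ) : (a • x).1 i = a • x.1 i := rfl

lemma coe_smul_ratTate (a : IntRing F) (x : H.ratTate ϖ) : (a : F) • x = a • x :=
  algebraMap_smul F a x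

lemma inv_pow_smul_apply (x : H.ratTate ϖ) (k : ℕ) (i : ℤ) :
    (((ϖ.val : F) ^ k)⁻¹ • x).1 i = x.1 (i + k) := by
  rw [ratTate.smul_apply x (a := 1) (k := k), one_smul]
  rw [mul_inv_cancel₀ (pow_ne_zero _ ϖ.ne_zero)]
  rfl

lemma uniformizer_pow_smul_apply (x : H.ratTate ϖ) (k : ℕ) (i : ℤ) :
    (ϖ.val ^ k • x).1 (i + k) = x.1 i :=
  ratTate.pow_smul x k i

/-- The absolute value of the component of index `0`. -/
def tateNrm (x : H.ratTate ϖ) : ℝ := nrm (x.1 0)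

lemma tateNrm_nonneg (x : H.ratTate ϖ) : 0 ≤ tateNrm x := nrm_nonneg _

lemma tateNrm_eq_zero {x : H.ratTate ϖ} : tateNrm x = 0 ↔ x ∈ H.tate ϖ := nrm_eq_zero

lemma tateNrm_smul_le (a : IntRing F) (x : H.ratTate ϖ) : tateNrm (a • x) ≤ tateNrm x :=
  nrm_smul_le _ _

lemma tateNrm_unit_smul {a : IntRing F} (ha : IsUnit a) (x : H.ratTate ϖ) :
    tateNrm (a • x) = tateNrm x :=
  nrm_unit_smul ha _

lemma tateNrm_add_le (x y : H.ratTate ϖ) : tateNrm (x + y) ≤ max (tateNrm x) (tateNrm y) :=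
  nrm_add_le _ _

lemma tateNrm_sub_le (x y : H.ratTate ϖ) : tateNrm (x - y) ≤ max (tateNrm x) (tateNrm y) :=
  nrm_sub_le _ _

lemma tateNrm_sum_le {ι : Type*} (s : Finset ι) (f : ι → H.ratTate ϖ) {C : ℝ} (hC : 0 ≤ C)
    (h : ∀ i ∈ s, tateNrm (f i) ≤ C) : tateNrm (∑ i ∈ s, f i) ≤ C :=
  Finset.sum_induction f (fun x => tateNrm x ≤ C)
    (fun x y hx hy => (tateNrm_add_le x y).trans (max_le hx hy))
    (by rwa [tateNrm_eq_zero.2 (zero_mem _)]) h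

lemma tateNrm_inv_pow_smul (x : H.ratTate ϖ) (k : ℕ) :
    tateNrm (((ϖ.val : F) ^ k)⁻¹ • x) = nrm (x.1 k) := by
  rw [tateNrm, inv_pow_smul_apply, zero_add]

end RatTate

section Tate

variable (H ϖ) in
/-- The reduction `T_p(H) → T_p(H) / ϖ T_p(H)`, the quotient being the `ϖ`-torsion of `H`. -/
def tateRed : H.tate ϖ →ₗ[IntRing F] H.torsion ϖ where
  toFun x := ⟨x.1.1 1, by
    rw [Submodule.mem_torsionBy_iff]
    exact (x.1.2.1 0).trans x.2⟩
  map_add' _ _ := rfl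
  map_smul' _ _ := rfl

lemma exists_smul_eq_of_tateRed_eq_zero {x : H.tate ϖ} (hx : H.tateRed ϖ x = 0) :
    ∃ y : H.tate ϖ, ϖ.val • y = x := by
  have h1 : x.1.1 1 = 0 := congrArg Subtype.val hx
  refine ⟨⟨((ϖ.val : F) ^ 1)⁻¹ • x.1, ?_⟩, Subtype.ext ?_⟩
  · change (((ϖ.val : F) ^ 1)⁻¹ • x.1).1 0 = 0
    rw [inv_pow_smul_apply]
    simpa using h1
  · change ϖ.val • ((ϖ.val : F) ^ 1)⁻¹ • x.1 = x.1
    rw [← coe_smul_ratTate, pow_one, smul_inv_smul₀ ϖ.ne_zero]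

lemma tate_smul_left_injective : Function.Injective fun x : H.tate ϖ => ϖ.val • x := by
  intro x y hxy
  have h : (ϖ.val : F) • x.1 = (ϖ.val : F) • y.1 := by
    rw [coe_smul_ratTate, coe_smul_ratTate]
    exact congrArg Subtype.val hxy
  exact Subtype.ext (smul_right_injective _ ϖ.ne_zero h)

instance : IsHausdorff (Ideal.span {ϖ.val}) (H.tate ϖ) where
  haus' x hx := by
    have h : ∀ k : ℕ, x.1.1 k = 0 := fun k => by
      have h1 := hx k
      rw [SModEq.zero, Ideal.span_singleton_pow, Submodule.ideal_span_singleton_smul,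
        Submodule.mem_smul_pointwise_iff_exists] at h1
      obtain ⟨y, -, rfl⟩ := h1
      have := uniformizer_pow_smul_apply y.1 k 0
      rw [zero_add] at this
      exact this.trans y.2
    refine Subtype.ext (Subtype.ext (funext fun i => ?_))
    rcases le_total 0 i with hi | hi
    · lift i to ℕ using hi
      exact h i
    · have h2 := uniformizer_pow_smul_apply x.1 (-i).toNat i
      rw [Int.toNat_of_nonneg (by omega), add_neg_cancel, ratTate_smul_apply] at h2
      rw [← h2, show x.1.1 0 = 0 from x.2, smul_zero]
      rfl

lemma isPrecomplete_fin_fun [CompleteSpace F] (n : ℕ) :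
    IsPrecomplete (Ideal.span {ϖ.val}) (Fin n → IntRing F) where
  prec' f hf := by
    have := isAdicComplete_span_singleton ϖ.irreducible.ne_zero ϖ.norm_lt_one
    have hmem : ∀ (m : ℕ) (x y : Fin n → IntRing F),
        x ≡ y [SMOD (Ideal.span {ϖ.val} ^ m • ⊤ : Submodule (IntRing F) (Fin n → IntRing F))] ↔
          ∀ i, x i ≡ y i [SMOD (Ideal.span {ϖ.val} ^ m • ⊤ : Submodule (IntRing F) (IntRing F))] := by
      intro m x y
      simp only [SModEq.sub_mem, Ideal.span_singleton_pow, Submodule.ideal_span_singleton_smul,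
        Submodule.mem_smul_pointwise_iff_exists]
      constructor
      · rintro ⟨z, -, hz⟩ i
        exact ⟨z i, trivial, congrFun hz i⟩
      · intro h
        choose z _ hz using h
        exact ⟨z, trivial, funext hz⟩
    have h1 : ∀ i, ∃ L : IntRing F, ∀ m, f m i ≡ L
        [SMOD (Ideal.span {ϖ.val} ^ m • ⊤ : Submodule (IntRing F) (IntRing F))] := fun i =>
      IsPrecomplete.prec' (fun m => f m i) fun hmn => (hmem _ _ _).1 (hf hmn) i
    choose L hL using h1
    exact ⟨L, fun m => (hmem _ _ _).2 fun i => hL i m⟩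

/-- Elements of `T_p(H)` whose reductions form a basis of the torsion form a basis, by Nakayama's
lemma for the complete ring of integers of `F` and the Hausdorff module `T_p(H)`. -/
lemma exists_tate_basis [CompleteSpace F] {n : ℕ}
    (b : Module.Basis (Fin n) ϖ.ResField (H.torsion ϖ)) {e : Fin n → H.tate ϖ}
    (he : ∀ i, H.tateRed ϖ (e i) = b i) :
    ∃ E : Module.Basis (Fin n) (IntRing F) (H.tate ϖ), ∀ i, E i = e i := by
  set f : (Fin n → IntRing F) →ₗ[IntRing F] H.tate ϖ :=
    Fintype.linearCombination (IntRing F) e with hf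
  have hfc : ∀ c, f c = ∑ i, c i • e i := fun c => Fintype.linearCombination_apply _ _ _
  have hred : ∀ c : Fin n → IntRing F, H.tateRed ϖ (f c) =
      ∑ i, (Ideal.Quotient.mk (Ideal.span {ϖ.val}) (c i) : ϖ.ResField) • b i := fun c => by
    rw [hfc, map_sum]
    refine Finset.sum_congr rfl fun i _ => ?_
    rw [map_smul, he]
    rfl
  have hinj : Function.Injective f := by
    have hdvd : ∀ (m : ℕ) (c : Fin n → IntRing F), f c = 0 → ∀ i, ϖ.val ^ m ∣ c i := by
      intro m
      induction m with
      | zero => exact fun c _ i => by simp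
      | succ m ih =>
        intro c hc
        have h1 := hred c
        rw [hc, map_zero] at h1
        have h2 := (Fintype.linearIndependent_iff.1 b.linearIndependent) _ h1.symm
        have h3 : ∀ i, ϖ.val ∣ c i := fun i =>
          Ideal.mem_span_singleton.1 (Ideal.Quotient.eq_zero_iff_mem.1 (h2 i))
        choose d hd using h3
        have hcd : c = ϖ.val • d := funext hd
        have h4 : f d = 0 := by
          refine tate_smul_left_injective ?_
          change ϖ.val • f d = ϖ.val • 0
          rw [← map_smul, ← hcd, hc, smul_zero]
        intro i
        rw [hd i, pow_succ']
        exact mul_dvd_mul_left _ (ih d h4 i)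
    refine (injective_iff_map_eq_zero f).2 fun c hc => funext fun i => Subtype.ext (norm_le_zero_iff.1 ?_)
    refine ge_of_tendsto' (tendsto_pow_atTop_nhds_zero_of_norm_lt_one
      (x := ‖(ϖ.val : F)‖) (by simpa using ϖ.norm_lt_one)) fun m => ?_
    simpa using dvd_iff_norm_le.1 (hdvd m c hc i)
  have hsurj : Function.Surjective f := by
    have := isPrecomplete_fin_fun (ϖ := ϖ) n
    refine surjective_of_mkQ_comp_surjective (I := Ideal.span {ϖ.val}) (M := Fin n → IntRing F)
      (N := H.tate ϖ) (f := f) fun y => ?_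
    obtain ⟨x, rfl⟩ := Submodule.mkQ_surjective _ y
    choose c hc using fun i => Ideal.Quotient.mk_surjective (b.repr (H.tateRed ϖ x) i)
    refine ⟨c, ?_⟩
    rw [LinearMap.comp_apply, Submodule.mkQ_apply, Submodule.mkQ_apply, Submodule.Quotient.eq,
      Submodule.ideal_span_singleton_smul, Submodule.mem_smul_pointwise_iff_exists]
    have h0 : H.tateRed ϖ (f c - x) = 0 := by
      rw [show H.tateRed ϖ (f c - x) = H.tateRed ϖ (f c) - H.tateRed ϖ x from rfl, hred,
        sub_eq_zero]
      simp only [hc]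
      exact b.sum_repr _
    obtain ⟨y, hy⟩ := exists_smul_eq_of_tateRed_eq_zero h0
    exact ⟨y, trivial, hy⟩
  refine ⟨(Pi.basisFun (IntRing F) (Fin n)).map (LinearEquiv.ofBijective f ⟨hinj, hsurj⟩),
    fun i => ?_⟩
  rw [Module.Basis.map_apply, Pi.basisFun_apply]
  refine (hfc _).trans ?_
  simp [Pi.single_apply]

variable [IsAlgClosed K] {n : ℕ} (hn : H.HasHeight ϖ n)
include hn

/-- Every torsion point is the reduction of an element of `T_p(H)` whose components are division
points of minimal norm. -/
lemma exists_tate_lift (z : H.torsion ϖ) : ∃ x : H.tate ϖ, H.tateRed ϖ x = z ∧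
    ∀ k : ℕ, H.gaussProd ϖ (nrm (x.1.1 (k + 1 + 1 : ℕ))) = nrm (x.1.1 (k + 1 : ℕ)) := by
  choose s hs hsφ using exists_smul_eq_gaussProd_eq hn
  -- `f` is the sequence `0, z, s z, s (s z), …`
  let f : ℕ → H.Points := fun k => Nat.casesOn k 0 fun k => s^[k] z
  have hf : ∀ k, ϖ.val • f (k + 1) = f k := fun k => by
    cases k with
    | zero => exact (Submodule.mem_torsionBy_iff _ _).1 z.2
    | succ k =>
      change ϖ.val • s^[k + 1] z = s^[k] z
      rw [Function.iterate_succ_apply', hs]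
  refine ⟨⟨⟨fun i => f i.toNat, fun i => ?_, 0, fun i hi => ?_⟩, rfl⟩, rfl, fun k => ?_⟩
  · change ϖ.val • f (i + 1).toNat = f i.toNat
    rcases le_or_gt 0 i with hi | hi
    · rw [show (i + 1).toNat = i.toNat + 1 by omega, hf]
    · rw [show (i + 1).toNat = 0 by omega, show i.toNat = 0 by omega]
      exact smul_zero _
  · change f i.toNat = 0
    rw [show i.toNat = 0 by omega]
    rfl
  · change H.gaussProd ϖ (nrm (s^[k + 1] z)) = nrm (s^[k] z)
    rw [Function.iterate_succ_apply', hsφ]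

/-- The reduction of a basis of `T_p(H)` is a basis of the torsion. -/
lemma exists_basis_eq_tateRed [ProperSpace F]
    (e : Module.Basis (Fin n) (IntRing F) (H.tate ϖ)) :
    ∃ b : Module.Basis (Fin n) ϖ.ResField (H.torsion ϖ), ∀ i, b i = H.tateRed ϖ (e i) := by
  have : Nonempty (Fin n) := ⟨⟨0, Nat.pos_of_ne_zero (ne_zero_of_hasHeight hn)⟩⟩
  have hspan : ⊤ ≤ Submodule.span ϖ.ResField (Set.range fun i => H.tateRed ϖ (e i)) := by
    rintro z -
    obtain ⟨x, rfl, -⟩ := exists_tate_lift hn z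
    rw [← e.sum_repr x, map_sum]
    refine sum_mem fun i _ => ?_
    rw [map_smul]
    exact Submodule.smul_mem _ (Ideal.Quotient.mk (Ideal.span {ϖ.val}) (e.repr x i) : ϖ.ResField)
      (Submodule.subset_span ⟨i, rfl⟩)
  refine ⟨basisOfTopLeSpanOfCardEqFinrank _ hspan ?_, fun i => ?_⟩
  · rw [finrank_torsion hn, Fintype.card_fin]
  · rw [coe_basisOfTopLeSpanOfCardEqFinrank]

end Tate

section MinimalBasis
variable {n : ℕ}

/-- A basis of `T_p(H)` whose reduction is an orthogonal basis of the torsion, ordered by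
increasing norms, and whose vectors consist of division points of minimal norm. -/
structure IsMinimalBasis (e : Module.Basis (Fin n) (IntRing F) (H.tate ϖ)) : Prop where
  mono : Monotone fun i => nrm ((e i).1.1 1)
  ortho : ∃ b : Module.Basis (Fin n) ϖ.ResField (H.torsion ϖ),
    (∀ i, b i = H.tateRed ϖ (e i)) ∧ (H.torsionSeminorm ϖ).IsOrthogonal b
  step : ∀ i (k : ℕ),
    H.gaussProd ϖ (nrm ((e i).1.1 (k + 1 + 1 : ℕ))) = nrm ((e i).1.1 (k + 1 : ℕ))

variable [IsAlgClosed K] (hn : H.HasHeight ϖ n)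
include hn

lemma exists_isMinimalBasis [ProperSpace F] [CompleteSpace F] :
    ∃ e : Module.Basis (Fin n) (IntRing F) (H.tate ϖ), IsMinimalBasis e := by
  obtain ⟨b, hmono, hb⟩ := exists_torsion_basis hn
  choose x hx hstep using fun i => exists_tate_lift hn (b i)
  obtain ⟨e, he⟩ := exists_tate_basis b hx
  refine ⟨e, fun i j hij => ?_, ⟨b, fun i => by rw [he, hx], hb⟩, fun i k => by
    rw [he]; exact hstep i k⟩
  simp only [he]
  have := hmono hij
  simp only [← hx] at this
  exact this

variable {e : Module.Basis (Fin n) (IntRing F) (H.tate ϖ)}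

omit [IsAlgClosed K] hn in
lemma IsMinimalBasis.nrm_pos (he : IsMinimalBasis e) (i : Fin n) (k : ℕ) :
    0 < nrm ((e i).1.1 (k + 1 : ℕ)) := by
  obtain ⟨b, hb, -⟩ := he.ortho
  refine Points.nrm_pos fun h => b.ne_zero i ?_
  rw [hb]
  refine Subtype.ext ?_
  have := uniformizer_pow_smul_apply (e i).1 k 1
  rw [ratTate_smul_apply, show (1 : ℤ) + k = (k + 1 : ℕ) by push_cast; ring, h, smul_zero] at this
  exact this.symm

/-- The numbers `λ_i^{(k)}` are the valuations `v(ϖ^{-k} e_i)` for a minimal basis. -/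
lemma IsMinimalBasis.slope_eq [ProperSpace F] (he : IsMinimalBasis e) (i : Fin n) (k : ℕ) :
    H.slope ϖ i (k + 1) = (ϖ.logVal (nrm ((e i).1.1 (k + 1 : ℕ))) : ℝ) := by
  obtain ⟨b, hb, hbo⟩ := he.ortho
  have hmono : Monotone fun i => nrm (b i : H.Points) := by
    simp only [hb]
    exact he.mono
  refine FormalModule.slope_eq hn hmono hbo (r := fun k => nrm ((e i).1.1 (k + 1 : ℕ))) ?_
    (he.nrm_pos i) (fun _ => nrm_lt_one _) (he.step i) k
  rw [hb]
  rfl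

omit [IsAlgClosed K] hn in
lemma tateVal_inv_pow_smul (x : H.ratTate ϖ) (k : ℕ) :
    H.tateVal ϖ (((ϖ.val : F) ^ k)⁻¹ • x) = ϖ.addVal ((x.1 k).val : K) := by
  rw [tateVal, inv_pow_smul_apply, zero_add]

omit [CompleteSpace K] [IsAlgClosed K] hn in
lemma val_ne_zero_of_nrm_pos {x : H.Points} (hx : 0 < nrm x) : (x.val : K) ≠ 0 :=
  norm_pos_iff.1 hx

lemma IsMinimalBasis.isAdapted [ProperSpace F] (he : IsMinimalBasis e) : H.IsAdapted ϖ e := by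
  intro i k hk
  obtain ⟨k, rfl⟩ := Nat.exists_eq_add_of_le' hk
  rw [he.slope_eq hn, tateVal_inv_pow_smul,
    ϖ.addVal_of_ne_zero (val_ne_zero_of_nrm_pos (he.nrm_pos i k))]
  rfl

/-- Adapted bases are minimal: their vectors have the same norms as those of a minimal basis, and
this suffices for the orthogonality of their reductions. -/
lemma IsAdapted.isMinimalBasis [ProperSpace F] [CompleteSpace F] (he : H.IsAdapted ϖ e) :
    IsMinimalBasis e := by
  obtain ⟨e', he'⟩ := exists_isMinimalBasis hn
  have hnrm : ∀ i (k : ℕ), nrm ((e i).1.1 (k + 1 : ℕ)) = nrm ((e' i).1.1 (k + 1 : ℕ)) := by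
    intro i k
    have h1 := he i (k + 1) (Nat.le_add_left 1 k)
    rw [he'.slope_eq hn, tateVal_inv_pow_smul] at h1
    have hne : (((e i).1.1 (k + 1 : ℕ)).val : K) ≠ 0 := fun h => by
      rw [Uniformizer.addVal, if_pos h] at h1
      exact EReal.coe_ne_top _ h1.symm
    rw [ϖ.addVal_of_ne_zero hne, EReal.coe_eq_coe_iff] at h1
    rw [← ϖ.rpow_logVal (he'.nrm_pos i k), ← h1, ϖ.rpow_logVal (norm_pos_iff.2 hne)]
    rfl
  have hnrm0 : ∀ i, nrm ((e i).1.1 1) = nrm ((e' i).1.1 1) := fun i => hnrm i 0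
  obtain ⟨b', hb', hbo'⟩ := he'.ortho
  obtain ⟨b, hb⟩ := exists_basis_eq_tateRed hn e
  have := ϖ.finite_resField
  refine ⟨fun i j hij => ?_, ⟨b, hb, hbo'.of_norm_eq fun i => ?_⟩, fun i k => ?_⟩
  · simp only [hnrm0]
    exact he'.mono hij
  · rw [hb, hb']
    exact hnrm0 i
  · rw [hnrm, hnrm, he'.step]

end MinimalBasis

end FormalModule

/-! ### Splitting of the filtration and adapted bases -/

namespace FormalModule
variable {F K : Type*} [NormedField F] [IsUltrametricDist F] [NormedField K] [IsUltrametricDist K]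
  [NormedAlgebra F K] [CompleteSpace K] {H : FormalModule F K} {ϖ : Uniformizer F}

open Points

lemma tateNrm_smul_of_mem {c : F} (hc : c ∈ IntRing F) (x : H.tate ϖ) :
    tateNrm (c • x.1) = 0 := by
  rw [tateNrm_eq_zero]
  have := coe_smul_ratTate ⟨c, hc⟩ x.1
  change c • x.1 = _ at this
  rw [this]
  exact (H.tate ϖ).smul_mem _ x.2

lemma tateNrm_inv_pow_mul_smul {u : IntRing F} (hu : IsUnit u) (k : ℕ) (x : H.ratTate ϖ) :
    tateNrm ((((ϖ.val : F) ^ k)⁻¹ * u) • x) = nrm (x.1 k) := by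
  rw [mul_comm, mul_smul, coe_smul_ratTate, tateNrm_unit_smul hu, tateNrm_inv_pow_smul]

section Splitting
variable {n : ℕ} [IsAlgClosed K] (hn : H.HasHeight ϖ n)
  {e : Module.Basis (Fin n) (IntRing F) (H.tate ϖ)}
include hn

/-- A minimal basis is orthogonal in the rational Tate module. The proof is by induction on the
common denominator of the coordinates of `x`. If `ϖ c_j` is not integral, then the induction
hypothesis for `ϖ x` gives `gaussProd ‖c_j e_j‖ = ‖ϖ c_j e_j‖ ≤ ‖ϖ x‖ ≤ gaussProd ‖x‖`, as the
division points are minimal. The sum of the remaining terms, for which `ϖ c_j` is integral, has a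
torsion point as its component of index `0`, and the orthogonality of the reductions applies. -/
lemma IsMinimalBasis.tateNrm_smul_le (he : IsMinimalBasis e) (c : Fin n → F) (i : Fin n) :
    tateNrm (c i • (e i).1) ≤ tateNrm (∑ j, c j • (e j).1) := by
  classical
  have hden : ∃ k : ℕ, ∀ j, (ϖ.val : F) ^ k * c j ∈ IntRing F := by
    choose k hk using fun j => ϖ.exists_pow_mul (c j)
    refine ⟨∑ j, k j, fun j => ?_⟩
    rw [← Finset.add_sum_erase _ _ (Finset.mem_univ j), add_comm, pow_add, mul_assoc]
    exact mul_mem (pow_mem ϖ.val.2 _) (hk j)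
  obtain ⟨k, hk⟩ := hden
  induction k generalizing c i with
  | zero =>
    rw [tateNrm_smul_of_mem (by simpa using hk i)]
    exact tateNrm_nonneg _
  | succ k ih =>
    set x := ∑ j, c j • (e j).1 with hx
    have hlarge : ∀ j, (ϖ.val : F) * c j ∉ IntRing F → tateNrm (c j • (e j).1) ≤ tateNrm x := by
      intro j hj
      have h1 := ih (fun j => ϖ.val * c j) j fun j => by
        rw [← mul_assoc, ← pow_succ]
        exact hk j
      have h2 : ∑ j, ((ϖ.val : F) * c j) • (e j).1 = ϖ.val • x := by
        rw [hx, ← coe_smul_ratTate, Finset.smul_sum]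
        simp only [mul_smul]
      rw [h2] at h1
      obtain ⟨l, u, hu, hl⟩ := ϖ.exists_eq_inv_pow_mul hj
      have hc : c j = ((ϖ.val : F) ^ (l + 1 + 1))⁻¹ * u := by
        rw [pow_succ', mul_inv, mul_assoc, ← hl, inv_mul_cancel_left₀ ϖ.ne_zero]
      refine le_of_gaussProd_le hn (tateNrm_nonneg x) ?_
      rw [hl, tateNrm_inv_pow_mul_smul hu, ← he.step] at h1
      rw [hc, tateNrm_inv_pow_mul_smul hu]
      exact h1.trans (nrm_uniformizer_smul_le hn _)
    by_cases hi : (ϖ.val : F) * c i ∈ IntRing F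
    swap
    · exact hlarge i hi
    by_cases hi' : c i ∈ IntRing F
    · rw [tateNrm_smul_of_mem hi']
      exact tateNrm_nonneg _
    obtain ⟨b, hb, hbo⟩ := he.ortho
    -- the part of `x` with small denominators, and its coordinates in the torsion
    set a : Fin n → IntRing F := fun j =>
      if hj : (ϖ.val : F) * c j ∈ IntRing F then ⟨_, hj⟩ else 0 with ha
    set z := ∑ j, (if (ϖ.val : F) * c j ∈ IntRing F then c j • (e j).1 else 0) with hz
    have hzx : tateNrm z ≤ tateNrm x := by
      have h1 : z = x - ∑ j, (if (ϖ.val : F) * c j ∈ IntRing F then 0 else c j • (e j).1) := by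
        rw [eq_sub_iff_add_eq, hz, hx, ← Finset.sum_add_distrib]
        refine Finset.sum_congr rfl fun j _ => ?_
        split_ifs <;> simp
      rw [h1]
      refine (tateNrm_sub_le _ _).trans (max_le le_rfl ?_)
      refine tateNrm_sum_le _ _ (tateNrm_nonneg _) fun j _ => ?_
      split_ifs with hj
      · rw [tateNrm_eq_zero.2 (zero_mem _)]
        exact tateNrm_nonneg _
      · exact hlarge j hj
    have haj : ∀ j, (if (ϖ.val : F) * c j ∈ IntRing F then c j • (e j).1 else 0) =
        ((ϖ.val : F) ^ 1)⁻¹ • a j • (e j).1 := fun j => by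
      rw [ha]
      dsimp only
      split_ifs with hj
      · rw [← coe_smul_ratTate, smul_smul, pow_one, inv_mul_cancel_left₀ ϖ.ne_zero]
      · rw [← coe_smul_ratTate]
        simp
    have hz0 : z = ((ϖ.val : F) ^ 1)⁻¹ • (∑ j, a j • e j : H.tate ϖ).1 := by
      rw [hz, Finset.sum_congr rfl fun j _ => haj j, ← Finset.smul_sum]
      congr 1
      exact (AddSubmonoidClass.coe_finsetSum (fun j => a j • e j) Finset.univ).symm
    have hzn : tateNrm z = (H.torsionSeminorm ϖ).toFun
        (∑ j, (Ideal.Quotient.mk (Ideal.span {ϖ.val}) (a j) : ϖ.ResField) • b j) := by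
      have h1 : H.tateRed ϖ (∑ j, a j • e j) =
          ∑ j, (Ideal.Quotient.mk (Ideal.span {ϖ.val}) (a j) : ϖ.ResField) • b j := by
        rw [map_sum]
        refine Finset.sum_congr rfl fun j _ => ?_
        rw [map_smul, hb]
        rfl
      rw [← h1, hz0, tateNrm_inv_pow_smul]
      rfl
    have hai : (Ideal.Quotient.mk (Ideal.span {ϖ.val}) (a i) : ϖ.ResField) ≠ 0 := fun h => by
      obtain ⟨d, hd⟩ := Ideal.mem_span_singleton.1 (Ideal.Quotient.eq_zero_iff_mem.1 h)
      have h1 : (ϖ.val : F) * c i = ϖ.val * d := by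
        have : (a i : F) = ϖ.val * c i := by simp only [ha, dif_pos hi]
        rw [← this, hd]
        rfl
      exact hi' (by rw [mul_left_cancel₀ ϖ.ne_zero h1]; exact d.2)
    have h1 := hbo (fun j => Ideal.Quotient.mk (Ideal.span {ϖ.val}) (a j)) i hai
    rw [← hzn] at h1
    refine le_trans ?_ (h1.trans hzx)
    have h2 := haj i
    rw [if_pos hi] at h2
    rw [h2, smul_comm, hb]
    refine (FormalModule.tateNrm_smul_le _ _).trans (le_of_eq ?_)
    rw [tateNrm_inv_pow_smul]
    rfl

end Splitting

end FormalModule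

namespace Uniformizer
variable {F : Type*} [NormedField F] [IsUltrametricDist F] (ϖ : Uniformizer F)

/-- The extended additive valuation of an element of absolute value `r ≥ 0`. -/
def radVal (r : ℝ) : EReal := if r = 0 then ⊤ else (ϖ.logVal r : ℝ)

lemma radVal_zero : ϖ.radVal 0 = ⊤ := if_pos rfl

lemma addVal_eq_radVal {K : Type*} [NormedField K] (x : K) : ϖ.addVal x = ϖ.radVal ‖x‖ := by
  by_cases hx : x = 0
  · rw [addVal, if_pos hx, hx, norm_zero, radVal_zero]
  · rw [ϖ.addVal_of_ne_zero hx, radVal, if_neg (norm_ne_zero_iff.2 hx)]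

lemma radVal_le_radVal_iff {r s : ℝ} (hr : 0 ≤ r) (hs : 0 ≤ s) :
    ϖ.radVal r ≤ ϖ.radVal s ↔ s ≤ r := by
  unfold radVal
  split_ifs with h1 h2 h2
  · rw [h1, h2]
    simp
  · rw [h1, top_le_iff]
    exact iff_of_false (EReal.coe_ne_top _) (not_le.2 (hs.lt_of_ne' h2))
  · rw [h2]
    exact iff_of_true le_top hr
  · rw [EReal.coe_le_coe_iff, ϖ.le_logVal_iff (hs.lt_of_ne' h2), ϖ.rpow_logVal (hr.lt_of_ne' h1)]

lemma radVal_pos {r : ℝ} (hr : 0 ≤ r) (hr1 : r < 1) : 0 < ϖ.radVal r := by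
  unfold radVal
  split_ifs with h
  · exact EReal.zero_lt_top
  · exact EReal.coe_pos.2 (ϖ.logVal_pos (hr.lt_of_ne' h) hr1)

lemma exists_radVal_eq {μ : EReal} (hμ : 0 < μ) : ∃ r : ℝ, 0 ≤ r ∧ r < 1 ∧ ϖ.radVal r = μ := by
  induction μ with
  | bot => exact absurd hμ (by simp)
  | top => exact ⟨0, le_rfl, one_pos, ϖ.radVal_zero⟩
  | coe t =>
    have ht : 0 < t := EReal.coe_pos.1 hμ
    have hpos := Real.rpow_pos_of_pos ϖ.norm_pos t
    refine ⟨‖(ϖ.val : F)‖ ^ t, hpos.le, Real.rpow_lt_one ϖ.norm_pos.le ϖ.norm_lt_one ht, ?_⟩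
    rw [radVal, if_neg hpos.ne', ϖ.logVal_rpow]

end Uniformizer

namespace FormalModule
variable {F K : Type*} [NormedField F] [IsUltrametricDist F] [NormedField K] [IsUltrametricDist K]
  [NormedAlgebra F K] [CompleteSpace K] {H : FormalModule F K} {ϖ : Uniformizer F}

open Points

lemma mem_fil_radVal {r : ℝ} (hr : 0 ≤ r) {x : H.ratTate ϖ} :
    x ∈ H.fil ϖ (ϖ.radVal r) ↔ tateNrm x ≤ r := by
  change ϖ.radVal r ≤ ϖ.addVal _ ↔ _
  rw [ϖ.addVal_eq_radVal, ϖ.radVal_le_radVal_iff hr (norm_nonneg _)]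
  rfl

lemma fil_top : H.fil ϖ ⊤ = H.tate ϖ := by
  ext x
  rw [← ϖ.radVal_zero, mem_fil_radVal le_rfl, ← tateNrm_eq_zero]
  exact ⟨fun h => le_antisymm h (tateNrm_nonneg x), fun h => h.le⟩

section Index
variable {n : ℕ} [IsAlgClosed K] [ProperSpace F] (hn : H.HasHeight ϖ n)
  {e : Module.Basis (Fin n) (IntRing F) (H.tate ϖ)} (he : IsMinimalBasis e)
include hn he

lemma IsMinimalBasis.slope_eq_radVal (i : Fin n) (k : ℕ) :
    H.slope ϖ i k = ϖ.radVal (nrm ((e i).1.1 k)) := by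
  cases k with
  | zero =>
    rw [slope, Nat.cast_zero, show (e i).1.1 0 = 0 from (e i).2, nrm_zero, ϖ.radVal_zero]
  | succ k => rw [he.slope_eq hn, Uniformizer.radVal, if_neg (he.nrm_pos i k).ne']

omit [ProperSpace F] in
/-- The norms of the division points of `e i` come arbitrarily close to `1`, as `[ϖ]` is contracting
by a factor `< 1` on every disc of radius `< 1`. -/
lemma IsMinimalBasis.exists_lt_nrm (i : Fin n) {r : ℝ} (hr : r < 1) :
    ∃ k : ℕ, r < nrm ((e i).1.1 (k + 1 : ℕ)) := by
  by_contra! hle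
  obtain ⟨b, -⟩ := he.ortho
  set M := max (nrm (b i : H.Points)) r with hM
  have hM1 : M < 1 := max_lt (nrm_lt_one _) hr
  have hM0 : 0 ≤ M := le_max_of_le_left (nrm_nonneg _)
  have hbound : ∀ k : ℕ, nrm ((e i).1.1 (0 + 1 : ℕ)) ≤ M ^ k * nrm ((e i).1.1 (k + 1 : ℕ)) := by
    intro k
    induction k with
    | zero => simp
    | succ k ih =>
      refine ih.trans ?_
      rw [← he.step, pow_succ, mul_assoc]
      refine mul_le_mul_of_nonneg_left ?_ (pow_nonneg hM0 k)
      refine (gaussProd_le_mul hn (nrm_nonneg _) (nrm_lt_one _).le (b.ne_zero i)).trans ?_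
      rw [mul_comm]
      exact mul_le_mul_of_nonneg_right (max_le_max le_rfl (hle _)) (nrm_nonneg _)
  refine absurd (he.nrm_pos i 0) (not_lt.2 ?_)
  refine ge_of_tendsto' (tendsto_pow_atTop_nhds_zero_of_lt_one hM0 hM1) fun k => ?_
  exact (hbound k).trans (mul_le_of_le_one_right (pow_nonneg hM0 k) (nrm_lt_one _).le)

omit he [IsAlgClosed K] [ProperSpace F] hn in
lemma nrm_apply_le_nrm_apply (x : H.ratTate ϖ) {k l : ℕ} (hkl : k ≤ l) :
    nrm (x.1 k) ≤ nrm (x.1 l) := by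
  obtain ⟨m, rfl⟩ := Nat.exists_eq_add_of_le hkl
  have := uniformizer_pow_smul_apply x m k
  rw [← this, Nat.cast_add, ratTate_smul_apply]
  exact nrm_smul_le _ _

/-- The supremum in `slopeIndex` is that of a bounded nonempty set, and it is attained. -/
lemma IsMinimalBasis.le_slope_iff (i : Fin n) {μ : EReal} (hμ : 0 < μ) (k : ℕ) :
    μ ≤ H.slope ϖ i k ↔ k ≤ H.slopeIndex ϖ i μ := by
  obtain ⟨r, hr, hr1, rfl⟩ := ϖ.exists_radVal_eq hμ
  have hiff : ∀ k, ϖ.radVal r ≤ H.slope ϖ i k ↔ nrm ((e i).1.1 k) ≤ r := fun k => by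
    rw [he.slope_eq_radVal hn, ϖ.radVal_le_radVal_iff hr (nrm_nonneg _)]
  have hbdd : BddAbove {k : ℕ | ϖ.radVal r ≤ H.slope ϖ i k} := by
    obtain ⟨m, hm⟩ := he.exists_lt_nrm hn i hr1
    refine ⟨m, fun k hk => ?_⟩
    by_contra! hlt
    exact absurd ((nrm_apply_le_nrm_apply (e i).1 hlt).trans ((hiff k).1 hk)) (not_le.2 hm)
  have hne : {k : ℕ | ϖ.radVal r ≤ H.slope ϖ i k}.Nonempty := ⟨0, (le_top : ϖ.radVal r ≤ ⊤)⟩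
  refine ⟨fun h => le_csSup hbdd h, fun h => (hiff k).2 ?_⟩
  exact (nrm_apply_le_nrm_apply (e i).1 h).trans ((hiff _).1 (Nat.sSup_mem hne hbdd))

lemma IsMinimalBasis.nrm_le_iff (i : Fin n) {r : ℝ} (hr : 0 ≤ r) (hr1 : r < 1) (k : ℕ) :
    nrm ((e i).1.1 k) ≤ r ↔ k ≤ H.slopeIndex ϖ i (ϖ.radVal r) := by
  rw [← he.le_slope_iff hn i (ϖ.radVal_pos hr hr1), he.slope_eq_radVal hn,
    ϖ.radVal_le_radVal_iff hr (nrm_nonneg _)]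

lemma IsMinimalBasis.slopeIndex_antitone {μ : EReal} (hμ : 0 < μ) :
    Antitone fun i : Fin n => H.slopeIndex ϖ i μ := by
  obtain ⟨r, hr, hr1, rfl⟩ := ϖ.exists_radVal_eq hμ
  intro i j hij
  have hmono : ∀ k : ℕ, nrm ((e i).1.1 (k + 1 : ℕ)) ≤ nrm ((e j).1.1 (k + 1 : ℕ)) := by
    intro k
    induction k with
    | zero => exact he.mono hij
    | succ k ih =>
      refine le_of_gaussProd_le hn (nrm_nonneg _) ?_
      rwa [he.step, he.step]
  change H.slopeIndex ϖ j _ ≤ H.slopeIndex ϖ i _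
  rw [← he.nrm_le_iff hn i hr hr1]
  have h := (he.nrm_le_iff hn j hr hr1 _).2 le_rfl
  rcases Nat.eq_zero_or_eq_succ_pred (H.slopeIndex ϖ j (ϖ.radVal r)) with h0 | h0
  · rw [h0, Nat.cast_zero, show (e i).1.1 0 = 0 from (e i).2, nrm_zero]
    exact hr
  · rw [h0] at h ⊢
    exact (hmono _).trans h

omit he hn [IsAlgClosed K] [ProperSpace F] in
lemma span_tate_eq_top : Submodule.span F (H.tate ϖ : Set (H.ratTate ϖ)) = ⊤ := by
  rw [eq_top_iff]
  rintro x -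
  obtain ⟨N, hN⟩ := x.2.2
  have hmem : ϖ.val ^ N.natAbs • x ∈ H.tate ϖ := by
    change (ϖ.val ^ N.natAbs • x).1 0 = 0
    have := uniformizer_pow_smul_apply x N.natAbs (-N.natAbs)
    rw [neg_add_cancel] at this
    rw [this]
    exact hN _ (by omega)
  have h2 := Submodule.smul_mem _ ((ϖ.val : F) ^ N.natAbs)⁻¹
    (Submodule.subset_span (R := F) hmem)
  rw [← coe_smul_ratTate] at h2
  push_cast at h2
  rwa [inv_smul_smul₀ (pow_ne_zero _ ϖ.ne_zero)] at h2

omit he hn [IsAlgClosed K] [ProperSpace F] in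
lemma isLattice_tate (e : Module.Basis (Fin n) (IntRing F) (H.tate ϖ)) :
    Submodule.IsLattice F (H.tate ϖ) where
  fg := (Submodule.fg_top _).1 (e.span_eq ▸ Submodule.fg_span (Set.finite_range e))
  span_eq_top := span_tate_eq_top

/-- A minimal basis splits all steps of the filtration. -/
lemma IsMinimalBasis.fil_eq_span {μ : EReal} (hμ : 0 < μ) :
    H.fil ϖ μ = Submodule.span (IntRing F) (Set.range fun i : Fin n =>
      ((ϖ.val : F) ^ H.slopeIndex ϖ i μ)⁻¹ • (e i : H.ratTate ϖ)) := by
  obtain ⟨r, hr, hr1, rfl⟩ := ϖ.exists_radVal_eq hμ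
  have := isLattice_tate e
  apply le_antisymm
  · intro x hx
    rw [mem_fil_radVal hr] at hx
    obtain ⟨c, rfl⟩ : ∃ c : Fin n → F, ∑ i, c i • (e i).1 = x := by
      refine ⟨(e.extendOfIsLattice F).repr x, ?_⟩
      conv_rhs => rw [← (e.extendOfIsLattice F).sum_repr x]
      simp only [Module.Basis.extendOfIsLattice_apply]
    refine sum_mem fun i _ => ?_
    have hi := (he.tateNrm_smul_le hn c i).trans hx
    set k := H.slopeIndex ϖ i (ϖ.radVal r) with hk
    have hmem : (ϖ.val : F) ^ k * c i ∈ IntRing F := by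
      by_cases hc : c i ∈ IntRing F
      · exact mul_mem (pow_mem ϖ.val.2 _) hc
      · obtain ⟨l, u, hu, hl⟩ := ϖ.exists_eq_inv_pow_mul hc
        rw [hl, tateNrm_inv_pow_mul_smul hu, he.nrm_le_iff hn i hr hr1, ← hk] at hi
        obtain ⟨m, hm⟩ := Nat.exists_eq_add_of_le hi
        rw [hl, hm, pow_add, mul_comm (_ ^ (l + 1)), mul_assoc,
          mul_inv_cancel_left₀ (pow_ne_zero _ ϖ.ne_zero)]
        exact mul_mem (pow_mem ϖ.val.2 _) u.2
    have heq : c i • (e i).1 =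
        (⟨_, hmem⟩ : IntRing F) • ((ϖ.val : F) ^ k)⁻¹ • (e i : H.ratTate ϖ) := by
      rw [← coe_smul_ratTate, smul_smul, mul_right_comm,
        mul_inv_cancel₀ (pow_ne_zero _ ϖ.ne_zero), one_mul]
    rw [heq]
    exact Submodule.smul_mem _ _ (Submodule.subset_span ⟨i, rfl⟩)
  · rw [Submodule.span_le]
    rintro _ ⟨i, rfl⟩
    rw [SetLike.mem_coe, mem_fil_radVal hr, tateNrm_inv_pow_smul, he.nrm_le_iff hn i hr hr1]

end Index

end FormalModule

/-! ### The vertices of the filtration in the building -/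

namespace FormalModule
variable {F K : Type*} [NormedField F] [IsUltrametricDist F] [NormedField K] [IsUltrametricDist K]
  [NormedAlgebra F K] [CompleteSpace K] {H : FormalModule F K} {ϖ : Uniformizer F}

open Points

lemma uniformizer_smul_fil_eq_units_smul (Λ : Submodule (IntRing F) (H.ratTate ϖ)) :
    ϖ.val • Λ = Units.mk0 (ϖ.val : F) ϖ.ne_zero • Λ := by
  ext x
  simp only [Submodule.mem_smul_pointwise_iff_exists, Units.smul_def, Units.val_mk0,
    coe_smul_ratTate]

section Vertices
variable {n : ℕ} [IsAlgClosed K] (hn : H.HasHeight ϖ n)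
include hn

lemma nrm_uniformizer_smul_eq {w : H.Points} (hw : ∀ z : H.torsion ϖ, nrm (z : H.Points) < nrm w) :
    nrm (ϖ.val • w) = H.gaussProd ϖ (nrm w) := by
  rw [nrm_uniformizer_smul hn, gaussProd]
  refine finprod_congr fun z => ?_
  rw [max_eq_right (hw z).le, sub_eq_add_neg, add_comm]
  exact nrm_add_eq_of_lt (by rw [nrm_neg]; exact hw z)

lemma uniformizer_smul_fil_le {r : ℝ} (hr : 0 ≤ r) :
    ϖ.val • H.fil ϖ (ϖ.radVal r) ≤ H.fil ϖ (ϖ.radVal (H.gaussProd ϖ r)) := by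
  intro x hx
  obtain ⟨y, hy, rfl⟩ := (Submodule.mem_smul_pointwise_iff_exists _ _ _).1 hx
  rw [mem_fil_radVal (gaussProd_nonneg hr)]
  rw [mem_fil_radVal hr] at hy
  exact (nrm_uniformizer_smul_le hn (y.1 0)).trans (gaussProd_mono hn (nrm_nonneg _) hy)

/-- Outside the disc that contains the torsion, `ϖ` maps each step of the filtration onto
another. -/
lemma fil_gaussProd_eq_smul {r : ℝ} (hr : 0 ≤ r)
    (hz : ∀ z : H.torsion ϖ, nrm (z : H.Points) ≤ r) :
    H.fil ϖ (ϖ.radVal (H.gaussProd ϖ r)) = ϖ.val • H.fil ϖ (ϖ.radVal r) := by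
  refine le_antisymm (fun x hx => ?_) (uniformizer_smul_fil_le hn hr)
  rw [mem_fil_radVal (gaussProd_nonneg hr)] at hx
  refine (Submodule.mem_smul_pointwise_iff_exists _ _ _).2 ⟨((ϖ.val : F) ^ 1)⁻¹ • x, ?_, ?_⟩
  · rw [mem_fil_radVal hr]
    by_contra! hlt
    have h1 := nrm_uniformizer_smul_eq hn (w := (((ϖ.val : F) ^ 1)⁻¹ • x).1 0)
      fun z => (hz z).trans_lt hlt
    have h2 : ϖ.val • (((ϖ.val : F) ^ 1)⁻¹ • x).1 0 = x.1 0 := by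
      rw [inv_pow_smul_apply]
      exact x.2.1 0
    rw [h2] at h1
    have h3 : tateNrm x = H.gaussProd ϖ (tateNrm (((ϖ.val : F) ^ 1)⁻¹ • x)) := h1
    exact absurd hx (not_le.2 (by rw [h3]; exact gaussProd_lt hn hr hlt))
  · rw [← coe_smul_ratTate, pow_one, smul_inv_smul₀ ϖ.ne_zero]

lemma exists_max_torsion [ProperSpace F] : ∃ z₀ : H.torsion ϖ, z₀ ≠ 0 ∧
    ∀ z : H.torsion ϖ, nrm (z : H.Points) ≤ nrm (z₀ : H.Points) := by
  have := finite_torsion hn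
  obtain ⟨b, -⟩ := exists_torsion_basis hn
  obtain ⟨z₀, hz₀⟩ := Finite.exists_max fun z : H.torsion ϖ => nrm (z : H.Points)
  refine ⟨z₀, fun h => ?_, hz₀⟩
  have h1 := hz₀ (b ⟨0, Nat.pos_of_ne_zero (ne_zero_of_hasHeight hn)⟩)
  rw [h, Submodule.coe_zero, nrm_zero] at h1
  exact absurd (nrm_basis_pos _) (not_lt.2 h1)

lemma gaussProd_lt_one [ProperSpace F] {r : ℝ} (hr : 0 ≤ r) (hr1 : r < 1) :
    H.gaussProd ϖ r < 1 := by
  obtain ⟨z₀, hz₀, -⟩ := exists_max_torsion hn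
  refine ((gaussProd_le_mul hn hr hr1.le hz₀).trans ?_).trans_lt hr1
  exact mul_le_of_le_one_right hr (max_le (nrm_lt_one _).le hr1.le)

/-- Since the iterates of the Gauss norm tend to `0` on `[0, 1[`, a property of radii may be proved
by descent along it. -/
lemma gaussProd_descent [ProperSpace F] {P : ℝ → Prop} {ε : ℝ} (hε : 0 < ε)
    (hbase : ∀ r, 0 ≤ r → r < ε → P r)
    (hstep : ∀ r, ε ≤ r → r < 1 → P (H.gaussProd ϖ r) → P r) {r : ℝ} (hr : 0 ≤ r) (hr1 : r < 1) :
    P r := by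
  obtain ⟨z₀, hz₀, -⟩ := exists_max_torsion hn
  set M := max (nrm (z₀ : H.Points)) r with hM
  have hM1 : M < 1 := max_lt (nrm_lt_one _) hr1
  have hM0 : 0 ≤ M := le_max_of_le_right hr
  have key : ∀ (m : ℕ) (s : ℝ), 0 ≤ s → s ≤ M → M ^ m * s < ε → P s := by
    intro m
    induction m with
    | zero => exact fun s hs _ h => hbase s hs (by simpa using h)
    | succ m ih =>
      intro s hs hsM h
      rcases lt_or_ge s ε with hlt | hge
      · exact hbase s hs hlt
      have h1 : H.gaussProd ϖ s ≤ M * s := by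
        refine (gaussProd_le_mul hn hs (hsM.trans hM1.le) hz₀).trans ?_
        rw [mul_comm]
        exact mul_le_mul_of_nonneg_right (max_le (le_max_left _ _) hsM) hs
      refine hstep s hge (hsM.trans_lt hM1) (ih _ (gaussProd_nonneg hs) ?_ ?_)
      · exact h1.trans ((mul_le_of_le_one_left hs hM1.le).trans hsM)
      · refine lt_of_le_of_lt ?_ h
        rw [pow_succ, mul_assoc]
        exact mul_le_mul_of_nonneg_left h1 (pow_nonneg hM0 m)
  obtain ⟨m, hm⟩ := exists_pow_lt_of_lt_one hε hM1
  refine key m r hr (le_max_right _ _) (lt_of_le_of_lt ?_ hm)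
  exact mul_le_of_le_one_right (pow_nonneg hM0 m) hr1.le

end Vertices

section Diagonal
variable {n : ℕ} [IsAlgClosed K] [ProperSpace F] (hn : H.HasHeight ϖ n)
  {e : Module.Basis (Fin n) (IntRing F) (H.tate ϖ)} (he : IsMinimalBasis e)

/-- The basis of `V_p(H)` defined by a basis of `T_p(H)`. -/
def ratTateBasis (e : Module.Basis (Fin n) (IntRing F) (H.tate ϖ)) :
    Module.Basis (Fin n) F (H.ratTate ϖ) :=
  have := isLattice_tate e
  e.extendOfIsLattice F

omit [IsAlgClosed K] [ProperSpace F] in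
lemma ratTateBasis_apply (i : Fin n) : ratTateBasis e i = (e i).1 :=
  have := isLattice_tate e
  e.extendOfIsLattice_apply F i

include hn he

lemma IsMinimalBasis.fil_eq_diagLattice {μ : EReal} (hμ : 0 < μ) :
    H.fil ϖ μ =
      (diagLattice ϖ (ratTateBasis e) fun i : Fin n => -(H.slopeIndex ϖ i μ : ℤ)).1 := by
  rw [he.fil_eq_span hn hμ, diagLattice]
  simp only [ratTateBasis_apply, zpow_neg, zpow_natCast]

lemma IsMinimalBasis.isLattice_fil {μ : EReal} (hμ : 0 < μ) : Submodule.IsLattice F (H.fil ϖ μ) := by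
  rw [he.fil_eq_diagLattice hn hμ]
  exact (diagLattice ϖ _ _).2

lemma IsMinimalBasis.mk_fil_eq {μ : EReal} (hμ : 0 < μ) (h : Submodule.IsLattice F (H.fil ϖ μ)) :
    Vertex.mk ⟨H.fil ϖ μ, h⟩ =
      Vertex.mk (diagLattice ϖ (ratTateBasis e) fun i : Fin n => -(H.slopeIndex ϖ i μ : ℤ)) :=
  congrArg Vertex.mk (Subtype.ext (he.fil_eq_diagLattice hn hμ))

/-- Below the norms of the nonzero torsion points the filtration is constant. -/
lemma IsMinimalBasis.slopeIndex_eq_zero {r : ℝ} (hr : 0 ≤ r)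
    (hlt : ∀ i, r < nrm ((e i).1.1 1)) (i : Fin n) : H.slopeIndex ϖ i (ϖ.radVal r) = 0 := by
  by_contra h0
  have h1 := (he.nrm_le_iff hn i hr ((hlt i).trans (nrm_lt_one _)) 1).2 (Nat.one_le_iff_ne_zero.2 h0)
  rw [Nat.cast_one] at h1
  exact absurd h1 (not_le.2 (hlt i))

lemma IsMinimalBasis.slopeIndex_top (i : Fin n) : H.slopeIndex ϖ i ⊤ = 0 := by
  rw [← ϖ.radVal_zero]
  exact he.slopeIndex_eq_zero hn le_rfl (fun i => he.nrm_pos i 0) i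

lemma IsMinimalBasis.isSector :
    ∃ (hT : Submodule.IsLattice F (H.tate ϖ)) (Q : Set (Vertex F (H.ratTate ϖ))),
      IsSector ϖ (ratTateBasis e) (Vertex.mk ⟨H.tate ϖ, hT⟩) Q ∧ H.filVertices ϖ ⊆ Q := by
  -- the order is reversed because the exponents `-k(i, μ)` increase with `i`
  refine ⟨isLattice_tate e, _, ⟨0, Fin.revPerm, ?_, rfl⟩, ?_⟩
  · refine congrArg Vertex.mk (Subtype.ext ?_)
    change H.tate ϖ = _
    rw [← fil_top, he.fil_eq_diagLattice hn EReal.zero_lt_top]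
    simp only [he.slopeIndex_top hn, Nat.cast_zero, neg_zero]
    rfl
  · rintro _ ⟨μ, hμ, h, rfl⟩
    refine ⟨fun i => -(H.slopeIndex ϖ i μ : ℤ), fun i j hij => ?_, ?_⟩
    · have h1 := he.slopeIndex_antitone hn hμ (Fin.rev_le_rev.2 hij)
      simpa using h1
    · rw [zero_add]
      exact he.mk_fil_eq hn hμ h

lemma IsMinimalBasis.filVertices_subset_apartment :
    H.filVertices ϖ ⊆ apartment ϖ (ratTateBasis e) := by
  rintro _ ⟨μ, hμ, h, rfl⟩
  exact ⟨_, (he.mk_fil_eq hn hμ h).symm⟩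

/-- Up to homothety, only the steps of the filtration for radii below the largest norm of a torsion
point matter, and their exponents are bounded. -/
lemma IsMinimalBasis.filVertices_finite : (H.filVertices ϖ).Finite := by
  obtain ⟨z₀, hz₀, hmax⟩ := exists_max_torsion hn
  have hpos : 0 < nrm (z₀ : H.Points) := Points.nrm_pos fun h => hz₀ (Subtype.ext h)
  have hrep : ∀ r : ℝ, 0 ≤ r → r < 1 → ∀ h : Submodule.IsLattice F (H.fil ϖ (ϖ.radVal r)),
      ∃ s, ∃ h' : Submodule.IsLattice F (H.fil ϖ (ϖ.radVal s)), 0 ≤ s ∧ s < nrm (z₀ : H.Points) ∧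
        Vertex.mk ⟨_, h⟩ = Vertex.mk ⟨_, h'⟩ := by
    intro r hr hr1
    refine gaussProd_descent hn (P := fun r =>
      ∀ h : Submodule.IsLattice F (H.fil ϖ (ϖ.radVal r)), ∃ s,
        ∃ h' : Submodule.IsLattice F (H.fil ϖ (ϖ.radVal s)), 0 ≤ s ∧ s < nrm (z₀ : H.Points) ∧
        Vertex.mk ⟨_, h⟩ = Vertex.mk ⟨_, h'⟩) hpos ?_ ?_ hr hr1
    · exact fun s hs hlt h => ⟨s, h, hs, hlt, rfl⟩
    · intro s hge hs1 ih h
      have hs := hpos.le.trans hge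
      have hL := he.isLattice_fil hn
        (ϖ.radVal_pos (gaussProd_nonneg (H := H) (ϖ := ϖ) hs) (gaussProd_lt_one hn hs hs1))
      obtain ⟨t, h', ht, htlt, heq⟩ := ih hL
      refine ⟨t, h', ht, htlt, Eq.trans
        (Quotient.sound ⟨Units.mk0 (ϖ.val : F) ϖ.ne_zero, ?_⟩) heq⟩
      change H.fil ϖ _ = _
      rw [fil_gaussProd_eq_smul hn hs fun z => (hmax z).trans hge,
        uniformizer_smul_fil_eq_units_smul]
  set c := ϖ.radVal (nrm (z₀ : H.Points)) with hc
  refine ((Set.finite_Iic fun i : Fin n => H.slopeIndex ϖ i c).image fun k : Fin n → ℕ =>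
    Vertex.mk (diagLattice ϖ (ratTateBasis e) fun i => -(k i : ℤ))).subset ?_
  rintro _ ⟨μ, hμ, h, rfl⟩
  obtain ⟨r, hr, hr1, rfl⟩ := ϖ.exists_radVal_eq hμ
  obtain ⟨s, h', hs, hslt, heq⟩ := hrep r hr hr1 h
  have hs1 := hslt.trans (nrm_lt_one _)
  refine ⟨fun i => H.slopeIndex ϖ i (ϖ.radVal s), fun i => ?_, ?_⟩
  · rw [hc, ← he.nrm_le_iff hn i hpos.le (nrm_lt_one _)]
    exact ((he.nrm_le_iff hn i hs hs1 _).2 le_rfl).trans hslt.le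
  · rw [heq]
    exact (he.mk_fil_eq hn (ϖ.radVal_pos hs hs1) h').symm

/-- The vertices of radii `r` and `gaussProd r` are equal or neighbours, as multiplication by `ϖ`
maps the former step of the filtration into the latter. -/
lemma IsMinimalBasis.filVertices_connected :
    ((skeleton (H.ratTate ϖ) ϖ).induce (H.filVertices ϖ)).Connected := by
  have hL : ∀ r : ℝ, 0 ≤ r → r < 1 → Submodule.IsLattice F (H.fil ϖ (ϖ.radVal r)) :=
    fun r hr hr1 => he.isLattice_fil hn (ϖ.radVal_pos hr hr1)
  have hmem : ∀ (r : ℝ) (hr : 0 ≤ r) (hr1 : r < 1),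
      Vertex.mk ⟨_, hL r hr hr1⟩ ∈ H.filVertices ϖ := fun r hr hr1 =>
    ⟨_, ϖ.radVal_pos hr hr1, hL r hr hr1, rfl⟩
  rw [SimpleGraph.connected_iff_exists_forall_reachable]
  refine ⟨⟨_, hmem 0 le_rfl one_pos⟩, ?_⟩
  rintro ⟨_, μ, hμ, h, rfl⟩
  obtain ⟨r, hr, hr1, rfl⟩ := ϖ.exists_radVal_eq hμ
  -- the torsion points `≠ 0` of smallest norm have the norm of the component of index `1` of `e i₀`
  set i₀ : Fin n := ⟨0, Nat.pos_of_ne_zero (ne_zero_of_hasHeight hn)⟩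
  refine gaussProd_descent hn (P := fun r => ∀ (hr : 0 ≤ r) (hr1 : r < 1),
    ((skeleton (H.ratTate ϖ) ϖ).induce (H.filVertices ϖ)).Reachable ⟨_, hmem 0 le_rfl one_pos⟩
      ⟨_, hmem r hr hr1⟩) (he.nrm_pos i₀ 0) ?_ ?_ hr hr1 hr hr1
  · intro s hs hlt _ hs1
    have hlt' : ∀ i, s < nrm ((e i).1.1 1) := fun i =>
      lt_of_lt_of_le hlt (he.mono (Nat.zero_le i : i₀ ≤ i))
    have heq : H.fil ϖ (ϖ.radVal 0) = H.fil ϖ (ϖ.radVal s) := by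
      rw [he.fil_eq_span hn (ϖ.radVal_pos le_rfl one_pos),
        he.fil_eq_span hn (ϖ.radVal_pos hs hs1)]
      simp only [he.slopeIndex_eq_zero hn hs hlt', ϖ.radVal_zero, he.slopeIndex_top hn]
    have : (⟨_, hmem 0 le_rfl one_pos⟩ : H.filVertices ϖ) = ⟨_, hmem s hs hs1⟩ :=
      Subtype.ext (congrArg Vertex.mk (Subtype.ext heq))
    rw [this]
  · intro s hge hs1 ih hs _
    have hφ0 : 0 ≤ H.gaussProd ϖ s := gaussProd_nonneg hs
    have hφ1 := gaussProd_lt_one hn hs hs1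
    refine (ih hφ0 hφ1).trans ?_
    set Λ : Lattice F (H.ratTate ϖ) := ⟨_, hL s hs hs1⟩ with hΛ
    set Λ' : Lattice F (H.ratTate ϖ) := ⟨_, hL _ hφ0 hφ1⟩ with hΛ'
    by_cases heq : Vertex.mk Λ = Vertex.mk Λ'
    · have : (⟨_, hmem _ hφ0 hφ1⟩ : H.filVertices ϖ) = ⟨_, hmem s hs hs1⟩ := Subtype.ext heq.symm
      rw [this]
    refine SimpleGraph.Reachable.symm (SimpleGraph.Adj.reachable ?_)
    change Vertex.mk Λ ≠ Vertex.mk Λ' ∧ IsSimplex ϖ {Vertex.mk Λ, Vertex.mk Λ'}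
    have hφs : H.gaussProd ϖ s ≤ s := by
      obtain ⟨z₀, hz₀, -⟩ := exists_max_torsion hn
      refine (gaussProd_le_mul hn hs hs1.le hz₀).trans ?_
      exact mul_le_of_le_one_right hs (max_le (nrm_lt_one _).le hs1.le)
    have hle : Λ'.1 ≤ Λ.1 := fun x hx =>
      (mem_fil_radVal hs).2 (((mem_fil_radVal hφ0).1 hx).trans hφs)
    have hlt : Λ'.1 < Λ.1 := lt_of_le_of_ne hle fun h => heq (congrArg _ (Subtype.ext h.symm))
    have hlt' : ϖ.val • Λ.1 < Λ'.1 := by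
      refine lt_of_le_of_ne (uniformizer_smul_fil_le hn hs) fun h => heq (Quotient.sound ?_)
      exact ⟨Units.mk0 (ϖ.val : F) ϖ.ne_zero,
        by rw [← h, uniformizer_smul_fil_eq_units_smul]⟩
    refine ⟨heq, 1, ![Λ, Λ'], ?_, hlt', ?_⟩
    · rw [Fin.strictAnti_iff_succ_lt]
      intro i
      fin_cases i
      exact hlt
    · ext y
      simp [Fin.exists_fin_two, eq_comm]

end Diagonal

end FormalModule

end

end Ramification

theorem mainTheorem3 {p : ℕ} [Fact p.Prime] {F K : Type*}
    [NormedField F] [IsUltrametricDist F] [NormedAlgebra ℚ_[p] F] [FiniteDimensional ℚ_[p] F]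
    [NormedField K] [IsUltrametricDist K] [CompleteSpace K] [IsAlgClosed K] [NormedAlgebra F K]
    (ϖ : Ramification.Uniformizer F) (H : Ramification.FormalModule F K)
    (n : ℕ) (hn : H.HasHeight ϖ n) :
    (∀ μ : EReal, 0 < μ → Submodule.IsLattice F (H.fil ϖ μ)) ∧
    H.fil ϖ ⊤ = H.tate ϖ ∧
    (H.filVertices ϖ).Finite ∧
    (∃ (hT : Submodule.IsLattice F (H.tate ϖ)) (e : Module.Basis (Fin n) F (H.ratTate ϖ)),
      H.filVertices ϖ ⊆ Ramification.apartment ϖ e ∧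
      ∃ Q : Set (Ramification.Vertex F (H.ratTate ϖ)),
        Ramification.IsSector ϖ e (Ramification.Vertex.mk ⟨H.tate ϖ, hT⟩) Q ∧
        H.filVertices ϖ ⊆ Q) ∧
    ((Ramification.skeleton (H.ratTate ϖ) ϖ).induce (H.filVertices ϖ)).Connected ∧
    (∃ e : Module.Basis (Fin n) (Ramification.IntRing F) (H.tate ϖ), H.IsAdapted ϖ e) ∧
    (∀ e : Module.Basis (Fin n) (Ramification.IntRing F) (H.tate ϖ), H.IsAdapted ϖ e →
      ∀ μ : EReal, 0 < μ →
        Antitone (fun i : Fin n => H.slopeIndex ϖ i μ) ∧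
        H.fil ϖ μ = Submodule.span (Ramification.IntRing F) (Set.range fun i : Fin n =>
          ((ϖ.val : F) ^ H.slopeIndex ϖ i μ)⁻¹ • (e i : H.ratTate ϖ))) := by
  have : ProperSpace F := FiniteDimensional.proper ℚ_[p] F
  obtain ⟨e, he⟩ := Ramification.FormalModule.exists_isMinimalBasis hn
  obtain ⟨hT, Q, hQ⟩ := he.isSector hn
  refine ⟨fun μ hμ => he.isLattice_fil hn hμ, Ramification.FormalModule.fil_top,
    he.filVertices_finite hn,
    ⟨hT, Ramification.FormalModule.ratTateBasis e, he.filVertices_subset_apartment hn, Q, hQ⟩,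
    he.filVertices_connected hn, ⟨e, he.isAdapted hn⟩, fun e' he' μ hμ => ?_⟩
  have h := he'.isMinimalBasis hn
  exact ⟨h.slopeIndex_antitone hn hμ, h.fil_eq_span hn hμ⟩
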